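/- Let $R>0$, $\varepsilon>0$, $\tau\in\mathbb R$ and $\sigma=\tau\varepsilon^4$. On $H^1=\mathbb C\times\mathbb R$, with points $(z,t)$, $z=x+iy$, consider the Riemannian metric for which the vector fields \[ X=\tfrac1\varepsilon\big(\partial_x+\sigma y\,\partial_t\big),\qquad Y=\tfrac1\varepsilon\big(\partial_y-\sigma x\,\partial_t\big),\qquad T=\varepsilon^2\partial_t \] are orthonormal. Let $\mathcal A$ be its Riemannian surface area and $\mathcal L^3$ the Lebesgue measure (which is its Riemannian volume). For $0\le r\le R$ put \[ \omega(r)=\sqrt{1+\tau^2\varepsilon^2r^2},\qquad p(r;R)=\tau\varepsilon\,\frac{\sqrt{R^2-r^2}}{\omega(r)},\qquad f(r;R)=\frac{\varepsilon^2}{2\tau}\Big[\omega(R)^2\arctan p(r;R)+\omega(r)^2p(r;R)\Big], \] where for $\tau=0$ the last expression is replaced by its limit $f(r;R)=\varepsilon^3\sqrt{R^2-r^2}$. Let \[ \Sigma_R=\{(z,t):|z|\le R,\ |t|=f(|z|;R)\},\qquad E_R=\{(z,t):|z|<R,\ |t|<f(|z|;R)\}, \] and, for $0\le\delta<R$, \[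 C_{R,\delta}=\{(z,t):|z|<R,\ t>f(R-\delta;R)\}. \] Set $k_{R\varepsilon\tau}=\varepsilon^3\omega(R)\sqrt R$ and \[ C_{R\varepsilon\tau}=\frac1{4\pi\varepsilon R^3\big(Rk_{R\varepsilon\tau}+f(0;R)\big)},\qquad D_{R\varepsilon\tau}=\frac1{12\varepsilon\pi^2R^5\big(4Rk_{R\varepsilon\tau}^2+f(0;R)^2\big)}. \] Let $E\subset H^1$ be an open set with smooth boundary $\Sigma=\partial E$ (near each of its boundary points, $E$ is the sublevel set $\{\varphi<0\}$ of a smooth function $\varphi$ that vanishes and has nonzero differential at that point) such that $\mathcal L^3(E)=\mathcal L^3(E_R)$. Then $\mathcal A(\Sigma_R)<\infty$ and the following hold. (i) If $0<\delta<R$ and the closure of $E\Delta E_R$ is a compact subset of $C_{R,\delta}$, then \[ \mathcal A(\Sigma)-\mathcal A(\Sigma_R)\ \ge\ \sqrt\delta\;C_{R\varepsilon\tau}\;\mathcal L^3(E\Delta E_R)^2 . \] (ii) If the closure of $E\Delta E_R$ is a compact subset of $C_{R,0}$, then \[ \mathcal A(\Sigma)-\mathcal A(\Sigma_R)\ \ge\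 D_{R\varepsilon\tau}\;\mathcal L^3(E\Delta E_R)^3 . \] -/

import Mathlib

open MeasureTheory Set
open scoped ContDiff ENNReal

noncomputable section

/-- The underlying manifold of the group in the coordinates `(z, t)`, with `z = x + i y`. Its
standard measure `volume` is the three-dimensional Lebesgue measure. -/
abbrev Heis : Type := ℂ × ℝ

namespace Heis

/-- The parameter `σ = τ ε ^ 4`. -/
def sigma (ε τ : ℝ) : ℝ := τ * ε ^ 4

/-- The left-invariant field `X = ε⁻¹ (∂/∂x + σ y ∂/∂t)`. -/
def frameX (ε τ : ℝ) (p : Heis) : Heis := (1 / ε : ℝ) • ((1 : ℂ), sigma ε τ * p.1.im)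

/-- The left-invariant field `Y = ε⁻¹ (∂/∂y - σ x ∂/∂t)`. -/
def frameY (ε τ : ℝ) (p : Heis) : Heis := (1 / ε : ℝ) • (Complex.I, -(sigma ε τ * p.1.re))

/-- The left-invariant field `T = ε² ∂/∂t`. -/
def frameT (ε : ℝ) (_p : Heis) : Heis := ε ^ 2 • ((0 : ℂ), (1 : ℝ))

/-- The coefficient of `X` in the expansion of the tangent vector `v` in the frame `X, Y, T`. -/
def coordX (ε : ℝ) (v : Heis) : ℝ := ε * v.1.re

/-- The coefficient of `Y` in the expansion of the tangent vector `v` in the frame `X, Y, T`. -/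
def coordY (ε : ℝ) (v : Heis) : ℝ := ε * v.1.im

/-- The coefficient of `T` in the expansion of the tangent vector `v` at `p` in the frame
`X, Y, T`. -/
def coordT (ε τ : ℝ) (p v : Heis) : ℝ :=
  (v.2 - sigma ε τ * (p.1.im * v.1.re - p.1.re * v.1.im)) / ε ^ 2

/-- `coordX`, `coordY`, `coordT` are the coefficients with respect to the frame `X, Y, T`. -/
theorem frame_expansion {ε : ℝ} (hε : 0 < ε) (τ : ℝ) (p v : Heis) :
    coordX ε v • frameX ε τ p + coordY ε v • frameY ε τ p + coordT ε τ p v • frameT ε p = v := by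
  have h : ε ≠ 0 := hε.ne'
  refine Prod.ext (Complex.ext ?_ ?_) ?_
  · simp [coordX, coordY, coordT, frameX, frameY, frameT]
    field_simp
  · simp [coordX, coordY, coordT, frameX, frameY, frameT]
    field_simp
  · simp [coordX, coordY, coordT, frameX, frameY, frameT]
    field_simp
    ring

/-- The left-invariant Riemannian metric `⟨v, w⟩` at the point `p` that makes `X, Y, T`
orthonormal. -/
def metric (ε τ : ℝ) (p v w : Heis) : ℝ :=
  coordX ε v * coordX ε w + coordY ε v * coordY ε w + coordT ε τ p v * coordT ε τ p w

/-- The frame `X, Y, T` is orthonormal for `metric`. -/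
theorem metric_frame {ε : ℝ} (hε : 0 < ε) (τ : ℝ) (p : Heis) :
    metric ε τ p (frameX ε τ p) (frameX ε τ p) = 1 ∧
    metric ε τ p (frameY ε τ p) (frameY ε τ p) = 1 ∧
    metric ε τ p (frameT ε p) (frameT ε p) = 1 ∧
    metric ε τ p (frameX ε τ p) (frameY ε τ p) = 0 ∧
    metric ε τ p (frameX ε τ p) (frameT ε p) = 0 ∧
    metric ε τ p (frameY ε τ p) (frameT ε p) = 0 := by
  have h : ε ≠ 0 := hε.ne'
  refine ⟨?_, ?_, ?_, ?_, ?_, ?_⟩ <;>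
    simp [metric, coordX, coordY, coordT, frameX, frameY, frameT, h] <;> field_simp <;> simp

/-- `ψ : U → S` is a smooth local parametrization of the surface `S`: an injective immersion of an
open set `U` of the plane with values in `S`. -/
structure IsLocalParametrization (S : Set Heis) (U : Set (ℝ × ℝ)) (ψ : ℝ × ℝ → Heis) : Prop where
  isOpen : IsOpen U
  contDiffOn : ContDiffOn ℝ ∞ ψ U
  injOn : InjOn ψ U
  immersion : ∀ u ∈ U, Function.Injective (fderiv ℝ ψ u)
  mapsTo : MapsTo ψ U S

/-- The Riemannian area density `√ det (⟨∂ᵢψ, ∂ⱼψ⟩)` of a parametrization `ψ`. -/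
def areaDensity (ε τ : ℝ) (ψ : ℝ × ℝ → Heis) (u : ℝ × ℝ) : ℝ :=
  let v := fderiv ℝ ψ u (1, 0)
  let w := fderiv ℝ ψ u (0, 1)
  √(metric ε τ (ψ u) v v * metric ε τ (ψ u) w w - metric ε τ (ψ u) v w ^ 2)

/-- The area measure of the piece `ψ(U)` of a parametrized surface: the image under `ψ` of
`√ det (⟨∂ᵢψ, ∂ⱼψ⟩) du` on `U`. -/
def patchMeasure (ε τ : ℝ) (U : Set (ℝ × ℝ)) (ψ : ℝ × ℝ → Heis) : Measure Heis :=
  Measure.map ψ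
    ((volume.restrict U).withDensity fun u => ENNReal.ofReal (areaDensity ε τ ψ u))

/-- The Riemannian surface-area measure of the surface `S`: the measure glued from the area
measures of all local parametrizations of `S`. These agree on overlaps, so that their least upper
bound is the measure which restricts to each of them. -/
def surfaceMeasure (ε τ : ℝ) (S : Set Heis) : Measure Heis :=
  sSup {μ | ∃ U ψ, IsLocalParametrization S U ψ ∧ μ = patchMeasure ε τ U ψ}

/-- The Riemannian area of the surface `S`. -/
def area (ε τ : ℝ) (S : Set Heis) : ℝ≥0∞ := surfaceMeasure ε τ S univ

/-- `E` is open with smooth boundary: near each boundary point it is the sublevel set `{φ < 0}` of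
a smooth function `φ` with nonvanishing differential at that point. -/
def IsSmoothOpen (E : Set Heis) : Prop :=
  IsOpen E ∧ ∀ p ∈ frontier E, ∃ (U : Set Heis) (φ : Heis → ℝ), IsOpen U ∧ p ∈ U ∧
    ContDiffOn ℝ ∞ φ U ∧ φ p = 0 ∧ fderiv ℝ φ p ≠ 0 ∧ E ∩ U = {q | q ∈ U ∧ φ q < 0}

/-- `A ⊂⊂ B`: the closure of `A` is compact and contained in `B`. -/
def CompactlyContained (A B : Set Heis) : Prop := IsCompact (closure A) ∧ closure A ⊆ B

/-- `ω(r) = √(1 + τ² ε² r²)`. -/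
def omega (ε τ r : ℝ) : ℝ := √(1 + τ ^ 2 * ε ^ 2 * r ^ 2)

/-- `p(r; R) = τ ε √(R² - r²) / ω(r)`. -/
def slope (ε τ r R : ℝ) : ℝ := τ * ε * √(R ^ 2 - r ^ 2) / omega ε τ r

/-- The profile function `f(r; R)`, `0 ≤ r ≤ R`, of the sphere `Σ_R`. The value at `τ = 0` is the
limit of the formula as `τ → 0`. -/
def profile (ε τ r R : ℝ) : ℝ :=
  if τ = 0 then ε ^ 3 * √(R ^ 2 - r ^ 2)
  else ε ^ 2 / (2 * τ) *
    (omega ε τ R ^ 2 * Real.arctan (slope ε τ r R) + omega ε τ r ^ 2 * slope ε τ r R)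

/-- The sphere `Σ_R` with constant mean curvature `1 / (ε R)`. -/
def sphere (ε τ R : ℝ) : Set Heis := {p | ‖p.1‖ ≤ R ∧ |p.2| = profile ε τ ‖p.1‖ R}

/-- The open domain `E_R` bounded by `Σ_R`. -/
def domain (ε τ R : ℝ) : Set Heis := {p | |p.2| < profile ε τ ‖p.1‖ R ∧ ‖p.1‖ < R}

/-- The half-cylinder `C_{R,δ}`. -/
def halfCylinder (ε τ R δ : ℝ) : Set Heis := {p | ‖p.1‖ < R ∧ profile ε τ (R - δ) R < p.2}

/-- `k_{Rετ} = ε³ ω(R) √R`. -/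
def constK (R ε τ : ℝ) : ℝ := ε ^ 3 * omega ε τ R * √R

/-- `C_{Rετ} = 1 / (4 π ε R³ (R k_{Rετ} + f(0; R)))`. -/
def constC (R ε τ : ℝ) : ℝ :=
  1 / (4 * Real.pi * ε * R ^ 3 * (R * constK R ε τ + profile ε τ 0 R))

/-- `D_{Rετ} = 1 / (12 ε π² R⁵ (4 R k_{Rετ}² + f(0; R)²))`. -/
def constD (R ε τ : ℝ) : ℝ :=
  1 / (12 * ε * Real.pi ^ 2 * R ^ 5 * (4 * R * constK R ε τ ^ 2 + profile ε τ 0 R ^ 2))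

end Heis

end

/-! The proof is a calibration argument. On the half-cylinder one builds a `C¹` field `V` of
Riemannian length one that is the outward normal along the upper half of `Σ_R`, has divergence
exactly `2/(εR)` on and above `Σ_R`, and has divergence at most `2/(εR)` minus a quantified gain
below it. The frame `X, Y, T` has Euclidean determinant one and Lebesgue measure is the Riemannian
volume, so the Riemannian divergence is the Euclidean one.

Let `χ` be a cutoff equal to `1` near the closure of `E Δ E_R` and supported in the half-cylinder.
The divergence theorem for `χV` gives `∫ χ dΣ_R ≤ ∫_{E_R} div(χV)`, because `V` is normal there
(`lintegral_sphere_le`), and `∫_E div(χV) ≤ ∫ χ dΣ`, because `|V| = 1`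
(`ofReal_setIntegral_divergence_le`). Where `χ ≠ 1` the sphere lies in `∂E`, so the weight `1 - χ`
costs nothing. Since `E` and `E_R` have equal volume, subtracting leaves `A(Σ) - A(Σ_R) ≥ ∫_{E_R \
E} (2/(εR) - div V)`, which is `area_sphere_add_le`.

The field is the unit normal of a sphere of radius `n ≥ R` passing through the point with Euclidean
depth `M = √(n² - r²)`. Its divergence is `2/(εn)` minus a term measuring how `n` changes along the
profile of that sphere (`divergence_calibField`). Above `Σ_R` the leaves are vertical translates, so
`M = w := √(R² - r²)`. Below, the leaf is chosen as if the profiles were Euclidean: with `a` the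
depth of `Σ_R` at the rim `r₀ = R - δ`, and `θ` a smoothed positive part of `d = (f - t)/(ε³ω(R))`,
the radius solves `√(n² - r²) - √(n² - r₀²) = w - a - θ`. This is explicit in `M`. For `τ ≠ 0` the
leaves are not exact spheres, but the error term in the divergence has a favourable sign because `f`
varies with respect to the depth at rate at most `ε³ω(R)`.

Elementary inequalities then bound `1 - R/n` below by a multiple of `aθ` (`mul_le_of_leaf`), or of
`θ²` when `δ = 0` and `a = 0` (`sq_le_of_leaf`). Finally, among sets of given volume under the graph
of `f`, a layer along the graph minimizes the integral of a power of the gap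
(`volume_pow_le_setIntegral_gap`). This turns the pointwise gain into the powers `2` and `3` of the
volume. -/

noncomputable section

namespace Heis

open Topology Filter

/-! ### The divergence theorem for subgraphs -/

/-- The Euclidean divergence of a vector field on `Heis`. -/
def divergence (F : Heis → Heis) (p : Heis) : ℝ :=
  (fderiv ℝ F p (1, 0)).1.re + (fderiv ℝ F p (Complex.I, 0)).1.im + (fderiv ℝ F p (0, 1)).2

theorem continuous_divergence {F : Heis → Heis} (hF : ContDiff ℝ 1 F) :
    Continuous (divergence F) := by
  have h := hF.continuous_fderiv one_ne_zero
  unfold divergence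
  fun_prop

theorem divergence_eq_zero_of_notMem_tsupport {F : Heis → Heis} {p : Heis}
    (hp : p ∉ tsupport F) : divergence F p = 0 := by
  have h : fderiv ℝ F p = 0 := by
    by_contra h
    exact hp (support_fderiv_subset ℝ h)
  simp [divergence, h]

theorem hasCompactSupport_divergence {F : Heis → Heis} (hc : HasCompactSupport F) :
    HasCompactSupport (divergence F) :=
  HasCompactSupport.intro' hc (isClosed_tsupport F)
    fun _ hp => divergence_eq_zero_of_notMem_tsupport hp

theorem integrable_divergence {F : Heis → Heis} (hF : ContDiff ℝ 1 F)
    (hc : HasCompactSupport F) : Integrable (divergence F) :=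
  (continuous_divergence hF).integrable_of_hasCompactSupport (hasCompactSupport_divergence hc)

theorem divergence_congr {F G : Heis → Heis} {p : Heis} (h : F =ᶠ[𝓝 p] G) :
    divergence F p = divergence G p := by
  simp only [divergence, h.fderiv_eq]

theorem integral_fderiv_apply_eq_zero {f : ℂ → ℝ} (hf : ContDiff ℝ 1 f)
    (hc : HasCompactSupport f) (v : ℂ) : ∫ z, fderiv ℝ f z v = 0 := by
  have hi : Integrable (fun z => fderiv ℝ f z v) :=
    ((hf.continuous_fderiv one_ne_zero).clm_apply continuous_const).integrable_of_hasCompactSupport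
      ((hc.fderiv ℝ).comp_left (g := fun L : ℂ →L[ℝ] ℝ => L v) (by simp))
  have := integral_mul_fderiv_eq_neg_fderiv_mul_of_integrable (μ := (volume : Measure ℂ))
    (f := fun _ : ℂ => (1 : ℝ)) (g := f) (v := v) (by simp) (by simpa using hi)
    (by simpa using hf.continuous.integrable_of_hasCompactSupport hc) (by simp)
    (fun x _ => hf.differentiable one_ne_zero x)
  simpa using this

theorem hasCompactSupport_slice_left {H : Heis → Heis} (hc : HasCompactSupport H) (t : ℝ) :
    HasCompactSupport fun z => H (z, t) := by
  refine HasCompactSupport.intro (hc.isCompact.image continuous_fst) fun z hz => ?_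
  by_contra h
  exact hz ⟨(z, t), subset_tsupport _ h, rfl⟩

theorem hasCompactSupport_slice_right {H : Heis → Heis} (hc : HasCompactSupport H) (z : ℂ) :
    HasCompactSupport fun t => H (z, t) := by
  refine HasCompactSupport.intro (hc.isCompact.image continuous_snd) fun t ht => ?_
  by_contra h
  exact ht ⟨(z, t), subset_tsupport _ h, rfl⟩

/-- On each horizontal slice the derivatives of a compactly supported function integrate to zero; on
each vertical half-line the fundamental theorem of calculus leaves the value at height `0`. -/
theorem integral_divergence_halfspace {H : Heis → Heis} (hH : ContDiff ℝ 1 H)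
    (hc : HasCompactSupport H) :
    ∫ p in {p : Heis | p.2 < 0}, divergence H p = ∫ z, (H (z, 0)).2 := by
  have hd := hH.differentiable one_ne_zero
  have hcont := hH.continuous_fderiv one_ne_zero
  have hint : ∀ (v : Heis) (ℓ : Heis →L[ℝ] ℝ), Integrable (fun p => ℓ (fderiv ℝ H p v)) := by
    intro v ℓ
    refine Continuous.integrable_of_hasCompactSupport (by fun_prop) ?_
    exact (hc.fderiv ℝ).comp_left (g := fun L : Heis →L[ℝ] Heis => ℓ (L v)) (by simp)
  let ℓre : Heis →L[ℝ] ℝ := Complex.reCLM ∘L ContinuousLinearMap.fst ℝ ℂ ℝ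
  let ℓim : Heis →L[ℝ] ℝ := Complex.imCLM ∘L ContinuousLinearMap.fst ℝ ℂ ℝ
  let ℓt : Heis →L[ℝ] ℝ := ContinuousLinearMap.snd ℝ ℂ ℝ
  have hset : {p : Heis | p.2 < 0} = univ ×ˢ Iio (0 : ℝ) := by ext; simp
  have hhor : ∀ (v : ℂ) (ℓ : Heis →L[ℝ] ℝ),
      ∫ p in {p : Heis | p.2 < 0}, ℓ (fderiv ℝ H p (v, 0)) = 0 := by
    intro v ℓ
    rw [hset, Measure.volume_eq_prod, ← Measure.prod_restrict, integral_prod_symm]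
    · have : ∀ t, ∫ z, ℓ (fderiv ℝ H (z, t) (v, 0)) ∂(volume.restrict univ) = 0 := by
        intro t
        have h1 : ∀ z, HasFDerivAt (fun z => ℓ (H (z, t)))
            (ℓ ∘L fderiv ℝ H (z, t) ∘L ContinuousLinearMap.inl ℝ ℂ ℝ) z := fun z =>
          ℓ.hasFDerivAt.comp z ((hd (z, t)).hasFDerivAt.comp z (hasFDerivAt_prodMk_left z t))
        have h2 := integral_fderiv_apply_eq_zero (f := fun z => ℓ (H (z, t)))
          (by fun_prop) ((hasCompactSupport_slice_left hc t).comp_left (map_zero ℓ)) v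
        rw [Measure.restrict_univ]
        refine (integral_congr_ae (.of_forall fun z => ?_)).trans h2
        simp only [(h1 z).fderiv]
        rfl
      simp only [this, integral_zero]
    · rw [Measure.prod_restrict, ← Measure.volume_eq_prod]
      exact (hint (v, 0) ℓ).integrableOn
  have hver : ∫ p in {p : Heis | p.2 < 0}, ℓt (fderiv ℝ H p (0, 1)) = ∫ z, (H (z, 0)).2 := by
    rw [hset, Measure.volume_eq_prod, setIntegral_prod]
    · rw [Measure.restrict_univ]
      refine integral_congr_ae (.of_forall fun z => ?_)
      have h1 : ∀ t, HasDerivAt (fun t => (H (z, t)).2) (ℓt (fderiv ℝ H (z, t) (0, 1))) t :=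
        fun t => (ℓt.hasFDerivAt.comp t
          ((hd (z, t)).hasFDerivAt.comp t (hasFDerivAt_prodMk_right z t))).hasDerivAt
      have h2 := HasCompactSupport.integral_Iic_deriv_eq (f := fun t => (H (z, t)).2)
        (by fun_prop) ((hasCompactSupport_slice_right hc z).comp_left (g := Prod.snd) rfl) 0
      simp only [fun t => (h1 t).deriv] at h2
      exact integral_Iic_eq_integral_Iio.symm.trans h2
    · rw [← Measure.volume_eq_prod]
      exact (hint (0, 1) ℓt).integrableOn
  have e : ∀ p, divergence H p = ℓre (fderiv ℝ H p (1, 0)) + ℓim (fderiv ℝ H p (Complex.I, 0))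
      + ℓt (fderiv ℝ H p (0, 1)) := fun p => rfl
  simp only [e]
  have h1 := integral_add (hint (1, 0) ℓre).restrict (hint (Complex.I, 0) ℓim).restrict
    (μ := volume.restrict {p : Heis | p.2 < 0})
  have h2 := integral_add ((hint (1, 0) ℓre).add (hint (Complex.I, 0) ℓim)).restrict
    (hint (0, 1) ℓt).restrict (μ := volume.restrict {p : Heis | p.2 < 0})
  simp only [Pi.add_apply] at h2
  rw [h2, h1, hhor, hhor, hver]
  simp

theorem map_eq_re_mul_add_im_mul (L : ℂ →L[ℝ] ℝ) (v : ℂ) :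
    L v = v.re * L 1 + v.im * L Complex.I := by
  have h : v = v.re • 1 + v.im • Complex.I := by apply Complex.ext <;> simp
  conv_lhs => rw [h]
  rw [map_add, map_smul, map_smul, smul_eq_mul, smul_eq_mul]

/-- The divergence theorem for the subgraph of a smooth function. -/
theorem integral_divergence_subgraph {F : Heis → Heis} (hF : ContDiff ℝ 1 F)
    (hc : HasCompactSupport F) {g : ℂ → ℝ} (hg : ContDiff ℝ ∞ g) :
    ∫ p in {p : Heis | p.2 < g p.1}, divergence F p
      = ∫ z, ((F (z, g z)).2 - fderiv ℝ g z (F (z, g z)).1) := by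
  have hgd : Differentiable ℝ g := hg.differentiable (by simp)
  have hFd := hF.differentiable one_ne_zero
  have hg1 : ContDiff ℝ 1 g := hg.of_le (by norm_cast)
  have hg2 : ContDiff ℝ 1 (fderiv ℝ g) := hg.fderiv_right (by norm_cast)
  -- This volume-preserving map flattens the graph of `g` to the plane at height `0`.
  let Φ : Heis ≃ₜ Heis :=
    { toFun := fun p => (p.1, g p.1 + p.2)
      invFun := fun p => (p.1, p.2 - g p.1)
      left_inv := fun p => by simp
      right_inv := fun p => by simp
      continuous_toFun := by have := hg.continuous; fun_prop
      continuous_invFun := by have := hg.continuous; fun_prop }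
  have hΦ1 : ContDiff ℝ 1 Φ := by
    change ContDiff ℝ 1 fun p : Heis => (p.1, g p.1 + p.2)
    fun_prop
  have hΦm : MeasurePreserving Φ (volume : Measure Heis) volume := by
    have := MeasurePreserving.skew_product (μa := (volume : Measure ℂ)) (μb := volume)
      (μc := (volume : Measure ℝ)) (μd := volume) (f := id) (MeasurePreserving.id _)
      (g := fun z t => g z + t) (by have := hg.continuous.measurable; fun_prop)
      (.of_forall fun z => map_add_left_eq_self volume (g z))
    exact this
  -- `H` is `DΦ⁻¹` applied to `F ∘ Φ`. As `Φ` has Jacobian one, this transform preserves divergence,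
  -- and the vertical component of `H` at height `0` is the flux density of `F` through the graph.
  let H : Heis → Heis := fun p => ((F (Φ p)).1, (F (Φ p)).2 - fderiv ℝ g p.1 (F (Φ p)).1)
  have hH : ContDiff ℝ 1 H := by
    have h1 : ContDiff ℝ 1 fun p => F (Φ p) := hF.comp hΦ1
    have h2 : ContDiff ℝ 1 fun p : Heis => fderiv ℝ g p.1 := hg2.comp contDiff_fst
    exact h1.fst.prodMk (h1.snd.sub (h2.clm_apply h1.fst))
  have hHc : HasCompactSupport H := by
    have h1 : HasCompactSupport fun p => F (Φ p) := hc.comp_homeomorph Φ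
    refine HasCompactSupport.intro h1 fun p hp => ?_
    have : F (Φ p) = 0 := by
      by_contra h
      exact hp (subset_tsupport _ h)
    simp [H, this]
  have hdiv : ∀ p, divergence H p = divergence F (Φ p) := by
    intro p
    have hΦ' : HasFDerivAt Φ ((ContinuousLinearMap.fst ℝ ℂ ℝ).prod
        (fderiv ℝ g p.1 ∘L ContinuousLinearMap.fst ℝ ℂ ℝ + ContinuousLinearMap.snd ℝ ℂ ℝ)) p := by
      change HasFDerivAt (fun p : Heis => (p.1, g p.1 + p.2)) _ p
      exact hasFDerivAt_fst.prodMk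
        (((hgd p.1).hasFDerivAt.comp p hasFDerivAt_fst).add hasFDerivAt_snd)
    have hFΦ := (hFd (Φ p)).hasFDerivAt.comp p hΦ'
    have hg' : HasFDerivAt (fun p : Heis => fderiv ℝ g p.1) _ p :=
      ((hg2.differentiable one_ne_zero p.1).hasFDerivAt.comp p hasFDerivAt_fst)
    have hH' : HasFDerivAt H _ p := hFΦ.fst.prodMk (hFΦ.snd.sub (hg'.clm_apply hFΦ.fst))
    set D := fderiv ℝ F (Φ p)
    have e1 : ∀ v : ℂ × ℝ, D v = D (v.1, 0) + v.2 • D (0, 1) := fun v => by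
      rw [← map_smul, ← map_add]; simp
    have e2 := map_eq_re_mul_add_im_mul (fderiv ℝ g p.1)
    unfold divergence
    rw [hH'.fderiv]
    change _ = (D (1, 0)).1.re + (D (Complex.I, 0)).1.im + (D (0, 1)).2
    simp only [ContinuousLinearMap.coe_comp, Function.comp_apply,
      ContinuousLinearMap.prod_apply, add_apply, sub_apply,
      ContinuousLinearMap.coe_fst', ContinuousLinearMap.coe_snd', ContinuousLinearMap.flip_apply,
      map_zero, zero_apply, add_zero, zero_add]
    rw [e1 (1, _), e1 (Complex.I, _)]
    simp [e2 (D _).1]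
    ring
  have key := integral_divergence_halfspace hH hHc
  have hpre : Φ ⁻¹' {p : Heis | p.2 < g p.1} = {p : Heis | p.2 < 0} := by
    ext p
    change g p.1 + p.2 < g p.1 ↔ p.2 < 0
    simp
  rw [← hΦm.setIntegral_preimage_emb Φ.measurableEmbedding, hpre]
  simp only [← hdiv]
  rw [key]
  refine integral_congr_ae (.of_forall fun z => ?_)
  simp [H, Φ]

theorem integral_divergence_eq_zero {F : Heis → Heis} (hF : ContDiff ℝ 1 F)
    (hc : HasCompactSupport F) : ∫ p, divergence F p = 0 := by
  obtain ⟨b, hb⟩ := (hc.isCompact.image continuous_snd).bddAbove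
  -- A horizontal plane above the support of `F` carries no flux.
  have h := integral_divergence_subgraph hF hc (g := fun _ => b + 1) contDiff_const
  have h0 : ∀ z, F (z, b + 1) = 0 := fun z => by
    by_contra h
    have := hb ⟨(z, b + 1), subset_tsupport _ h, rfl⟩
    simp at this
    linarith
  simp only [h0] at h
  rw [← setIntegral_eq_integral_of_forall_compl_eq_zero (s := {p : Heis | p.2 < b + 1}), h]
  · simp
  · intro p hp
    refine divergence_eq_zero_of_notMem_tsupport fun hp' => hp ?_
    have := hb ⟨p, hp', rfl⟩
    simp only [mem_ofPred_eq]
    linarith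

/-! ### Smooth boundaries as local graphs -/

theorem isInvertible_of_apply_one_ne_zero {L : ℝ →L[ℝ] ℝ} (h : L 1 ≠ 0) : L.IsInvertible := by
  refine ⟨ContinuousLinearEquiv.unitsEquivAut ℝ (Units.mk0 (L 1) h), ?_⟩
  ext
  simp

/-- Near a zero at which the vertical derivative is positive, the negativity set of a smooth
function is the subgraph of a globally defined smooth function. -/
theorem exists_subgraph_of_vertical_deriv_pos {φ : Heis → ℝ} {U : Set Heis} (hU : IsOpen U)
    (hφ : ContDiffOn ℝ ∞ φ U) {q₀ : Heis} (hq₀ : q₀ ∈ U) (h0 : φ q₀ = 0)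
    (hpos : 0 < fderiv ℝ φ q₀ (0, 1)) :
    ∃ (W : Set Heis) (g : ℂ → ℝ), IsOpen W ∧ q₀ ∈ W ∧ W ⊆ U ∧ ContDiff ℝ ∞ g ∧
      ∀ q ∈ W, (φ q < 0 ↔ q.2 < g q.1) ∧ (φ q = 0 ↔ q.2 = g q.1) := by
  have hat : ∀ q ∈ U, ContDiffAt ℝ ∞ φ q := fun q hq => hφ.contDiffAt (hU.mem_nhds hq)
  have hinv : ∀ q, 0 < fderiv ℝ φ q (0, 1) →
      (fderiv ℝ φ q ∘L ContinuousLinearMap.inr ℝ ℂ ℝ).IsInvertible := fun q hq =>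
    isInvertible_of_apply_one_ne_zero (by simpa using hq.ne')
  have hcont : ContinuousOn (fun q => fderiv ℝ φ q (0, 1)) U :=
    (hφ.continuousOn_fderiv_of_isOpen hU (by simp)).clm_apply continuousOn_const
  have hVopen : IsOpen (U ∩ (fun q => fderiv ℝ φ q (0, 1)) ⁻¹' Ioi 0) :=
    hcont.isOpen_inter_preimage hU isOpen_Ioi
  obtain ⟨ρ, hρ, hball⟩ := Metric.isOpen_iff.1 hVopen q₀ ⟨hq₀, hpos⟩
  have hne : (∞ : WithTop ℕ∞) ≠ 0 := by simp
  set g₀ : ℂ → ℝ := (hat q₀ hq₀).implicitFunction hne (hinv q₀ hpos) with hg₀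
  have hg₀q : g₀ q₀.1 = q₀.2 := (hat q₀ hq₀).implicitFunction_apply_self hne (hinv q₀ hpos)
  have hg₀s : ContDiffAt ℝ ∞ g₀ q₀.1 :=
    (hat q₀ hq₀).contDiffAt_implicitFunction hne (hinv q₀ hpos)
  have hev0 : ∀ᶠ z in 𝓝 q₀.1, φ (z, g₀ z) = 0 := by
    have := (hat q₀ hq₀).eventually_apply_implicitFunction hne (hinv q₀ hpos)
    simpa only [h0] using this
  have hevc : ∀ᶠ z in 𝓝 q₀.1, ContinuousAt g₀ z :=
    ((hg₀s.of_le (m := 1) (by norm_cast)).eventually (by simp)).mono fun z hz => hz.continuousAt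
  have hevb : ∀ᶠ z in 𝓝 q₀.1, (z, g₀ z) ∈ Metric.ball q₀ ρ := by
    have : ContinuousAt (fun z => (z, g₀ z)) q₀.1 := continuousAt_id.prodMk hg₀s.continuousAt
    refine this.eventually_mem (Metric.isOpen_ball.mem_nhds ?_)
    simp only [hg₀q]
    exact Metric.mem_ball_self hρ
  -- Smoothness of order `∞` at one point does not by itself spread to a neighbourhood. At each
  -- nearby point `g₀` coincides with the implicit function based at that point, which is smooth
  -- there.
  have hevs : ∀ᶠ z in 𝓝 q₀.1, ContDiffAt ℝ ∞ g₀ z := by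
    filter_upwards [hev0, hev0.eventually_nhds, hevc, hevb] with z hz0 hz0' hzc hzb
    have hzV := hball hzb
    have hcd := hat _ hzV.1
    have hii := hinv _ hzV.2
    have heq := hcd.eventually_apply_eq_iff_implicitFunction hne hii
    have ht : Tendsto (fun z' => (z', g₀ z')) (𝓝 z) (𝓝 (z, g₀ z)) :=
      (continuousAt_id.prodMk hzc)
    refine (hcd.contDiffAt_implicitFunction hne hii).congr_of_eventuallyEq ?_
    filter_upwards [ht.eventually heq, hz0'] with z' h1 h2
    exact (h1.1 (h2.trans hz0.symm)).symm
  obtain ⟨r, hr, hrball⟩ := Metric.eventually_nhds_iff_ball.1 (hev0.and (hevb.and hevs))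
  -- The plateau of radius `r/3` leaves `g₀` unchanged over the chosen neighbourhood; the support of
  -- radius `r/2 < r` stays where `g₀` is smooth, so the product extends by zero.
  let f : ContDiffBump q₀.1 := ⟨r / 3, r / 2, by positivity, by linarith⟩
  refine ⟨Metric.ball q₀ ρ ∩ Prod.fst ⁻¹' Metric.ball q₀.1 (r / 3), fun z => f z * g₀ z,
    Metric.isOpen_ball.inter (Metric.isOpen_ball.preimage continuous_fst),
    ⟨Metric.mem_ball_self hρ, Metric.mem_ball_self (by positivity)⟩,
    fun q hq => (hball hq.1).1, ?_, ?_⟩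
  · refine contDiff_iff_contDiffAt.2 fun z => ?_
    by_cases hz : z ∈ Metric.ball q₀.1 r
    · exact f.contDiff.contDiffAt.mul (hrball z hz).2.2
    · have hz' : z ∉ tsupport f := by
        rw [f.tsupport_eq]
        intro h
        refine hz (Metric.closedBall_subset_ball (?_ : r / 2 < r) h)
        linarith
      have : (fun z => f z * g₀ z) =ᶠ[𝓝 z] fun _ => 0 := by
        filter_upwards [notMem_tsupport_iff_eventuallyEq.1 hz'] with y hy
        simp [hy]
      exact contDiffAt_const.congr_of_eventuallyEq this
  · rintro ⟨z, s⟩ ⟨hq, hz⟩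
    have hz : z ∈ Metric.ball q₀.1 (r / 3) := hz
    have hzr : z ∈ Metric.ball q₀.1 r := Metric.ball_subset_ball (by linarith) hz
    have hf1 : f z = 1 := f.one_of_mem_closedBall (Metric.ball_subset_closedBall hz)
    obtain ⟨e0, e1, -⟩ := hrball z hzr
    have hbp : Metric.ball q₀ ρ = Metric.ball q₀.1 ρ ×ˢ Metric.ball q₀.2 ρ := by
      rw [ball_prod_same]
    rw [hbp] at e1 hq
    have hmono : StrictMonoOn (fun s => φ (z, s)) (Metric.ball q₀.2 ρ) := by
      have hmem : ∀ s ∈ Metric.ball q₀.2 ρ, (z, s) ∈ U ∩ (fun q => fderiv ℝ φ q (0, 1)) ⁻¹' Ioi 0 :=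
        fun s hs => hball (by rw [hbp]; exact ⟨hq.1, hs⟩)
      have hd : ∀ s ∈ Metric.ball q₀.2 ρ,
          HasDerivAt (fun s => φ (z, s)) (fderiv ℝ φ (z, s) (0, 1)) s := fun s hs =>
        (((hat _ (hmem s hs).1).differentiableAt hne).hasFDerivAt.comp s
          (hasFDerivAt_prodMk_right z s)).hasDerivAt
      refine strictMonoOn_of_deriv_pos (convex_ball _ _)
        (fun s hs => (hd s hs).continuousAt.continuousWithinAt) fun s hs => ?_
      have hs := interior_subset hs
      rw [(hd s hs).deriv]
      exact (hmem s hs).2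
    have hlt := hmono.lt_iff_lt hq.2 e1.2
    have heq := hmono.injOn.eq_iff hq.2 e1.2
    simp only [e0] at hlt heq
    simp only [hf1, one_mul]
    exact ⟨hlt, heq⟩

/-! ### Shears, sheared graphs and flux -/

/-- The shear `(z, s) ↦ (z + s c, s)`. -/
def shear (c : ℂ) : Heis ≃L[ℝ] Heis :=
  ContinuousLinearEquiv.equivOfInverse
    ((ContinuousLinearMap.fst ℝ ℂ ℝ + (ContinuousLinearMap.snd ℝ ℂ ℝ).smulRight c).prod
      (ContinuousLinearMap.snd ℝ ℂ ℝ))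
    ((ContinuousLinearMap.fst ℝ ℂ ℝ - (ContinuousLinearMap.snd ℝ ℂ ℝ).smulRight c).prod
      (ContinuousLinearMap.snd ℝ ℂ ℝ))
    (fun p => by simp) (fun p => by simp)

theorem shear_apply (c : ℂ) (p : Heis) : shear c p = (p.1 + p.2 • c, p.2) := rfl

theorem shear_symm_apply (c : ℂ) (p : Heis) : (shear c).symm p = (p.1 - p.2 • c, p.2) := rfl

theorem measurePreserving_shear (c : ℂ) :
    MeasurePreserving (shear c) (volume : Measure Heis) volume := by
  have h := MeasurePreserving.skew_product (μa := (volume : Measure ℝ)) (μb := volume)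
    (μc := (volume : Measure ℂ)) (μd := volume) (f := id) (MeasurePreserving.id _)
    (g := fun s z => z + s • c) (by fun_prop)
    (.of_forall fun s => map_add_right_eq_self volume (s • c))
  have h1 := (Measure.measurePreserving_swap (μ := (volume : Measure ℂ))
    (ν := (volume : Measure ℝ)))
  have h2 := (Measure.measurePreserving_swap (μ := (volume : Measure ℝ))
    (ν := (volume : Measure ℂ)))
  exact h2.comp (h.comp h1)

/-- The divergence is a trace, hence invariant under conjugation by a linear isomorphism. -/
theorem divergence_conj_shear {F : Heis → Heis} (hF : Differentiable ℝ F) (c : ℂ) (p : Heis) :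
    divergence (fun p => (shear c).symm (F (shear c p))) p = divergence F (shear c p) := by
  have h : HasFDerivAt (fun p => (shear c).symm (F (shear c p)))
      (((shear c).symm : Heis →L[ℝ] Heis) ∘L fderiv ℝ F (shear c p) ∘L
        (shear c : Heis →L[ℝ] Heis)) p :=
    (shear c).symm.hasFDerivAt.comp p
      ((hF _).hasFDerivAt.comp p (shear c).hasFDerivAt)
  unfold divergence
  rw [h.fderiv]
  set D := fderiv ℝ F (shear c p)
  have e : D (c, 1) = c.re • D (1, 0) + c.im • D (Complex.I, 0) + D (0, 1) := by
    rw [← map_smul, ← map_smul, ← map_add, ← map_add]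
    congr 1
    ext <;> simp
  simp [shear_apply, shear_symm_apply, e]
  ring

/-- The Euclidean triple product of three tangent vectors. -/
def tripleProduct (F v w : Heis) : ℝ :=
  F.1.re * (v.1.im * w.2 - v.2 * w.1.im) - F.1.im * (v.1.re * w.2 - v.2 * w.1.re)
    + F.2 * (v.1.re * w.1.im - v.1.im * w.1.re)

/-- The squared area of the parallelogram spanned by two tangent vectors. -/
def gram (ε τ : ℝ) (p v w : Heis) : ℝ :=
  metric ε τ p v v * metric ε τ p w w - metric ε τ p v w ^ 2

/-- Because the frame has Euclidean determinant one, the triple product is `⟨F, v × w⟩` in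
orthonormal coordinates. The bound is Cauchy–Schwarz; the squares supplied at the end are those of
Lagrange's identity. -/
theorem abs_tripleProduct_le {ε : ℝ} (hε : 0 < ε) (τ : ℝ) (p F v w : Heis) :
    |tripleProduct F v w| ≤ √(metric ε τ p F F) * √(gram ε τ p v w) := by
  have hm : 0 ≤ metric ε τ p F F := by
    unfold metric
    nlinarith [sq_nonneg (coordX ε F), sq_nonneg (coordY ε F), sq_nonneg (coordT ε τ p F)]
  have hdet : tripleProduct F v w =
      coordX ε F * (coordY ε v * coordT ε τ p w - coordT ε τ p v * coordY ε w)
      - coordY ε F * (coordX ε v * coordT ε τ p w - coordT ε τ p v * coordX ε w)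
      + coordT ε τ p F * (coordX ε v * coordY ε w - coordY ε v * coordX ε w) := by
    unfold tripleProduct coordX coordY coordT
    field_simp
    ring
  rw [← Real.sqrt_mul hm, hdet]
  refine Real.abs_le_sqrt ?_
  unfold gram metric
  generalize coordX ε F = a
  generalize coordY ε F = b
  generalize coordT ε τ p F = c
  generalize coordX ε v = v₁
  generalize coordY ε v = v₂
  generalize coordT ε τ p v = v₃
  generalize coordX ε w = w₁
  generalize coordY ε w = w₂
  generalize coordT ε τ p w = w₃
  linarith [sq_nonneg (b * (v₁ * w₂ - v₂ * w₁) + c * (v₁ * w₃ - v₃ * w₁)),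
    sq_nonneg (c * (v₂ * w₃ - v₃ * w₂) - a * (v₁ * w₂ - v₂ * w₁)),
    sq_nonneg (-a * (v₁ * w₃ - v₃ * w₁) - b * (v₂ * w₃ - v₃ * w₂))]

/-- The graph of `g` over the plane `ℂ`, in the direction `(c, 1)`. -/
def shearedGraph (c : ℂ) (g : ℂ → ℝ) (u : ℝ × ℝ) : Heis :=
  shear c (Complex.equivRealProdCLM.symm u, g (Complex.equivRealProdCLM.symm u))

theorem contDiff_shearedGraph (c : ℂ) {g : ℂ → ℝ} (hg : ContDiff ℝ ∞ g) :
    ContDiff ℝ ∞ (shearedGraph c g) := by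
  have h := Complex.equivRealProdCLM.symm.contDiff (n := ∞)
  exact (shear c).contDiff.comp (h.prodMk (hg.comp h))

theorem fderiv_shearedGraph (c : ℂ) {g : ℂ → ℝ} {u : ℝ × ℝ}
    (hg : DifferentiableAt ℝ g (Complex.equivRealProdCLM.symm u)) (v : ℝ × ℝ) :
    fderiv ℝ (shearedGraph c g) u v = shear c (Complex.equivRealProdCLM.symm v,
      fderiv ℝ g (Complex.equivRealProdCLM.symm u) (Complex.equivRealProdCLM.symm v)) := by
  have h := (Complex.equivRealProdCLM.symm.hasFDerivAt (x := u))
  have h2 := (shear c).hasFDerivAt.comp u (h.prodMk (hg.hasFDerivAt.comp u h))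
  have h3 : HasFDerivAt (shearedGraph c g) _ u := h2
  rw [h3.fderiv]
  rfl

theorem equivRealProdCLM_symm_fst : Complex.equivRealProdCLM.symm (1, 0) = 1 := by
  apply Complex.ext <;> simp

theorem equivRealProdCLM_symm_snd : Complex.equivRealProdCLM.symm (0, 1) = Complex.I := by
  apply Complex.ext <;> simp

theorem integral_comp_equivRealProdCLM_symm (f : ℂ → ℝ) :
    ∫ u, f (Complex.equivRealProdCLM.symm u) = ∫ z, f z :=
  Complex.volume_preserving_equiv_real_prod.symm.integral_comp
    Complex.measurableEquivRealProd.symm.measurableEmbedding f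

theorem lintegral_comp_equivRealProdCLM_symm (f : ℂ → ℝ≥0∞) :
    ∫⁻ u, f (Complex.equivRealProdCLM.symm u) = ∫⁻ z, f z :=
  Complex.volume_preserving_equiv_real_prod.symm.lintegral_comp_emb
    Complex.measurableEquivRealProd.symm.measurableEmbedding f

/-- The flux form of the divergence theorem for the sheared subgraph of a smooth function. -/
theorem integral_divergence_sheared_subgraph {F : Heis → Heis} (hF : ContDiff ℝ 1 F)
    (hc : HasCompactSupport F) (c : ℂ) {g : ℂ → ℝ} (hg : ContDiff ℝ ∞ g) :
    ∫ p in {p : Heis | p.2 < g (p.1 - p.2 • c)}, divergence F p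
      = ∫ u, tripleProduct (F (shearedGraph c g u)) (fderiv ℝ (shearedGraph c g) u (1, 0))
          (fderiv ℝ (shearedGraph c g) u (0, 1)) := by
  set G : Heis → Heis := fun p => (shear c).symm (F (shear c p)) with hGdef
  have hG : ContDiff ℝ 1 G := (shear c).symm.contDiff.comp (hF.comp (shear c).contDiff)
  have hGc : HasCompactSupport G := by
    have h1 : HasCompactSupport fun p => F (shear c p) :=
      hc.comp_homeomorph (shear c).toHomeomorph
    exact h1.comp_left (map_zero _)
  have key := integral_divergence_subgraph hG hGc hg
  have hpre : (shear c) ⁻¹' {p : Heis | p.2 < g (p.1 - p.2 • c)} = {p : Heis | p.2 < g p.1} := by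
    ext p
    simp [shear_apply]
  rw [← (measurePreserving_shear c).setIntegral_preimage_emb
    (shear c).toHomeomorph.measurableEmbedding, hpre]
  simp only [hGdef, divergence_conj_shear (hF.differentiable one_ne_zero)] at key
  rw [key, ← integral_comp_equivRealProdCLM_symm]
  refine integral_congr_ae (.of_forall fun u => ?_)
  have hgd := hg.differentiable (by simp) (Complex.equivRealProdCLM.symm u)
  simp only [fderiv_shearedGraph c hgd, equivRealProdCLM_symm_fst, equivRealProdCLM_symm_snd]
  rw [map_eq_re_mul_add_im_mul]
  simp only [tripleProduct, shear_apply, shear_symm_apply, shearedGraph]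
  simp
  ring

theorem shearedGraph_injective (c : ℂ) (g : ℂ → ℝ) : Function.Injective (shearedGraph c g) := by
  intro u v h
  have := congrArg Prod.fst ((shear c).injective h)
  exact Complex.equivRealProdCLM.symm.injective this

theorem isLocalParametrization_shearedGraph {S W : Set Heis} (hW : IsOpen W) (c : ℂ) {g : ℂ → ℝ}
    (hg : ContDiff ℝ ∞ g) (h : ∀ p ∈ W, p.2 = g (p.1 - p.2 • c) → p ∈ S) :
    IsLocalParametrization S (shearedGraph c g ⁻¹' W) (shearedGraph c g) where
  isOpen := hW.preimage (contDiff_shearedGraph c hg).continuous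
  contDiffOn := (contDiff_shearedGraph c hg).contDiffOn
  injOn := (shearedGraph_injective c g).injOn
  immersion u _ v w hvw := by
    have hgd := hg.differentiable (by simp) (Complex.equivRealProdCLM.symm u)
    rw [fderiv_shearedGraph c hgd, fderiv_shearedGraph c hgd] at hvw
    have := congrArg Prod.fst ((shear c).injective hvw)
    exact Complex.equivRealProdCLM.symm.injective this
  mapsTo u hu := h _ hu (by simp [shearedGraph, shear_apply])

theorem areaDensity_eq (ε τ : ℝ) (ψ : ℝ × ℝ → Heis) (u : ℝ × ℝ) :
    areaDensity ε τ ψ u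
      = √(gram ε τ (ψ u) (fderiv ℝ ψ u (1, 0)) (fderiv ℝ ψ u (0, 1))) := rfl

theorem continuous_areaDensity (ε τ : ℝ) {ψ : ℝ × ℝ → Heis} (hψ : ContDiff ℝ ∞ ψ) :
    Continuous (areaDensity ε τ ψ) := by
  have h0 := hψ.continuous
  have h1 : Continuous fun u => fderiv ℝ ψ u (1, 0) :=
    (hψ.continuous_fderiv (by simp)).clm_apply continuous_const
  have h2 : Continuous fun u => fderiv ℝ ψ u (0, 1) :=
    (hψ.continuous_fderiv (by simp)).clm_apply continuous_const
  simp only [funext (areaDensity_eq ε τ ψ), gram, metric, coordX, coordY, coordT]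
  fun_prop

/-- The Riemannian length of a tangent vector. -/
def riemNorm (ε τ : ℝ) (p v : Heis) : ℝ := √(metric ε τ p v v)

theorem continuous_riemNorm (ε τ : ℝ) {F : Heis → Heis} (hF : Continuous F) :
    Continuous fun p => riemNorm ε τ p (F p) := by
  unfold riemNorm metric coordX coordY coordT
  fun_prop

theorem riemNorm_smul (ε τ : ℝ) (p : Heis) {a : ℝ} (ha : 0 ≤ a) (v : Heis) :
    riemNorm ε τ p (a • v) = a * riemNorm ε τ p v := by
  have : metric ε τ p (a • v) (a • v) = a ^ 2 * metric ε τ p v v := by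
    simp only [metric, coordX, coordY, coordT, Prod.smul_fst, Prod.smul_snd, Complex.smul_re,
      Complex.smul_im, smul_eq_mul]
    ring
  rw [riemNorm, this, Real.sqrt_mul (sq_nonneg _), Real.sqrt_sq ha, riemNorm]

theorem patchMeasure_le_surfaceMeasure {ε τ : ℝ} {S : Set Heis} {U : Set (ℝ × ℝ)}
    {ψ : ℝ × ℝ → Heis} (h : IsLocalParametrization S U ψ) :
    patchMeasure ε τ U ψ ≤ surfaceMeasure ε τ S :=
  le_sSup ⟨U, ψ, h, rfl⟩

theorem lintegral_patchMeasure (ε τ : ℝ) {U : Set (ℝ × ℝ)} {ψ : ℝ × ℝ → Heis}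
    (hψ : ContDiff ℝ ∞ ψ) {f : Heis → ℝ≥0∞} (hf : Measurable f) :
    ∫⁻ p, f p ∂(patchMeasure ε τ U ψ)
      = ∫⁻ u in U, ENNReal.ofReal (areaDensity ε τ ψ u) * f (ψ u) := by
  unfold patchMeasure
  rw [lintegral_map hf hψ.continuous.measurable,
    lintegral_withDensity_eq_lintegral_mul _
      (continuous_areaDensity ε τ hψ).measurable.ennreal_ofReal
      (show Measurable fun u => f (ψ u) from hf.comp hψ.continuous.measurable)]
  rfl

/-- The flux through a piece of graph is bounded by the integral of the length of the field. -/
theorem ofReal_integral_abs_tripleProduct_le {ε : ℝ} (hε : 0 < ε) (τ : ℝ) {S W : Set Heis}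
    (hW : IsOpen W) (c : ℂ) {g : ℂ → ℝ} (hg : ContDiff ℝ ∞ g)
    (hS : ∀ p ∈ W, p.2 = g (p.1 - p.2 • c) → p ∈ S) {F : Heis → Heis} (hF : ContDiff ℝ 1 F)
    (hFW : tsupport F ⊆ W) :
    ENNReal.ofReal |∫ u, tripleProduct (F (shearedGraph c g u))
        (fderiv ℝ (shearedGraph c g) u (1, 0)) (fderiv ℝ (shearedGraph c g) u (0, 1))|
      ≤ ∫⁻ p, ENNReal.ofReal (riemNorm ε τ p (F p)) ∂(surfaceMeasure ε τ S) := by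
  set ψ := shearedGraph c g with hψdef
  have hψ : ContDiff ℝ ∞ ψ := contDiff_shearedGraph c hg
  have hU : IsOpen (ψ ⁻¹' W) := hW.preimage hψ.continuous
  have hmeas : Measurable fun p => ENNReal.ofReal (riemNorm ε τ p (F p)) :=
    (continuous_riemNorm ε τ hF.continuous).measurable.ennreal_ofReal
  -- Only the trivial direction, a patch measure lying below the supremum, is needed for this bound.
  refine le_trans ?_ (lintegral_mono' (patchMeasure_le_surfaceMeasure
    (isLocalParametrization_shearedGraph hW c hg hS)) le_rfl)
  rw [lintegral_patchMeasure ε τ hψ hmeas, ← lintegral_indicator hU.measurableSet,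
    ← Real.norm_eq_abs, ofReal_norm]
  refine (enorm_integral_le_lintegral_enorm _).trans (lintegral_mono fun u => ?_)
  by_cases hu : ψ u ∈ W
  · rw [indicator_of_mem (show u ∈ ψ ⁻¹' W from hu), ← ofReal_norm, Real.norm_eq_abs,
      areaDensity_eq, ← ENNReal.ofReal_mul (Real.sqrt_nonneg _), mul_comm]
    exact ENNReal.ofReal_le_ofReal (abs_tripleProduct_le hε τ (ψ u) _ _ _)
  · have h0 : F (ψ u) = 0 := by
      by_contra h
      exact hu (hFW (subset_tsupport _ h))
    simp [h0, tripleProduct]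

/-! ### The one-sided divergence theorem for smooth open sets -/

/-- The flux bound of the divergence theorem for a set and fields supported in `W`. -/
def FluxBoundOn (ε τ : ℝ) (E W : Set Heis) : Prop :=
  ∀ F : Heis → Heis, ContDiff ℝ 1 F → HasCompactSupport F → tsupport F ⊆ W →
    ENNReal.ofReal (∫ p in E, divergence F p)
      ≤ ∫⁻ p, ENNReal.ofReal (riemNorm ε τ p (F p)) ∂(surfaceMeasure ε τ (frontier E))

theorem setIntegral_divergence_congr {A B W : Set Heis} (hA : MeasurableSet A)
    (hB : MeasurableSet B) {F : Heis → Heis} (hFW : tsupport F ⊆ W)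
    (h : ∀ p ∈ W, p ∈ A ↔ p ∈ B) :
    ∫ p in A, divergence F p = ∫ p in B, divergence F p := by
  rw [← integral_indicator hA, ← integral_indicator hB]
  congr 1
  ext p
  by_cases hp : p ∈ W
  · by_cases hpA : p ∈ A
    · simp [hpA, (h p hp).1 hpA]
    · simp [hpA, mt (h p hp).2 hpA]
  · have := divergence_eq_zero_of_notMem_tsupport fun h => hp (hFW h)
    simp [indicator, this]

theorem fluxBoundOn_of_subgraph {ε : ℝ} (hε : 0 < ε) (τ : ℝ) {E W : Set Heis} (hE : IsOpen E)
    (hW : IsOpen W) (c : ℂ) {g : ℂ → ℝ} (hg : ContDiff ℝ ∞ g)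
    (hS : ∀ p ∈ W, p.2 = g (p.1 - p.2 • c) → p ∈ frontier E)
    (hEW : (∀ p ∈ W, p ∈ E ↔ p.2 < g (p.1 - p.2 • c)) ∨
      (∀ p ∈ W, p ∈ E ↔ ¬ p.2 ≤ g (p.1 - p.2 • c))) :
    FluxBoundOn ε τ E W := by
  intro F hF hc hFW
  refine le_trans (ENNReal.ofReal_le_ofReal ?_)
    (ofReal_integral_abs_tripleProduct_le hε τ hW c hg hS hF hFW)
  have hcont : Continuous fun p : Heis => g (p.1 - p.2 • c) := by
    have := hg.continuous
    fun_prop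
  have hlt : MeasurableSet {p : Heis | p.2 < g (p.1 - p.2 • c)} :=
    (isOpen_lt continuous_snd hcont).measurableSet
  have hle : MeasurableSet {p : Heis | p.2 ≤ g (p.1 - p.2 • c)} :=
    (isClosed_le continuous_snd hcont).measurableSet
  rw [← integral_divergence_sheared_subgraph hF hc c hg]
  rcases hEW with h | h
  · rw [setIntegral_divergence_congr hE.measurableSet hlt hFW h]
    exact le_abs_self _
  -- When `E` lies above the graph, the total integral of the divergence is zero, so its integral
  -- over `E` is minus that over the subgraph, up to the null graph itself. The absolute value in
  -- the flux bound absorbs the sign.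
  · have hnull : ({p : Heis | p.2 ≤ g (p.1 - p.2 • c)} : Set Heis) =ᵐ[volume]
        {p : Heis | p.2 < g (p.1 - p.2 • c)} := by
      have h0 : volume ((shear c) '' {p : Heis | p.2 = g p.1}) = 0 := by
        have hg0 : volume {p : Heis | p.2 = g p.1} = 0 := by
          have hm : MeasurableSet {p : Heis | p.2 = g p.1} :=
            measurableSet_eq_fun measurable_snd (hg.continuous.measurable.comp measurable_fst)
          rw [Measure.volume_eq_prod, Measure.measure_prod_null hm]
          refine .of_forall fun z => ?_
          have : Prod.mk z ⁻¹' {p : Heis | p.2 = g p.1} = {g z} := by ext; simp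
          simp [this]
        have h1 := (measurePreserving_shear c).measure_preimage_emb
          (shear c).toHomeomorph.measurableEmbedding ((shear c) '' {p : Heis | p.2 = g p.1})
        rw [preimage_image_eq _ (shear c).injective, hg0] at h1
        exact h1.symm
      have hsub : {p : Heis | p.2 = g (p.1 - p.2 • c)} ⊆ (shear c) '' {p : Heis | p.2 = g p.1} :=
        fun p hp => ⟨(shear c).symm p, by simpa [shear_symm_apply] using hp, by simp⟩
      have hne : ∀ᵐ p : Heis, p ∉ {p : Heis | p.2 = g (p.1 - p.2 • c)} :=
        measure_eq_zero_iff_ae_notMem.1 (measure_mono_null hsub h0)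
      filter_upwards [hne] with p hp
      exact propext ⟨fun h => lt_of_le_of_ne h hp, fun h => le_of_lt h⟩
    have hcompl := integral_add_compl hle (integrable_divergence hF hc)
    rw [integral_divergence_eq_zero hF hc, setIntegral_congr_set hnull] at hcompl
    rw [setIntegral_divergence_congr hE.measurableSet hle.compl hFW h]
    rw [eq_neg_of_add_eq_zero_right hcompl]
    exact neg_le_abs _

/-- The vectors `(c, 1)` span the space. Hence every smooth boundary is locally a graph in one of
these directions, and a shear makes that direction vertical. -/
theorem exists_direction {L : Heis →L[ℝ] ℝ} (hL : L ≠ 0) : ∃ c : ℂ, L (c, 1) ≠ 0 := by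
  by_contra! h
  refine hL (ContinuousLinearMap.ext fun p => ?_)
  have h1 : L (p.1, 0) = 0 := by
    have := map_sub L (p.1, 1) (0, 1)
    simpa [h] using this
  have h2 : L (0, 1) = 0 := h 0
  have h3 : p = (p.1, 0) + p.2 • (0, 1) := by ext <;> simp
  rw [h3, map_add, map_smul, h1, h2]
  simp

theorem exists_fluxBoundOn_of_mem_frontier {ε : ℝ} (hε : 0 < ε) (τ : ℝ) {E : Set Heis}
    (hE : IsSmoothOpen E) {p : Heis} (hp : p ∈ frontier E) :
    ∃ W, IsOpen W ∧ p ∈ W ∧ FluxBoundOn ε τ E W := by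
  obtain ⟨U, φ, hU, hpU, hφ, hφp, hdφ, hEU⟩ := hE.2 p hp
  obtain ⟨c, hc⟩ := exists_direction hdφ
  -- The sign `s` records whether `E` lies below or above its local graph.
  obtain ⟨s, hs, hspos⟩ : ∃ s : ℝ, (s = 1 ∨ s = -1) ∧ 0 < s * fderiv ℝ φ p (c, 1) := by
    rcases hc.lt_or_gt with h | h
    · exact ⟨-1, .inr rfl, by linarith⟩
    · exact ⟨1, .inl rfl, by linarith⟩
  set φ' : Heis → ℝ := fun q => s * φ (shear c q) with hφ'
  set q₀ := (shear c).symm p with hq₀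
  have hsq₀ : shear c q₀ = p := by simp [hq₀]
  have hpre : IsOpen (shear c ⁻¹' U) := hU.preimage (shear c).continuous
  have hφ's : ContDiffOn ℝ ∞ φ' (shear c ⁻¹' U) :=
    contDiffOn_const.mul (hφ.comp (shear c).contDiff.contDiffOn fun _ h => h)
  have hder : fderiv ℝ φ' q₀ (0, 1) = s * fderiv ℝ φ p (c, 1) := by
    have h1 : DifferentiableAt ℝ φ (shear c q₀) := by
      rw [hsq₀]
      exact (hφ.contDiffAt (hU.mem_nhds hpU)).differentiableAt (by simp)
    have h2 := (h1.hasFDerivAt.comp q₀ (shear c).hasFDerivAt).const_mul s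
    have h3 : HasFDerivAt φ' _ q₀ := h2
    rw [h3.fderiv]
    simp [shear_apply, hsq₀]
  obtain ⟨W, g, hWo, hq₀W, hWU, hg, hW⟩ := exists_subgraph_of_vertical_deriv_pos hpre hφ's
    (show q₀ ∈ shear c ⁻¹' U by simpa [hsq₀] using hpU) (by simp [hφ', hsq₀, hφp])
    (by rw [hder]; exact hspos)
  have hW' : ∀ p ∈ (shear c).symm ⁻¹' W, p ∈ U ∧ (s * φ p < 0 ↔ p.2 < g (p.1 - p.2 • c)) ∧
      (φ p = 0 ↔ p.2 = g (p.1 - p.2 • c)) := by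
    intro p hp
    have h1 := hWU hp
    have h2 := hW _ hp
    have hs0 : s ≠ 0 := by rcases hs with h | h <;> simp [h]
    simp only [hφ', ContinuousLinearEquiv.apply_symm_apply, mul_eq_zero, hs0, false_or] at h2
    simp only [mem_preimage, ContinuousLinearEquiv.apply_symm_apply] at h1
    exact ⟨h1, h2⟩
  have hEiff : ∀ p ∈ U, p ∈ E ↔ φ p < 0 := fun p hp => by
    have := Set.ext_iff.1 hEU p
    simpa [hp] using this
  have hopen : IsOpen ((shear c).symm ⁻¹' W) := hWo.preimage (shear c).symm.continuous
  refine ⟨(shear c).symm ⁻¹' W, hopen, hq₀W, fluxBoundOn_of_subgraph hε τ hE.1 hopen c hg ?_ ?_⟩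
  · intro q hq hqg
    obtain ⟨hqU, hqlt, hq0⟩ := hW' q hq
    have hφq := hq0.2 hqg
    have hqE : q ∉ E := fun h => by
      have := (hEiff q hqU).1 h
      linarith
    refine ⟨?_, fun h => hqE (interior_subset h)⟩
    -- Moving along `(c, 1)` keeps the base point `q.1 - q.2 • c` fixed, so only the height relative
    -- to the graph changes, and the sign sends the moving point into `E`.
    have hline : Tendsto (fun η : ℝ => q - (s * η) • ((c, 1) : Heis)) (𝓝[>] 0) (𝓝 q) := by
      have : Continuous fun η : ℝ => q - (s * η) • ((c, 1) : Heis) := by fun_prop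
      have h := this.tendsto 0
      simp only [mul_zero, zero_smul, sub_zero] at h
      exact h.mono_left nhdsWithin_le_nhds
    refine mem_closure_of_tendsto hline ?_
    filter_upwards [hline.eventually_mem (hopen.mem_nhds hq), self_mem_nhdsWithin] with η h1 h2
    obtain ⟨h3, h4, h5⟩ := hW' _ h1
    rw [hEiff _ h3]
    have hη : (0 : ℝ) < η := h2
    have e : (q - (s * η) • ((c, 1) : Heis)).1 - (q - (s * η) • ((c, 1) : Heis)).2 • c
        = q.1 - q.2 • c := by
      simp [sub_mul]
    rw [e, ← hqg] at h4 h5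
    rcases hs with rfl | rfl
    · simpa using h4.2 (by simpa using hη)
    · have h6 : ¬ (-1 * φ (q - (-1 * η) • ((c, 1) : Heis)) < 0) := fun h => by
        have := h4.1 h
        simp at this
        linarith
      have h7 : φ (q - (-1 * η) • ((c, 1) : Heis)) ≠ 0 := fun h => by
        have := h5.1 h
        simp at this
        linarith
      refine lt_of_le_of_ne ?_ h7
      linarith
  · rcases hs with rfl | rfl
    · left
      intro q hq
      obtain ⟨hqU, hqlt, hq0⟩ := hW' q hq
      rw [hEiff q hqU, ← hqlt, one_mul]
    · right
      intro q hq
      obtain ⟨hqU, hqlt, hq0⟩ := hW' q hq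
      rw [hEiff q hqU, le_iff_lt_or_eq, ← hqlt, ← hq0, ← neg_one_mul, not_or, not_lt]
      constructor
      · intro h
        exact ⟨by linarith, h.ne⟩
      · rintro ⟨h, h'⟩
        exact lt_of_le_of_ne (by linarith) h'

/-- Off the boundary the flux bound is trivial: inside `E` the total integral of the divergence
vanishes, and outside the closure the domain of integration misses the support. -/
theorem exists_fluxBoundOn {ε : ℝ} (hε : 0 < ε) (τ : ℝ) {E : Set Heis}
    (hE : IsSmoothOpen E) (p : Heis) : ∃ W, IsOpen W ∧ p ∈ W ∧ FluxBoundOn ε τ E W := by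
  by_cases hp : p ∈ frontier E
  · exact exists_fluxBoundOn_of_mem_frontier hε τ hE hp
  by_cases hpE : p ∈ E
  · refine ⟨E, hE.1, hpE, fun F hF hc hFE => ?_⟩
    rw [setIntegral_divergence_congr hE.1.measurableSet MeasurableSet.univ hFE
      fun p hp => by simp [hp], setIntegral_univ, integral_divergence_eq_zero hF hc]
    simp
  · refine ⟨(closure E)ᶜ, isClosed_closure.isOpen_compl, fun h => hp ⟨h, fun h' =>
      hpE (interior_subset h')⟩, fun F hF hc hFE => ?_⟩
    rw [setIntegral_divergence_congr hE.1.measurableSet MeasurableSet.empty hFE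
      fun p hp => by simpa using fun h => hp (subset_closure h)]
    simp

theorem divergence_finset_sum {ι : Type*} (s : Finset ι) {F : ι → Heis → Heis}
    (hF : ∀ i ∈ s, Differentiable ℝ (F i)) (p : Heis) :
    divergence (fun p => ∑ i ∈ s, F i p) p = ∑ i ∈ s, divergence (F i) p := by
  unfold divergence
  rw [fderiv_fun_sum fun i hi => hF i hi p]
  simp [Prod.fst_sum, Prod.snd_sum, Finset.sum_add_distrib]

theorem tsupport_fun_smul_subset {V V' : Type*} [TopologicalSpace V] [AddCommGroup V']
    [Module ℝ V'] (a : V → ℝ) (F : V → V') : tsupport (fun p => a p • F p) ⊆ tsupport a :=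
  closure_mono fun p hp ha => hp (by simp [ha])

theorem hasCompactSupport_fun_smul {V V' : Type*} [TopologicalSpace V] [AddCommGroup V']
    [Module ℝ V'] (a : V → ℝ) {F : V → V'} (hF : HasCompactSupport F) :
    HasCompactSupport fun p => a p • F p :=
  hF.mono fun p hp hF => hp (by simp [hF])

theorem exists_smooth_partition {V ι : Type*} [NormedAddCommGroup V] [NormedSpace ℝ V]
    [FiniteDimensional ℝ V] [Fintype ι] {s : Set V} (hs : IsClosed s) (W : ι → Set V)
    (hW : ∀ i, IsOpen (W i)) (hsW : s ⊆ ⋃ i, W i) :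
    ∃ f : ι → V → ℝ, (∀ i, ContDiff ℝ ∞ (f i)) ∧ (∀ i p, 0 ≤ f i p) ∧
      (∀ p ∈ s, ∑ i, f i p = 1) ∧ (∀ p, ∑ i, f i p ≤ 1) ∧ ∀ i, tsupport (f i) ⊆ W i := by
  obtain ⟨f, hf⟩ := SmoothPartitionOfUnity.exists_isSubordinate (modelWithCornersSelf ℝ V)
    hs W hW hsW
  refine ⟨fun i => f i, fun i => (f i).contMDiff.contDiff, f.nonneg, fun p hp => ?_,
    fun p => ?_, hf⟩
  · rw [← finsum_eq_sum_of_fintype]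
    exact f.sum_eq_one hp
  · rw [← finsum_eq_sum_of_fintype]
    exact f.sum_le_one p

/-- A one-sided divergence theorem: the integral of the divergence of a compactly supported field
over a smooth open set is at most the integral of its length over the boundary. -/
theorem ofReal_setIntegral_divergence_le {ε : ℝ} (hε : 0 < ε) (τ : ℝ) {E : Set Heis}
    (hE : IsSmoothOpen E) {F : Heis → Heis} (hF : ContDiff ℝ 1 F) (hc : HasCompactSupport F) :
    ENNReal.ofReal (∫ p in E, divergence F p)
      ≤ ∫⁻ p, ENNReal.ofReal (riemNorm ε τ p (F p)) ∂(surfaceMeasure ε τ (frontier E)) := by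
  choose W hWo hpW hW using exists_fluxBoundOn hε τ hE
  obtain ⟨t, ht⟩ := hc.isCompact.elim_finite_subcover W hWo
    fun p _ => mem_iUnion_of_mem p (hpW p)
  obtain ⟨f, hfsmooth, hf0, hsum, hsumle, hf⟩ := exists_smooth_partition (isClosed_tsupport F)
    (fun i : t => W i) (fun i => hWo i) (by
      rwa [← iUnion_subtype (p := (· ∈ t)) (s := fun i => W i)] at ht)
  set G : t → Heis → Heis := fun i p => f i p • F p with hG
  have hGs : ∀ i, ContDiff ℝ 1 (G i) := fun i => ((hfsmooth i).of_le (by norm_cast)).smul hF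
  have hGc : ∀ i, HasCompactSupport (G i) := fun i =>
    hasCompactSupport_fun_smul (f i) hc
  have hGW : ∀ i, tsupport (G i) ⊆ W i := fun i =>
    (tsupport_fun_smul_subset (f i) F).trans (hf i)
  have hFG : F = fun p => ∑ i, G i p := by
    ext1 p
    simp only [hG, ← Finset.sum_smul]
    by_cases hp : p ∈ tsupport F
    · rw [hsum p hp, one_smul]
    · have : F p = 0 := by
        by_contra h
        exact hp (subset_tsupport _ h)
      rw [this, smul_zero]
  have hdiv : ∀ p, divergence F p = ∑ i, divergence (G i) p := fun p => by
    conv_lhs => rw [hFG]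
    exact divergence_finset_sum _ (fun i _ => (hGs i).differentiable one_ne_zero) p
  have hnorm : ∀ i p, riemNorm ε τ p (G i p) = f i p * riemNorm ε τ p (F p) := fun i p =>
    riemNorm_smul ε τ p (hf0 i p) (F p)
  have hmeas : ∀ i, Measurable fun p => ENNReal.ofReal (riemNorm ε τ p (G i p)) := fun i =>
    (continuous_riemNorm ε τ (hGs i).continuous).measurable.ennreal_ofReal
  calc ENNReal.ofReal (∫ p in E, divergence F p)
      = ENNReal.ofReal (∑ i, ∫ p in E, divergence (G i) p) := by
        simp only [hdiv]
        rw [integral_finsetSum _ fun i _ => (integrable_divergence (hGs i) (hGc i)).restrict]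
    _ ≤ ∑ i, ENNReal.ofReal (∫ p in E, divergence (G i) p) :=
        Finset.le_sum_of_subadditive _ ENNReal.ofReal_zero.le
          (fun _ _ => ENNReal.ofReal_add_le) _ _
    _ ≤ ∑ i, ∫⁻ p, ENNReal.ofReal (riemNorm ε τ p (G i p)) ∂(surfaceMeasure ε τ (frontier E)) :=
        Finset.sum_le_sum fun i _ => hW i (G i) (hGs i) (hGc i) (hGW i)
    _ = ∫⁻ p, ∑ i, ENNReal.ofReal (riemNorm ε τ p (G i p))
          ∂(surfaceMeasure ε τ (frontier E)) :=
        (lintegral_finsetSum _ fun i _ => hmeas i).symm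
    _ ≤ ∫⁻ p, ENNReal.ofReal (riemNorm ε τ p (F p)) ∂(surfaceMeasure ε τ (frontier E)) := by
        refine lintegral_mono fun p => ?_
        rw [← ENNReal.ofReal_sum_of_nonneg
          (f := fun i => riemNorm ε τ p (G i p)) fun i _ => Real.sqrt_nonneg _]
        refine ENNReal.ofReal_le_ofReal ?_
        simp only [hnorm, ← Finset.sum_mul]
        -- The partition functions sum to at most one, so the pieces have total length at most that
        -- of `F`.
        exact mul_le_of_le_one_left (Real.sqrt_nonneg _) (hsumle p)

/-! ### Upper bounds for the surface measure -/

theorem IsLocalParametrization.measurableSet_inter_preimage {S : Set Heis} {U : Set (ℝ × ℝ)}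
    {ψ : ℝ × ℝ → Heis} (h : IsLocalParametrization S U ψ) {B : Set Heis} (hB : MeasurableSet B) :
    MeasurableSet (U ∩ ψ ⁻¹' B) := by
  have h1 : Measurable (U.domRestrict ψ) :=
    (continuousOn_iff_continuous_domRestrict.1 h.contDiffOn.continuousOn).measurable
  have h2 := h.isOpen.measurableSet.subtype_image (h1 hB)
  rwa [domRestrict_eq, preimage_comp, Subtype.image_preimage_coe] at h2

theorem patchMeasure_apply (ε τ : ℝ) {S : Set Heis} {U : Set (ℝ × ℝ)} {ψ : ℝ × ℝ → Heis}
    (h : IsLocalParametrization S U ψ) {B : Set Heis} (hB : MeasurableSet B) :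
    patchMeasure ε τ U ψ B
      = ∫⁻ u in U ∩ ψ ⁻¹' B, ENNReal.ofReal (areaDensity ε τ ψ u) := by
  have hψ : AEMeasurable ψ ((volume.restrict U).withDensity
      fun u => ENNReal.ofReal (areaDensity ε τ ψ u)) :=
    (h.contDiffOn.continuousOn.aemeasurable h.isOpen.measurableSet).mono_ac
      (withDensity_absolutelyContinuous _ _)
  rw [patchMeasure, Measure.map_apply_of_aemeasurable hψ hB, withDensity_apply',
    Measure.restrict_restrict' h.isOpen.measurableSet, inter_comm]

theorem IsLocalParametrization.inter_preimage {S S' O : Set Heis} {U : Set (ℝ × ℝ)}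
    {ψ : ℝ × ℝ → Heis} (h : IsLocalParametrization S U ψ) (hO : IsOpen O) (hS : S ∩ O ⊆ S') :
    IsLocalParametrization S' (U ∩ ψ ⁻¹' O) ψ where
  isOpen := h.contDiffOn.continuousOn.isOpen_inter_preimage h.isOpen hO
  contDiffOn := h.contDiffOn.mono inter_subset_left
  injOn := h.injOn.mono inter_subset_left
  immersion := fun u hu => h.immersion u hu.1
  mapsTo _ hu := hS ⟨h.mapsTo hu.1, hu.2⟩

/-- A measure that bounds all area measures of patches inside `O` bounds the surface measure
in `O`. -/
theorem surfaceMeasure_restrict_le {ε τ : ℝ} {S O : Set Heis} (hO : IsOpen O) {ν : Measure Heis}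
    (h : ∀ U ψ, IsLocalParametrization (S ∩ O) U ψ → patchMeasure ε τ U ψ ≤ ν) :
    (surfaceMeasure ε τ S).restrict O ≤ ν := by
  -- Restricting a supremum of measures is avoided: each patch splits into its parts in `O` and in
  -- `Oᶜ`, so the whole supremum is bounded first. Restricting this bound to `O` removes the second
  -- summand.
  have hle : surfaceMeasure ε τ S ≤ ν + (surfaceMeasure ε τ S).restrict Oᶜ := by
    refine sSup_le ?_
    rintro _ ⟨U, ψ, hψ, rfl⟩
    have hO' : IsLocalParametrization (S ∩ O) (U ∩ ψ ⁻¹' O) ψ :=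
      { hψ.inter_preimage hO (Subset.refl (S ∩ O)) with }
    rw [← Measure.restrict_add_restrict_compl (μ := patchMeasure ε τ U ψ) hO.measurableSet]
    refine add_le_add ?_ (Measure.restrict_mono_measure
      (patchMeasure_le_surfaceMeasure hψ) _)
    refine le_trans (Measure.le_iff.2 fun B hB => ?_) (h _ _ hO')
    rw [Measure.restrict_apply hB, patchMeasure_apply ε τ hψ (hB.inter hO.measurableSet),
      patchMeasure_apply ε τ hO' hB, inter_comm B, preimage_inter, inter_assoc]
  refine (Measure.restrict_mono_measure hle O).trans ?_
  rw [Measure.restrict_add, Measure.restrict_restrict hO.measurableSet, inter_compl_self,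
    Measure.restrict_empty, add_zero]
  exact Measure.restrict_le_self

/-- Used to compare the part of `Σ_R` away from `E Δ E_R` with `∂E`, which contains it. -/
theorem surfaceMeasure_restrict_le_surfaceMeasure {ε τ : ℝ} {S S' O : Set Heis} (hO : IsOpen O)
    (hS : S ∩ O ⊆ S') : (surfaceMeasure ε τ S).restrict O ≤ surfaceMeasure ε τ S' :=
  surfaceMeasure_restrict_le hO fun _ _ hψ => patchMeasure_le_surfaceMeasure
    { hψ with mapsTo := hψ.mapsTo.mono_right hS }

theorem det_eq_of_prod (L : ℝ × ℝ →L[ℝ] ℝ × ℝ) :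
    L.det = (L (1, 0)).1 * (L (0, 1)).2 - (L (0, 1)).1 * (L (1, 0)).2 := by
  rw [ContinuousLinearMap.det, ← LinearMap.det_toMatrix (Module.Basis.finTwoProd ℝ),
    Matrix.det_fin_two]
  simp [LinearMap.toMatrix_apply]

theorem gram_linear_combination (ε τ : ℝ) (p v w : Heis) (a b c d : ℝ) :
    gram ε τ p (a • v + b • w) (c • v + d • w) = (a * d - c * b) ^ 2 * gram ε τ p v w := by
  simp only [gram, metric, coordX, coordY, coordT, Prod.fst_add, Prod.snd_add, Prod.smul_fst,
    Prod.smul_snd, Complex.add_re, Complex.add_im, Complex.smul_re, Complex.smul_im, smul_eq_mul]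
  ring

/-- The Euclidean projection `(z, t) ↦ z + t c` in real coordinates. -/
def planeProj (c : ℂ) : Heis →L[ℝ] ℝ × ℝ :=
  (Complex.equivRealProdCLM : ℂ →L[ℝ] ℝ × ℝ) ∘L
    (ContinuousLinearMap.fst ℝ ℂ ℝ + (ContinuousLinearMap.snd ℝ ℂ ℝ).smulRight c)

theorem planeProj_apply (c : ℂ) (p : Heis) :
    planeProj c p = (p.1.re + p.2 * c.re, p.1.im + p.2 * c.im) := by
  simp [planeProj]

theorem isLocalParametrization_graph {h : ℂ → ℝ} {D : Set ℂ} (hD : IsOpen D)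
    (hh : ContDiffOn ℝ ∞ h D) :
    IsLocalParametrization (shearedGraph 0 h '' (Complex.equivRealProdCLM.symm ⁻¹' D))
      (Complex.equivRealProdCLM.symm ⁻¹' D) (shearedGraph 0 h) where
  isOpen := hD.preimage Complex.equivRealProdCLM.symm.continuous
  contDiffOn := by
    have h1 := Complex.equivRealProdCLM.symm.contDiff (n := ∞)
    exact (shear 0).contDiff.comp_contDiffOn
      (h1.contDiffOn.prodMk (hh.comp h1.contDiffOn fun _ h => h))
  injOn := (shearedGraph_injective 0 h).injOn
  immersion u hu v w hvw := by
    have hd : DifferentiableAt ℝ h (Complex.equivRealProdCLM.symm u) :=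
      (hh.contDiffAt (hD.mem_nhds hu)).differentiableAt (by simp)
    rw [fderiv_shearedGraph 0 hd, fderiv_shearedGraph 0 hd] at hvw
    exact Complex.equivRealProdCLM.symm.injective
      (congrArg Prod.fst ((shear 0).injective hvw))
  mapsTo := mapsTo_image _ _

/-- The area measure of any parametrization of a graph is at most that of the graph. -/
theorem patchMeasure_le_of_subset_graph {ε τ : ℝ} {h : ℂ → ℝ} {D : Set ℂ}
    (hD : IsOpen D) (hh : ContDiffOn ℝ ∞ h D) {S : Set Heis}
    (hS : ∀ p ∈ S, p.1 ∈ D ∧ p.2 = h p.1) {U : Set (ℝ × ℝ)} {ψ : ℝ × ℝ → Heis}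
    (hψ : IsLocalParametrization S U ψ) :
    patchMeasure ε τ U ψ
      ≤ patchMeasure ε τ (Complex.equivRealProdCLM.symm ⁻¹' D) (shearedGraph 0 h) := by
  set Γ := shearedGraph 0 h with hΓ
  set κ : ℝ × ℝ → ℝ × ℝ := fun u => planeProj 0 (ψ u) with hκ
  have hhd : ∀ z ∈ D, DifferentiableAt ℝ h z := fun z hz =>
    (hh.contDiffAt (hD.mem_nhds hz)).differentiableAt (by simp)
  have hψd : ∀ u ∈ U, HasFDerivAt ψ (fderiv ℝ ψ u) u := fun u hu =>
    ((hψ.contDiffOn.contDiffAt (hψ.isOpen.mem_nhds hu)).differentiableAt (by simp)).hasFDerivAt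
  have hzκ : ∀ u, Complex.equivRealProdCLM.symm (κ u) = (ψ u).1 := fun u => by
    simp only [hκ, planeProj_apply]
    apply Complex.ext <;> simp
  have hψΓ : ∀ u ∈ U, ψ u = Γ (κ u) := fun u hu => by
    obtain ⟨h1, h2⟩ := hS _ (hψ.mapsTo hu)
    rw [hΓ, shearedGraph, hzκ, ← h2, shear_apply]
    simp
  have hκd : ∀ u ∈ U, HasFDerivAt κ (planeProj 0 ∘L fderiv ℝ ψ u) u := fun u hu =>
    (planeProj 0).hasFDerivAt.comp u (hψd u hu)
  -- Here `κ` is the transition from `ψ` to graph coordinates. By the chain rule the densities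
  -- differ by the Jacobian of `κ`, and injectivity of `κ` lets the change of variables formula
  -- conclude.
  have hdensity : ∀ u ∈ U, areaDensity ε τ ψ u
      = |(planeProj 0 ∘L fderiv ℝ ψ u).det| * areaDensity ε τ Γ (κ u) := by
    intro u hu
    have hd : DifferentiableAt ℝ h (Complex.equivRealProdCLM.symm (κ u)) := by
      rw [hzκ]
      exact hhd _ (hS _ (hψ.mapsTo hu)).1
    have hΓd : HasFDerivAt Γ (fderiv ℝ Γ (κ u)) (κ u) := by
      refine DifferentiableAt.hasFDerivAt ?_
      have h1 := Complex.equivRealProdCLM.symm.differentiableAt (x := κ u)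
      exact (shear 0).differentiableAt.comp _ (h1.prodMk (hd.comp _ h1))
    have hcomp : fderiv ℝ ψ u = fderiv ℝ Γ (κ u) ∘L (planeProj 0 ∘L fderiv ℝ ψ u) := by
      refine ((hΓd.comp u (hκd u hu)).congr_of_eventuallyEq ?_).fderiv
      filter_upwards [hψ.isOpen.mem_nhds hu] with v hv using hψΓ v hv
    set L := planeProj 0 ∘L fderiv ℝ ψ u
    have hlin : ∀ v : ℝ × ℝ, fderiv ℝ ψ u v = (L v).1 • fderiv ℝ Γ (κ u) (1, 0)
        + (L v).2 • fderiv ℝ Γ (κ u) (0, 1) := fun v => by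
      rw [hcomp, ← map_smul, ← map_smul, ← map_add, ContinuousLinearMap.comp_apply]
      simp
    rw [areaDensity_eq, areaDensity_eq, hlin (1, 0), hlin (0, 1), gram_linear_combination,
      Real.sqrt_mul (sq_nonneg _), Real.sqrt_sq_eq_abs, det_eq_of_prod, ← hψΓ u hu]
  have hΓp := isLocalParametrization_graph hD hh
  refine Measure.le_iff.2 fun B hB => ?_
  have hA := hψ.measurableSet_inter_preimage hB
  rw [patchMeasure_apply ε τ hψ hB, patchMeasure_apply ε τ hΓp hB]
  have hκinj : InjOn κ (U ∩ ψ ⁻¹' B) := fun u hu v hv huv =>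
    hψ.injOn hu.1 hv.1 (by rw [hψΓ u hu.1, hψΓ v hv.1, huv])
  calc ∫⁻ u in U ∩ ψ ⁻¹' B, ENNReal.ofReal (areaDensity ε τ ψ u)
      = ∫⁻ u in U ∩ ψ ⁻¹' B, ENNReal.ofReal |(planeProj 0 ∘L fderiv ℝ ψ u).det|
          * ENNReal.ofReal (areaDensity ε τ Γ (κ u)) := by
        refine setLIntegral_congr_fun hA fun u hu => ?_
        rw [hdensity u hu.1, ENNReal.ofReal_mul (abs_nonneg _)]
    _ = ∫⁻ v in κ '' (U ∩ ψ ⁻¹' B), ENNReal.ofReal (areaDensity ε τ Γ v) :=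
        (lintegral_image_eq_lintegral_abs_det_fderiv_mul volume hA
          (fun u hu => (hκd u hu.1).hasFDerivWithinAt) hκinj
          fun v => ENNReal.ofReal (areaDensity ε τ Γ v)).symm
    _ ≤ _ := by
        refine lintegral_mono_set ?_
        rintro _ ⟨u, hu, rfl⟩
        refine ⟨?_, ?_⟩
        · rw [mem_preimage, hzκ]
          exact (hS _ (hψ.mapsTo hu.1)).1
        · change Γ (κ u) ∈ B
          rw [← hψΓ u hu.1]
          exact hu.2

/-- The Gram determinant is a sum of squares of linear combinations of the three Euclidean `2 × 2`
minors. -/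
theorem gram_eq_zero {ε τ : ℝ} {p v w : Heis}
    (h1 : v.1.re * w.1.im - w.1.re * v.1.im = 0)
    (h2 : v.1.re * w.2 - w.1.re * v.2 = 0) (h3 : v.2 * w.1.im - w.2 * v.1.im = 0) :
    gram ε τ p v w = 0 := by
  have e : gram ε τ p v w = (ε ^ 2 * (v.1.re * w.1.im - w.1.re * v.1.im)) ^ 2
      + (ε * ((v.1.re * w.2 - w.1.re * v.2)
        + sigma ε τ * p.1.re * (v.1.re * w.1.im - w.1.re * v.1.im)) / ε ^ 2) ^ 2
      + (ε * (-(v.2 * w.1.im - w.2 * v.1.im)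
        + sigma ε τ * p.1.im * (v.1.re * w.1.im - w.1.re * v.1.im)) / ε ^ 2) ^ 2 := by
    simp only [gram, metric, coordX, coordY, coordT]
    ring
  rw [e, h1, h2, h3]
  simp

/-- A circle in a horizontal plane has no area in any parametrized surface. -/
theorem patchMeasure_circle_eq_zero (ε τ R : ℝ) (hR : R ≠ 0) {S : Set Heis} {U : Set (ℝ × ℝ)}
    {ψ : ℝ × ℝ → Heis} (hψ : IsLocalParametrization S U ψ) :
    patchMeasure ε τ U ψ {p | ‖p.1‖ = R ∧ p.2 = 0} = 0 := by
  have hC : MeasurableSet {p : Heis | ‖p.1‖ = R ∧ p.2 = 0} :=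
    ((isClosed_eq (by fun_prop) continuous_const).inter
      (isClosed_eq continuous_snd continuous_const)).measurableSet
  have hA := hψ.measurableSet_inter_preimage hC
  rw [patchMeasure_apply ε τ hψ hC]
  set A := U ∩ ψ ⁻¹' {p : Heis | ‖p.1‖ = R ∧ p.2 = 0} with hAdef
  have hψd : ∀ u ∈ U, HasFDerivAt ψ (fderiv ℝ ψ u) u := fun u hu =>
    ((hψ.contDiffOn.contDiffAt (hψ.isOpen.mem_nhds hu)).differentiableAt (by simp)).hasFDerivAt
  -- On the preimage of the circle each map `z + t c` is injective with image in a planar circle, a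
  -- null set, so its Jacobian vanishes almost everywhere. The choices `c = 0, 1, i` together force
  -- all three minors of `Dψ` to vanish.
  have hdet : ∀ c : ℂ, ∀ᵐ u ∂(volume.restrict A), (planeProj c ∘L fderiv ℝ ψ u).det = 0 := by
    intro c
    have hd : ∀ u ∈ A, HasFDerivWithinAt (fun u => planeProj c (ψ u))
        (planeProj c ∘L fderiv ℝ ψ u) A u := fun u hu =>
      ((planeProj c).hasFDerivAt.comp u (hψd u hu.1)).hasFDerivWithinAt
    have hval : ∀ u ∈ A, planeProj c (ψ u) = ((ψ u).1.re, (ψ u).1.im) := fun u hu => by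
      rw [planeProj_apply, hu.2.2]
      simp
    have hinj : InjOn (fun u => planeProj c (ψ u)) A := fun u hu v hv huv => by
      simp only [hval u hu, hval v hv, Prod.mk.injEq] at huv
      exact hψ.injOn hu.1 hv.1 (Prod.ext (Complex.ext huv.1 huv.2) (hu.2.2.trans hv.2.2.symm))
    have hnull : volume ((fun u => planeProj c (ψ u)) '' A) = 0 := by
      have h1 : volume (Complex.measurableEquivRealProd.symm ⁻¹' (Metric.sphere (0 : ℂ) R)) = 0 := by
        rw [Complex.volume_preserving_equiv_real_prod.symm.measure_preimage_equiv]
        exact Measure.addHaar_sphere_of_ne_zero _ _ hR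
      refine measure_mono_null ?_ h1
      rintro _ ⟨u, hu, rfl⟩
      simp only [mem_preimage, hval u hu, mem_sphere_iff_norm, sub_zero]
      exact hu.2.1
    have h0 := lintegral_abs_det_fderiv_eq_addHaar_image volume hA hd hinj
    rw [hnull, lintegral_eq_zero_iff' (aemeasurable_ofReal_abs_det_fderivWithin volume hA hd)] at h0
    filter_upwards [h0] with u hu
    simpa using hu
  rw [lintegral_congr_ae (g := fun _ => 0), lintegral_zero]
  filter_upwards [hdet 0, hdet 1, hdet Complex.I] with u h0 h1 h2
  simp only [det_eq_of_prod, ContinuousLinearMap.comp_apply, planeProj_apply, Complex.zero_re,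
    Complex.zero_im, Complex.one_re, Complex.one_im, Complex.I_re, Complex.I_im, mul_zero, mul_one,
    add_zero] at h0 h1 h2
  rw [areaDensity_eq, gram_eq_zero (by linarith) (by linarith) (by linarith)]
  simp

/-! ### The profile function and the upper hemisphere -/

/-- The profile as a function of the squared radius. -/
def profileSq (ε τ R q : ℝ) : ℝ :=
  if τ = 0 then ε ^ 3 * √(R ^ 2 - q)
  else ε ^ 2 / (2 * τ) *
    (omega ε τ R ^ 2 * Real.arctan (τ * ε * √(R ^ 2 - q) / √(1 + τ ^ 2 * ε ^ 2 * q))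
      + √(1 + τ ^ 2 * ε ^ 2 * q) ^ 2 * (τ * ε * √(R ^ 2 - q) / √(1 + τ ^ 2 * ε ^ 2 * q)))

theorem profile_eq_profileSq (ε τ r R : ℝ) : profile ε τ r R = profileSq ε τ R (r ^ 2) := rfl

theorem one_add_pos (ε τ : ℝ) {q : ℝ} (hq : 0 ≤ q) : 0 < 1 + τ ^ 2 * ε ^ 2 * q := by positivity

theorem omega_sq (ε τ r : ℝ) : omega ε τ r ^ 2 = 1 + τ ^ 2 * ε ^ 2 * r ^ 2 :=
  Real.sq_sqrt (by positivity)

theorem omega_pos (ε τ r : ℝ) : 0 < omega ε τ r := Real.sqrt_pos.2 (by positivity)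

/-- Working with `q = r²` makes the hemisphere smooth on the axis, where `‖z‖` is not
differentiable. -/
theorem contDiffAt_profileSq (ε τ R : ℝ) {q : ℝ} (hq : 0 ≤ q) (hqR : q < R ^ 2) :
    ContDiffAt ℝ ∞ (profileSq ε τ R) q := by
  have h1 : ContDiffAt ℝ ∞ (fun q => √(R ^ 2 - q)) q :=
    (contDiffAt_const.sub contDiffAt_id).sqrt (by simp only [id]; linarith)
  have h2 : ContDiffAt ℝ ∞ (fun q => √(1 + τ ^ 2 * ε ^ 2 * q)) q :=
    (contDiffAt_const.add (contDiffAt_const.mul contDiffAt_id)).sqrt (one_add_pos ε τ hq).ne'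
  have h3 : √(1 + τ ^ 2 * ε ^ 2 * q) ≠ 0 := (Real.sqrt_pos.2 (one_add_pos ε τ hq)).ne'
  have h4 := (contDiffAt_const (c := τ * ε) |>.mul h1).div h2 h3
  unfold profileSq
  split_ifs
  · exact contDiffAt_const.mul h1
  · exact contDiffAt_const.mul ((contDiffAt_const.mul
      (Real.contDiff_arctan.contDiffAt.comp q h4)).add ((h2.pow 2).mul h4))

theorem continuousOn_profileSq (ε τ R : ℝ) : ContinuousOn (profileSq ε τ R) (Ici 0) := by
  intro q hq
  have h3 : √(1 + τ ^ 2 * ε ^ 2 * q) ≠ 0 := (Real.sqrt_pos.2 (one_add_pos ε τ hq)).ne'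
  have h1 : ContinuousAt (fun q => √(R ^ 2 - q)) q := by fun_prop
  have h2 : ContinuousAt (fun q => √(1 + τ ^ 2 * ε ^ 2 * q)) q := by fun_prop
  have h4 := (continuousAt_const (y := τ * ε) |>.mul h1).div h2 h3
  refine ContinuousAt.continuousWithinAt ?_
  unfold profileSq
  split_ifs
  · exact continuousAt_const.mul h1
  · exact continuousAt_const.mul ((continuousAt_const.mul
      (Real.continuous_arctan.continuousAt.comp h4)).add ((h2.pow 2).mul h4))

theorem hasDerivAt_profileSq (ε τ R : ℝ) {q : ℝ} (hq : 0 ≤ q) (hqR : q < R ^ 2) :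
    HasDerivAt (profileSq ε τ R)
      (-(ε ^ 3 * √(1 + τ ^ 2 * ε ^ 2 * q) / (2 * √(R ^ 2 - q)))) q := by
  have hw : 0 < √(R ^ 2 - q) := Real.sqrt_pos.2 (by linarith)
  have hω : 0 < √(1 + τ ^ 2 * ε ^ 2 * q) := Real.sqrt_pos.2 (one_add_pos ε τ hq)
  have hw2 : √(R ^ 2 - q) ^ 2 = R ^ 2 - q := Real.sq_sqrt (by linarith)
  have hω2 : √(1 + τ ^ 2 * ε ^ 2 * q) ^ 2 = 1 + τ ^ 2 * ε ^ 2 * q :=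
    Real.sq_sqrt (one_add_pos ε τ hq).le
  have h1 : HasDerivAt (fun q => √(R ^ 2 - q)) (-1 / (2 * √(R ^ 2 - q))) q :=
    ((hasDerivAt_id q).const_sub _).sqrt (by simp only [id]; linarith)
  have h2 : HasDerivAt (fun q => √(1 + τ ^ 2 * ε ^ 2 * q))
      (τ ^ 2 * ε ^ 2 / (2 * √(1 + τ ^ 2 * ε ^ 2 * q))) q := by
    have := (((hasDerivAt_id q).const_mul (τ ^ 2 * ε ^ 2)).const_add 1).sqrt
      (one_add_pos ε τ hq).ne'
    simpa using this
  unfold profileSq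
  by_cases hτ : τ = 0
  · simp only [hτ, if_true]
    refine (h1.const_mul (ε ^ 3)).congr_deriv ?_
    simp
    field_simp
  · simp only [hτ, if_false]
    have h4 := (h1.const_mul (τ * ε)).div h2 hω.ne'
    have h5 := (((Real.hasDerivAt_arctan _).comp q h4).const_mul (omega ε τ R ^ 2)).add
      ((h2.pow 2).mul h4)
    refine (h5.const_mul (ε ^ 2 / (2 * τ))).congr_deriv ?_
    simp only [Pi.div_apply, Pi.pow_apply, Nat.cast_ofNat]
    rw [omega_sq]
    set w := √(R ^ 2 - q)
    set o := √(1 + τ ^ 2 * ε ^ 2 * q)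
    -- Thus `1 + p² = ω(R)²/ω(r)²`, so the factor `ω(R)²` cancels the denominator in the derivative
    -- of the arctangent.
    have hR2 : 1 + τ ^ 2 * ε ^ 2 * R ^ 2 = o ^ 2 + (τ * ε * w) ^ 2 := by
      rw [mul_pow, hw2, hω2]
      ring
    rw [hR2]
    have hne : o ^ 2 + (τ * ε * w) ^ 2 ≠ 0 := by positivity
    have e1 : 1 + (τ * ε * w / o) ^ 2 = (o ^ 2 + (τ * ε * w) ^ 2) / o ^ 2 := by
      field_simp
    rw [e1]
    field_simp
    ring

theorem profileSq_self (ε τ R : ℝ) : profileSq ε τ R (R ^ 2) = 0 := by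
  simp [profileSq]

theorem strictAntiOn_profileSq {ε : ℝ} (hε : 0 < ε) (τ R : ℝ) :
    StrictAntiOn (profileSq ε τ R) (Icc 0 (R ^ 2)) := by
  refine strictAntiOn_of_deriv_neg (convex_Icc _ _)
    ((continuousOn_profileSq ε τ R).mono Icc_subset_Ici_self) fun q hq => ?_
  rw [interior_Icc] at hq
  rw [(hasDerivAt_profileSq ε τ R hq.1.le hq.2).deriv]
  have hw : 0 < √(R ^ 2 - q) := Real.sqrt_pos.2 (by linarith [hq.2])
  have hω : 0 < √(1 + τ ^ 2 * ε ^ 2 * q) := Real.sqrt_pos.2 (one_add_pos ε τ hq.1.le)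
  have : 0 < ε ^ 3 * √(1 + τ ^ 2 * ε ^ 2 * q) / (2 * √(R ^ 2 - q)) := by positivity
  linarith

/-- The slope of the profile with respect to `√(R² - r²)` is at most `ε³ ω(R)`. -/
theorem monotoneOn_profileSq_sub {ε : ℝ} (hε : 0 < ε) (τ R : ℝ) :
    MonotoneOn (fun q => profileSq ε τ R q - ε ^ 3 * omega ε τ R * √(R ^ 2 - q))
      (Icc 0 (R ^ 2)) := by
  have hd : ∀ q ∈ Ioo 0 (R ^ 2), HasDerivAt
      (fun q => profileSq ε τ R q - ε ^ 3 * omega ε τ R * √(R ^ 2 - q))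
      (-(ε ^ 3 * √(1 + τ ^ 2 * ε ^ 2 * q) / (2 * √(R ^ 2 - q)))
        - ε ^ 3 * omega ε τ R * (-1 / (2 * √(R ^ 2 - q)))) q := fun q hq => by
    have h1 : HasDerivAt (fun q => √(R ^ 2 - q)) (-1 / (2 * √(R ^ 2 - q))) q :=
      ((hasDerivAt_id q).const_sub _).sqrt (by simp only [id]; linarith [hq.2])
    exact (hasDerivAt_profileSq ε τ R hq.1.le hq.2).sub (h1.const_mul _)
  refine monotoneOn_of_deriv_nonneg (convex_Icc _ _)
    (((continuousOn_profileSq ε τ R).mono Icc_subset_Ici_self).sub (by fun_prop))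
    (fun q hq => ?_) fun q hq => ?_
  · rw [interior_Icc] at hq
    exact (hd q hq).differentiableAt.differentiableWithinAt
  · rw [interior_Icc] at hq
    rw [(hd q hq).deriv]
    have hw : 0 < √(R ^ 2 - q) := Real.sqrt_pos.2 (by linarith [hq.2])
    have hle : √(1 + τ ^ 2 * ε ^ 2 * q) ≤ omega ε τ R :=
      Real.sqrt_le_sqrt (by have := hq.2.le; gcongr)
    have e : -(ε ^ 3 * √(1 + τ ^ 2 * ε ^ 2 * q) / (2 * √(R ^ 2 - q)))
        - ε ^ 3 * omega ε τ R * (-1 / (2 * √(R ^ 2 - q)))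
        = ε ^ 3 * (omega ε τ R - √(1 + τ ^ 2 * ε ^ 2 * q)) / (2 * √(R ^ 2 - q)) := by
      field_simp
      ring
    rw [e]
    have := sub_nonneg.2 hle
    positivity

/-- The graph function of the upper half of the sphere. -/
def height (ε τ R : ℝ) (z : ℂ) : ℝ := profile ε τ ‖z‖ R

/-- The length `√(R² - |z|²)`. -/
def depth (R : ℝ) (z : ℂ) : ℝ := √(R ^ 2 - ‖z‖ ^ 2)

theorem height_eq (ε τ R : ℝ) (z : ℂ) : height ε τ R z = profileSq ε τ R (‖z‖ ^ 2) := rfl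

theorem continuous_height (ε τ R : ℝ) : Continuous (height ε τ R) := by
  have h : Continuous fun z : ℂ => ‖z‖ ^ 2 := by fun_prop
  exact (continuousOn_profileSq ε τ R).comp_continuous h fun z => sq_nonneg ‖z‖

theorem norm_sq_lt {R : ℝ} {z : ℂ} (hz : ‖z‖ < R) : ‖z‖ ^ 2 < R ^ 2 :=
  pow_lt_pow_left₀ hz (norm_nonneg z) two_ne_zero

theorem depth_sq {R : ℝ} {z : ℂ} (hz : ‖z‖ ≤ R) : depth R z ^ 2 = R ^ 2 - ‖z‖ ^ 2 :=
  Real.sq_sqrt (sub_nonneg.2 (pow_le_pow_left₀ (norm_nonneg z) hz 2))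

theorem depth_pos {R : ℝ} {z : ℂ} (hz : ‖z‖ < R) : 0 < depth R z :=
  Real.sqrt_pos.2 (by linarith [norm_sq_lt hz])

theorem contDiffOn_height (ε τ R : ℝ) : ContDiffOn ℝ ∞ (height ε τ R) (Metric.ball 0 R) :=
  fun z hz => ((contDiffAt_profileSq ε τ R (sq_nonneg _)
    (norm_sq_lt (mem_ball_zero_iff.1 hz))).comp z
      (contDiff_norm_sq ℝ).contDiffAt).contDiffWithinAt

theorem contDiffAt_depth {R : ℝ} {z : ℂ} (hz : ‖z‖ < R) : ContDiffAt ℝ ∞ (depth R) z :=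
  (contDiffAt_const.sub (contDiff_norm_sq ℝ).contDiffAt).sqrt (by linarith [norm_sq_lt hz])

theorem hasFDerivAt_norm_sq (z : ℂ) :
    HasFDerivAt (fun z : ℂ => ‖z‖ ^ 2) ((2 : ℝ) • innerSL ℝ z) z := by
  have := (hasStrictFDerivAt_norm_sq z).hasFDerivAt (𝕜 := ℝ)
  rwa [two_smul, ← two_smul ℝ] at this

theorem hasFDerivAt_depth {R : ℝ} {z : ℂ} (hz : ‖z‖ < R) :
    HasFDerivAt (depth R) (-(depth R z)⁻¹ • innerSL ℝ z) z := by
  have h := ((hasFDerivAt_norm_sq z).const_sub (R ^ 2)).sqrt (by linarith [norm_sq_lt hz])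
  refine h.congr_fderiv ?_
  ext v
  simp [depth]
  ring

theorem hasFDerivAt_height (ε τ : ℝ) {R : ℝ} {z : ℂ} (hz : ‖z‖ < R) :
    HasFDerivAt (height ε τ R) (-(ε ^ 3 * omega ε τ ‖z‖ / depth R z) • innerSL ℝ z) z := by
  have h := (hasDerivAt_profileSq ε τ R (sq_nonneg ‖z‖) (norm_sq_lt hz)).comp_hasFDerivAt z
    (hasFDerivAt_norm_sq z)
  refine h.congr_fderiv ?_
  ext v
  have hd := depth_pos hz
  simp only [smul_apply, smul_eq_mul]
  change -(ε ^ 3 * omega ε τ ‖z‖ / (2 * depth R z)) * (2 * innerSL ℝ z v) = _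
  field_simp

theorem hasFDerivAt_omega (ε τ : ℝ) (z : ℂ) :
    HasFDerivAt (fun z : ℂ => omega ε τ ‖z‖)
      ((τ ^ 2 * ε ^ 2 / omega ε τ ‖z‖) • innerSL ℝ z) z := by
  have h := (((hasFDerivAt_norm_sq z).const_mul (τ ^ 2 * ε ^ 2)).const_add 1).sqrt
    (one_add_pos ε τ (sq_nonneg ‖z‖)).ne'
  refine h.congr_fderiv ?_
  ext v
  have := omega_pos ε τ ‖z‖
  simp only [smul_apply, smul_eq_mul]
  change 1 / (2 * omega ε τ ‖z‖) * (τ ^ 2 * ε ^ 2 * (2 * innerSL ℝ z v)) = _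
  field_simp

theorem contDiff_omega (ε τ : ℝ) : ContDiff ℝ ∞ fun z : ℂ => omega ε τ ‖z‖ :=
  (contDiff_const.add (contDiff_const.mul (contDiff_norm_sq ℝ))).sqrt
    fun z => (one_add_pos ε τ (sq_nonneg ‖z‖)).ne'

theorem height_pos {ε : ℝ} (hε : 0 < ε) (τ : ℝ) {R : ℝ} {z : ℂ} (hz : ‖z‖ < R) :
    0 < height ε τ R z := by
  have h := strictAntiOn_profileSq hε τ R ⟨sq_nonneg ‖z‖, (norm_sq_lt hz).le⟩
    ⟨sq_nonneg R, le_rfl⟩ (norm_sq_lt hz)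
  rwa [profileSq_self] at h

/-- This comparison lets a Euclidean model for the leaves replace the true profiles, at the price of
the factor `ε³ω(R)`. -/
theorem height_sub_le {ε : ℝ} (hε : 0 < ε) (τ : ℝ) {R r : ℝ} {z : ℂ} (hr : r ≤ R)
    (hz : ‖z‖ ≤ r) :
    height ε τ R z - profile ε τ r R
      ≤ ε ^ 3 * omega ε τ R * (depth R z - √(R ^ 2 - r ^ 2)) := by
  have h0 := norm_nonneg z
  have h := monotoneOn_profileSq_sub hε τ R
    (a := ‖z‖ ^ 2) ⟨sq_nonneg _, by gcongr; exact hz.trans hr⟩ (b := r ^ 2)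
    ⟨sq_nonneg _, by have := h0.trans hz; gcongr⟩ (by gcongr)
  simp only at h
  rw [height_eq, profile_eq_profileSq, depth]
  linarith

theorem norm_lt_of_profile_lt {ε : ℝ} (hε : 0 < ε) (τ : ℝ) {R r : ℝ} {z : ℂ} (hz : ‖z‖ < R)
    (hr0 : 0 ≤ r) (hr : r ≤ R) (h : profile ε τ r R < height ε τ R z) : ‖z‖ < r := by
  by_contra! hle
  have := (strictAntiOn_profileSq hε τ R).antitoneOn (a := r ^ 2)
    ⟨sq_nonneg _, by gcongr⟩ (b := ‖z‖ ^ 2)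
    ⟨sq_nonneg _, (norm_sq_lt hz).le⟩ (by gcongr)
  rw [height_eq, profile_eq_profileSq] at h
  linarith

theorem innerSL_one (z : ℂ) : innerSL ℝ z 1 = z.re := by
  simp [Complex.inner]

theorem innerSL_I (z : ℂ) : innerSL ℝ z Complex.I = z.im := by
  simp [Complex.inner]

theorem innerSL_apply_eq (z v : ℂ) : innerSL ℝ z v = z.re * v.re + z.im * v.im := by
  simp [Complex.inner]
  ring

theorem norm_sq_eq (z : ℂ) : ‖z‖ ^ 2 = z.re ^ 2 + z.im ^ 2 := by
  rw [Complex.sq_norm, Complex.normSq_apply]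
  ring

/-! ### Finiteness of the area of the sphere -/

/-- The area density of a graph whose gradient is that of the upper or lower half of the sphere. -/
theorem areaDensity_graph {ε : ℝ} (hε : 0 < ε) (τ : ℝ) {R : ℝ} {s : ℝ} (hs : s ^ 2 = 1)
    {g : ℂ → ℝ} {u : ℝ × ℝ} (hz : ‖Complex.equivRealProdCLM.symm u‖ < R)
    (hg : HasFDerivAt g (s • -(ε ^ 3 * omega ε τ ‖Complex.equivRealProdCLM.symm u‖
      / depth R (Complex.equivRealProdCLM.symm u)) • innerSL ℝ (Complex.equivRealProdCLM.symm u))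
      (Complex.equivRealProdCLM.symm u)) :
    areaDensity ε τ (shearedGraph 0 g) u = ε ^ 2 * omega ε τ ‖Complex.equivRealProdCLM.symm u‖ * R
      / depth R (Complex.equivRealProdCLM.symm u) := by
  rw [areaDensity_eq, fderiv_shearedGraph 0 hg.differentiableAt,
    fderiv_shearedGraph 0 hg.differentiableAt, equivRealProdCLM_symm_fst,
    equivRealProdCLM_symm_snd, hg.fderiv]
  simp only [smul_apply, innerSL_one, innerSL_I, shear_apply, smul_zero, add_zero, shearedGraph]
  set z := Complex.equivRealProdCLM.symm u
  have hR : 0 < R := (norm_nonneg z).trans_lt hz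
  have hw := depth_pos hz
  have hw2 := depth_sq hz.le
  have ho := omega_pos ε τ ‖z‖
  have ho2 := omega_sq ε τ ‖z‖
  rw [norm_sq_eq] at hw2 ho2
  set w := depth R z
  set o := omega ε τ ‖z‖
  have e : gram ε τ (z, g z) (1, s • -(ε ^ 3 * o / w) • z.re)
      (Complex.I, s • -(ε ^ 3 * o / w) • z.im) = (ε ^ 2 * o * R / w) ^ 2 := by
    have h1 : gram ε τ (z, g z) (1, s • -(ε ^ 3 * o / w) • z.re)
        (Complex.I, s • -(ε ^ 3 * o / w) • z.im)
        = ε ^ 4 + s ^ 2 * (ε ^ 4 * o ^ 2 / w ^ 2) * (z.re ^ 2 + z.im ^ 2)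
          + ε ^ 4 * (τ ^ 2 * ε ^ 2 * (z.re ^ 2 + z.im ^ 2)) := by
      simp only [gram, metric, coordX, coordY, coordT, sigma, Complex.one_re, Complex.one_im,
        Complex.I_re, Complex.I_im, smul_eq_mul]
      field_simp
      ring
    have h2 : z.re ^ 2 + z.im ^ 2 = R ^ 2 - w ^ 2 := by linarith
    rw [h1, hs, h2]
    rw [h2] at ho2
    have h3 : ε ^ 4 * (τ ^ 2 * ε ^ 2 * (R ^ 2 - w ^ 2)) = ε ^ 4 * (o ^ 2 - 1) := by
      rw [ho2]; ring
    rw [h3]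
    field_simp
    ring
  rw [e, Real.sqrt_sq (by positivity)]

/-- In polar coordinates the integrand becomes `r/√(R² - r²)`, with the bounded primitive `-√(R² -
r²)`. -/
theorem lintegral_inv_depth_lt_top {R : ℝ} (hR : 0 < R) :
    ∫⁻ z in Metric.ball (0 : ℂ) R, ENNReal.ofReal (1 / depth R z) < ⊤ := by
  rw [← lintegral_indicator Metric.isOpen_ball.measurableSet,
    ← Complex.lintegral_comp_polarCoord_symm]
  have hint : IntegrableOn (fun r => r / √(R ^ 2 - r ^ 2)) (Ioc 0 R) := by
    refine intervalIntegral.integrableOn_deriv_of_nonneg (g := fun r => -√(R ^ 2 - r ^ 2)) (by fun_prop)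
      (fun r hr => ?_) fun r hr => ?_
    · have h1 : 0 < R ^ 2 - r ^ 2 := by nlinarith [hr.1, hr.2]
      have h2 : HasDerivAt (fun r => R ^ 2 - r ^ 2) (-(2 * r)) r := by
        simpa using ((hasDerivAt_id r).pow 2).const_sub (R ^ 2)
      refine (h2.sqrt h1.ne').neg.congr_deriv ?_
      have := Real.sqrt_pos.2 h1
      field_simp
    · exact div_nonneg hr.1.le (Real.sqrt_nonneg _)
  have hbound : ∀ p ∈ polarCoord.target,
      ENNReal.ofReal p.1 • (Metric.ball (0 : ℂ) R).indicator
        (fun z => ENNReal.ofReal (1 / depth R z)) (Complex.polarCoord.symm p)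
      ≤ (Ioc 0 R).indicator (fun r => ENNReal.ofReal (r / √(R ^ 2 - r ^ 2))) p.1 := by
    intro p hp
    have hp1 : 0 < p.1 := hp.1
    by_cases h : Complex.polarCoord.symm p ∈ Metric.ball (0 : ℂ) R
    · have h' : p.1 < R := by
        rwa [mem_ball_zero_iff, Complex.norm_polarCoord_symm, abs_of_pos hp1] at h
      rw [indicator_of_mem h, indicator_of_mem (show p.1 ∈ Ioc 0 R from ⟨hp1, h'.le⟩), smul_eq_mul,
        ← ENNReal.ofReal_mul hp1.le, depth, Complex.norm_polarCoord_symm, sq_abs, mul_one_div]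
    · rw [indicator_of_notMem h]
      simp
  have hm : MeasurableSet polarCoord.target := polarCoord.open_target.measurableSet
  refine (setLIntegral_mono' hm hbound).trans_lt ?_
  have hmeas : Measurable ((Ioc 0 R).indicator fun r => ENNReal.ofReal (r / √(R ^ 2 - r ^ 2))) :=
    Measurable.indicator (by fun_prop) measurableSet_Ioc
  have ht : polarCoord.target = Ioi 0 ×ˢ Ioo (-Real.pi) Real.pi := rfl
  rw [ht, Measure.volume_eq_prod, ← Measure.prod_restrict,
    lintegral_prod _ (show Measurable fun p : ℝ × ℝ => (Ioc 0 R).indicator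
      (fun r => ENNReal.ofReal (r / √(R ^ 2 - r ^ 2))) p.1 from
        hmeas.comp measurable_fst).aemeasurable]
  simp only [lintegral_const, Measure.restrict_apply_univ, Real.volume_Ioo]
  rw [lintegral_mul_const _ hmeas]
  refine ENNReal.mul_lt_top ?_ ENNReal.ofReal_lt_top
  refine (setLIntegral_le_lintegral _ _).trans_lt ?_
  rw [lintegral_indicator measurableSet_Ioc]
  refine lt_of_le_of_lt (lintegral_mono fun r => ?_) hint.2
  rw [← ofReal_norm]
  exact ENNReal.ofReal_le_ofReal (Real.le_norm_self _)

theorem hasFDerivAt_smul_height (ε τ : ℝ) {R : ℝ} (s : ℝ) {z : ℂ} (hz : ‖z‖ < R) :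
    HasFDerivAt (fun z => s * height ε τ R z)
      (s • -(ε ^ 3 * omega ε τ ‖z‖ / depth R z) • innerSL ℝ z) z :=
  (hasFDerivAt_height ε τ hz).const_mul s

/-- The two open halves of the sphere have finite area. -/
theorem patchMeasure_half_sphere_lt_top {ε : ℝ} (hε : 0 < ε) (τ : ℝ) {R : ℝ} (hR : 0 < R)
    {s : ℝ} (hs : s ^ 2 = 1) :
    patchMeasure ε τ (Complex.equivRealProdCLM.symm ⁻¹' Metric.ball 0 R)
      (shearedGraph 0 fun z => s * height ε τ R z) univ < ⊤ := by
  rw [patchMeasure_apply ε τ (isLocalParametrization_graph Metric.isOpen_ball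
    (contDiffOn_const.mul (contDiffOn_height ε τ R))) MeasurableSet.univ, preimage_univ, inter_univ]
  have hm : MeasurableSet (Complex.equivRealProdCLM.symm ⁻¹' Metric.ball (0 : ℂ) R) :=
    (Metric.isOpen_ball.preimage Complex.equivRealProdCLM.symm.continuous).measurableSet
  have hle : ∀ u ∈ Complex.equivRealProdCLM.symm ⁻¹' Metric.ball (0 : ℂ) R,
      ENNReal.ofReal (areaDensity ε τ (shearedGraph 0 fun z => s * height ε τ R z) u)
        ≤ ENNReal.ofReal (ε ^ 2 * omega ε τ R * R) * ENNReal.ofReal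
          (1 / depth R (Complex.equivRealProdCLM.symm u)) := by
    intro u hu
    have hz : ‖Complex.equivRealProdCLM.symm u‖ < R := mem_ball_zero_iff.1 hu
    have hw := depth_pos hz
    have ho := omega_pos ε τ R
    have hoo : omega ε τ ‖Complex.equivRealProdCLM.symm u‖ ≤ omega ε τ R :=
      Real.sqrt_le_sqrt (by gcongr)
    rw [areaDensity_graph hε τ hs hz (hasFDerivAt_smul_height ε τ s hz),
      ← ENNReal.ofReal_mul (by positivity), mul_one_div]
    refine ENNReal.ofReal_le_ofReal ?_
    gcongr
  refine (setLIntegral_mono' hm hle).trans_lt ?_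
  rw [lintegral_const_mul' _ _ ENNReal.ofReal_ne_top]
  refine ENNReal.mul_lt_top ENNReal.ofReal_lt_top ?_
  refine lt_of_eq_of_lt ?_ (lintegral_inv_depth_lt_top hR)
  rw [← lintegral_indicator hm, ← lintegral_indicator Metric.isOpen_ball.measurableSet,
    ← lintegral_comp_equivRealProdCLM_symm]
  rfl

theorem mem_sphere_of_pos {ε : ℝ} {τ R : ℝ} {p : Heis} (hp : p ∈ sphere ε τ R) (h : 0 < p.2) :
    p.1 ∈ Metric.ball (0 : ℂ) R ∧ p.2 = height ε τ R p.1 := by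
  obtain ⟨h1, h2⟩ := hp
  rw [abs_of_pos h] at h2
  refine ⟨mem_ball_zero_iff.2 (lt_of_le_of_ne h1 fun h3 => ?_), h2⟩
  rw [h3, profile_eq_profileSq, profileSq_self] at h2
  exact h.ne' h2

theorem mem_sphere_of_neg {ε : ℝ} {τ R : ℝ} {p : Heis} (hp : p ∈ sphere ε τ R) (h : p.2 < 0) :
    p.1 ∈ Metric.ball (0 : ℂ) R ∧ p.2 = -1 * height ε τ R p.1 := by
  obtain ⟨h1, h2⟩ := hp
  rw [abs_of_neg h] at h2
  refine ⟨mem_ball_zero_iff.2 (lt_of_le_of_ne h1 fun h3 => ?_), ?_⟩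
  · rw [h3, profile_eq_profileSq, profileSq_self] at h2
    linarith
  · rw [height, ← h2]
    ring

theorem norm_eq_of_mem_sphere {ε : ℝ} (hε : 0 < ε) {τ R : ℝ} {p : Heis}
    (hp : p ∈ sphere ε τ R) (h : p.2 = 0) : ‖p.1‖ = R := by
  obtain ⟨h1, h2⟩ := hp
  rw [h, abs_zero] at h2
  refine h1.eq_of_not_lt fun h3 => ?_
  have := height_pos hε τ h3
  rw [height, ← h2] at this
  exact this.false

theorem area_sphere_lt_top {ε : ℝ} (hε : 0 < ε) (τ : ℝ) {R : ℝ} (hR : 0 < R) :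
    area ε τ (sphere ε τ R) < ⊤ := by
  set D := Complex.equivRealProdCLM.symm ⁻¹' Metric.ball (0 : ℂ) R
  set νp := patchMeasure ε τ D (shearedGraph 0 fun z => 1 * height ε τ R z) with hνp
  set νn := patchMeasure ε τ D (shearedGraph 0 fun z => -1 * height ε τ R z) with hνn
  have hop : IsOpen {p : Heis | 0 < p.2} := isOpen_lt continuous_const continuous_snd
  have hon : IsOpen {p : Heis | p.2 < 0} := isOpen_lt continuous_snd continuous_const
  have hp : (surfaceMeasure ε τ (sphere ε τ R)).restrict {p | 0 < p.2} ≤ νp :=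
    surfaceMeasure_restrict_le hop fun U ψ hψ => patchMeasure_le_of_subset_graph
      Metric.isOpen_ball (contDiffOn_const.mul (contDiffOn_height ε τ R))
      (fun p hp => by simpa using mem_sphere_of_pos hp.1 hp.2) hψ
  have hn : (surfaceMeasure ε τ (sphere ε τ R)).restrict {p | p.2 < 0} ≤ νn :=
    surfaceMeasure_restrict_le hon fun U ψ hψ => patchMeasure_le_of_subset_graph
      Metric.isOpen_ball (contDiffOn_const.mul (contDiffOn_height ε τ R))
      (fun p hp => mem_sphere_of_neg hp.1 hp.2) hψ
  -- Every patch is split by the sign of the height. Only the equator is left over, and it has no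
  -- area in any patch.
  have hle : surfaceMeasure ε τ (sphere ε τ R) ≤ νp + νn := by
    refine sSup_le ?_
    rintro _ ⟨U, ψ, hψ, rfl⟩
    have hψle := patchMeasure_le_surfaceMeasure (ε := ε) (τ := τ) hψ
    have hzero : patchMeasure ε τ U ψ {p | p.2 = 0} = 0 := by
      have h0 : MeasurableSet {p : Heis | p.2 = 0} :=
        (isClosed_eq continuous_snd continuous_const).measurableSet
      have hC : MeasurableSet {p : Heis | ‖p.1‖ = R ∧ p.2 = 0} :=
        ((isClosed_eq (by fun_prop) continuous_const).inter
          (isClosed_eq continuous_snd continuous_const)).measurableSet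
      rw [← patchMeasure_circle_eq_zero ε τ R hR.ne' hψ, patchMeasure_apply ε τ hψ h0,
        patchMeasure_apply ε τ hψ hC]
      congr 2
      ext u
      constructor
      · rintro ⟨h1, h2⟩
        exact ⟨h1, norm_eq_of_mem_sphere hε (hψ.mapsTo h1) h2, h2⟩
      · rintro ⟨h1, h2⟩
        exact ⟨h1, h2.2⟩
    refine Measure.le_iff.2 fun B hB => ?_
    have hB1 : B ⊆ (B ∩ {p | 0 < p.2} ∪ B ∩ {p | p.2 < 0}) ∪ {p | p.2 = 0} := fun p hp => by
      rcases lt_trichotomy p.2 0 with h | h | h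
      · exact .inl (.inr ⟨hp, h⟩)
      · exact .inr h
      · exact .inl (.inl ⟨hp, h⟩)
    calc patchMeasure ε τ U ψ B
        ≤ patchMeasure ε τ U ψ (B ∩ {p | 0 < p.2}) + patchMeasure ε τ U ψ (B ∩ {p | p.2 < 0})
          + patchMeasure ε τ U ψ {p | p.2 = 0} :=
          (measure_mono hB1).trans ((measure_union_le _ _).trans
            (add_le_add (measure_union_le _ _) le_rfl))
      _ ≤ νp B + νn B := by
          rw [hzero, add_zero]
          refine add_le_add ?_ ?_
          · refine (hψle _).trans ?_
            rw [← Measure.restrict_apply hB]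
            exact hp B
          · refine (hψle _).trans ?_
            rw [← Measure.restrict_apply hB]
            exact hn B
  refine (hle univ).trans_lt ?_
  rw [Measure.add_apply]
  exact ENNReal.add_lt_top.2 ⟨patchMeasure_half_sphere_lt_top hε τ hR (s := 1) (by norm_num),
    patchMeasure_half_sphere_lt_top hε τ hR (s := -1) (by norm_num)⟩

/-! ### Flux of a normal field through the sphere -/

theorem isOpen_domain (ε τ R : ℝ) : IsOpen (domain ε τ R) := by
  have h1 : IsOpen {p : Heis | |p.2| < height ε τ R p.1} :=
    isOpen_lt (by fun_prop) ((continuous_height ε τ R).comp continuous_fst)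
  have h2 : IsOpen {p : Heis | ‖p.1‖ < R} := isOpen_lt (by fun_prop) continuous_const
  exact h1.inter h2

/-- For a field that is normal to the upper half of the sphere, the integral of its length over
the sphere is at most the integral of its divergence over the domain. -/
theorem lintegral_sphere_le {ε : ℝ} (τ : ℝ) {R : ℝ} {N : Set ℂ}
    (hN : IsOpen N) (hNR : N ⊆ Metric.ball 0 R) {g : ℂ → ℝ} (hg : ContDiff ℝ ∞ g)
    (hgN : EqOn g (height ε τ R) N) {F : Heis → Heis} (hF : ContDiff ℝ 1 F)
    (hc : HasCompactSupport F) (hFN : tsupport F ⊆ {p | p.1 ∈ N ∧ 0 < p.2})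
    (hnormal : ∀ u, Complex.equivRealProdCLM.symm u ∈ N →
      tripleProduct (F (shearedGraph 0 g u)) (fderiv ℝ (shearedGraph 0 g) u (1, 0))
        (fderiv ℝ (shearedGraph 0 g) u (0, 1))
        = areaDensity ε τ (shearedGraph 0 g) u
          * riemNorm ε τ (shearedGraph 0 g u) (F (shearedGraph 0 g u))) :
    0 ≤ ∫ p in domain ε τ R, divergence F p ∧
    ∫⁻ p, ENNReal.ofReal (riemNorm ε τ p (F p)) ∂(surfaceMeasure ε τ (sphere ε τ R))
      ≤ ENNReal.ofReal (∫ p in domain ε τ R, divergence F p) := by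
  set O : Set Heis := {p | p.1 ∈ N ∧ 0 < p.2} with hOdef
  have hO : IsOpen O :=
    (hN.preimage continuous_fst).inter (isOpen_lt continuous_const continuous_snd)
  set ψ := shearedGraph 0 g with hψdef
  have hψs : ContDiff ℝ ∞ ψ := contDiff_shearedGraph 0 hg
  have hψapp : ∀ u, ψ u = (Complex.equivRealProdCLM.symm u, g (Complex.equivRealProdCLM.symm u)) :=
    fun u => by simp [hψdef, shearedGraph, shear_apply]
  have hF0 : ∀ p ∉ O, F p = 0 := fun p hp => by
    by_contra h
    exact hp (hFN (subset_tsupport _ h))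
  have hle : (surfaceMeasure ε τ (sphere ε τ R)).restrict O
      ≤ patchMeasure ε τ (Complex.equivRealProdCLM.symm ⁻¹' N) ψ :=
    surfaceMeasure_restrict_le hO fun U ψ hψ => patchMeasure_le_of_subset_graph hN
      hg.contDiffOn (fun p hp => ⟨hp.2.1, by
        rw [hgN hp.2.1]; exact (mem_sphere_of_pos hp.1 hp.2.2).2⟩) hψ
  have hmeas : Measurable fun p => ENNReal.ofReal (riemNorm ε τ p (F p)) :=
    (continuous_riemNorm ε τ hF.continuous).measurable.ennreal_ofReal
  have hnonneg : ∀ u, 0 ≤ tripleProduct (F (ψ u)) (fderiv ℝ ψ u (1, 0)) (fderiv ℝ ψ u (0, 1)) := by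
    intro u
    by_cases hu : Complex.equivRealProdCLM.symm u ∈ N
    · rw [hnormal u hu]
      exact mul_nonneg (Real.sqrt_nonneg _) (Real.sqrt_nonneg _)
    · rw [hF0 (ψ u) fun h => hu (by rw [hψapp] at h; exact h.1)]
      simp [tripleProduct]
  have hcont : Continuous fun u =>
      tripleProduct (F (ψ u)) (fderiv ℝ ψ u (1, 0)) (fderiv ℝ ψ u (0, 1)) := by
    have h0 : Continuous fun u => F (ψ u) := hF.continuous.comp hψs.continuous
    have h1 : Continuous fun u => fderiv ℝ ψ u (1, 0) :=
      (hψs.continuous_fderiv (by simp)).clm_apply continuous_const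
    have h2 : Continuous fun u => fderiv ℝ ψ u (0, 1) :=
      (hψs.continuous_fderiv (by simp)).clm_apply continuous_const
    unfold tripleProduct
    fun_prop
  have hsupp : HasCompactSupport fun u =>
      tripleProduct (F (ψ u)) (fderiv ℝ ψ u (1, 0)) (fderiv ℝ ψ u (0, 1)) := by
    refine HasCompactSupport.intro ((hc.isCompact.image continuous_fst).image
      Complex.equivRealProdCLM.continuous) fun u hu => ?_
    have : F (ψ u) = 0 := by
      by_contra h
      refine hu ⟨_, ⟨ψ u, subset_tsupport _ h, rfl⟩, ?_⟩
      rw [hψapp]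
      simp
    simp [this, tripleProduct]
  have hset : ∫ p in domain ε τ R, divergence F p
      = ∫ p in {p : Heis | p.2 < g (p.1 - p.2 • (0 : ℂ))}, divergence F p := by
    refine setIntegral_divergence_congr (isOpen_domain ε τ R).measurableSet
      (isOpen_lt continuous_snd (by have := hg.continuous; fun_prop)).measurableSet hFN ?_
    rintro p ⟨hpN, hp0⟩
    have h1 : ‖p.1‖ < R := mem_ball_zero_iff.1 (hNR hpN)
    have h2 := hgN hpN
    simp only [height] at h2
    simp [domain, h1, abs_of_pos hp0, h2]
  rw [hset, integral_divergence_sheared_subgraph hF hc 0 hg]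
  refine ⟨integral_nonneg hnonneg, ?_⟩
  rw [ofReal_integral_eq_lintegral_ofReal
    (hcont.integrable_of_hasCompactSupport hsupp) (.of_forall hnonneg)]
  calc ∫⁻ p, ENNReal.ofReal (riemNorm ε τ p (F p)) ∂(surfaceMeasure ε τ (sphere ε τ R))
      = ∫⁻ p in O, ENNReal.ofReal (riemNorm ε τ p (F p)) ∂(surfaceMeasure ε τ (sphere ε τ R)) := by
        rw [← lintegral_indicator hO.measurableSet]
        refine lintegral_congr fun p => ?_
        by_cases hp : p ∈ O
        · rw [indicator_of_mem hp]
        · rw [indicator_of_notMem hp, hF0 p hp]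
          simp [riemNorm, metric, coordX, coordY, coordT]
    _ ≤ ∫⁻ p, ENNReal.ofReal (riemNorm ε τ p (F p))
          ∂(patchMeasure ε τ (Complex.equivRealProdCLM.symm ⁻¹' N) ψ) :=
        lintegral_mono' hle le_rfl
    _ = ∫⁻ u in Complex.equivRealProdCLM.symm ⁻¹' N, ENNReal.ofReal (areaDensity ε τ ψ u)
          * ENNReal.ofReal (riemNorm ε τ (ψ u) (F (ψ u))) :=
        lintegral_patchMeasure ε τ hψs hmeas
    _ = ∫⁻ u in Complex.equivRealProdCLM.symm ⁻¹' N, ENNReal.ofReal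
          (tripleProduct (F (ψ u)) (fderiv ℝ ψ u (1, 0)) (fderiv ℝ ψ u (0, 1))) := by
        refine setLIntegral_congr_fun
          (hN.preimage Complex.equivRealProdCLM.symm.continuous).measurableSet fun u hu => ?_
        rw [hnormal u hu, areaDensity_eq, ENNReal.ofReal_mul (Real.sqrt_nonneg _)]
    _ ≤ _ := setLIntegral_le_lintegral _ _

/-! ### The calibrating field and its divergence -/

/-- The field with horizontal part determined by `M`: the unit normal, at a point where the leaf of
radius `√(|z|² + M²)` has depth `M`. -/
def calibField (ε τ : ℝ) (M : Heis → ℝ) (p : Heis) : Heis :=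
  ((ε * √(‖p.1‖ ^ 2 + M p ^ 2))⁻¹ • p.1
      - (τ * M p * (omega ε τ ‖p.1‖ * √(‖p.1‖ ^ 2 + M p ^ 2))⁻¹) • (Complex.I * p.1),
    ε ^ 2 * (omega ε τ ‖p.1‖ * M p * (√(‖p.1‖ ^ 2 + M p ^ 2))⁻¹))

theorem radius_pos {M : Heis → ℝ} {p : Heis} (hM : 0 < M p) : 0 < √(‖p.1‖ ^ 2 + M p ^ 2) :=
  Real.sqrt_pos.2 (by positivity)

theorem riemNorm_calibField {ε : ℝ} (hε : 0 < ε) (τ : ℝ) {M : Heis → ℝ} {p : Heis}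
    (hM : 0 < M p) : riemNorm ε τ p (calibField ε τ M p) = 1 := by
  have hn := radius_pos hM
  have hn2 : √(‖p.1‖ ^ 2 + M p ^ 2) ^ 2 = ‖p.1‖ ^ 2 + M p ^ 2 := Real.sq_sqrt (by positivity)
  have ho := omega_pos ε τ ‖p.1‖
  have ho2 := omega_sq ε τ ‖p.1‖
  have e : metric ε τ p (calibField ε τ M p) (calibField ε τ M p) = 1 := by
    unfold calibField
    set n := √(‖p.1‖ ^ 2 + M p ^ 2)
    set o := omega ε τ ‖p.1‖
    rw [norm_sq_eq] at hn2 ho2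
    simp only [metric, coordX, coordY, coordT, sigma, Complex.sub_re, Complex.sub_im,
      Complex.smul_re, Complex.smul_im, Complex.mul_re, Complex.mul_im, Complex.I_re,
      Complex.I_im, smul_eq_mul]
    set x := p.1.re
    set y := p.1.im
    set m := M p
    -- The coefficient along `T` simplifies through `ω² - τ²ε²r² = 1`.
    have h1 : (ε ^ 2 * (o * m * n⁻¹) - τ * ε ^ 4 *
        (y * ((ε * n)⁻¹ * x - τ * m * (o * n)⁻¹ * (0 * x - 1 * y))
          - x * ((ε * n)⁻¹ * y - τ * m * (o * n)⁻¹ * (0 * y + 1 * x)))) / ε ^ 2 = m / (o * n) := by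
      have : ε ^ 2 * (o * m * n⁻¹) - τ * ε ^ 4 *
        (y * ((ε * n)⁻¹ * x - τ * m * (o * n)⁻¹ * (0 * x - 1 * y))
          - x * ((ε * n)⁻¹ * y - τ * m * (o * n)⁻¹ * (0 * y + 1 * x)))
          = ε ^ 2 * m * (o ^ 2 - τ ^ 2 * ε ^ 2 * (x ^ 2 + y ^ 2)) / (o * n) := by
        field_simp
        ring
      rw [this, ho2]
      field_simp
      ring
    rw [h1]
    have h2 : ε * ((ε * n)⁻¹ * x - τ * m * (o * n)⁻¹ * (0 * x - 1 * y))
        = (o * x + ε * τ * m * y) / (o * n) := by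
      field_simp
      ring
    have h3 : ε * ((ε * n)⁻¹ * y - τ * m * (o * n)⁻¹ * (0 * y + 1 * x))
        = (o * y - ε * τ * m * x) / (o * n) := by
      field_simp
      ring
    rw [h2, h3]
    have h4 : (o * x + ε * τ * m * y) ^ 2 + (o * y - ε * τ * m * x) ^ 2 + m ^ 2
        = (o * n) ^ 2 := by
      have : (o * x + ε * τ * m * y) ^ 2 + (o * y - ε * τ * m * x) ^ 2 + m ^ 2
        = o ^ 2 * (x ^ 2 + y ^ 2) + m ^ 2 * (1 + τ ^ 2 * ε ^ 2 * (x ^ 2 + y ^ 2)) := by ring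
      rw [this, ← ho2, mul_pow, hn2]
      ring
    have h5 : o * n ≠ 0 := by positivity
    field_simp
    linarith
  rw [riemNorm, e, Real.sqrt_one]

theorem contDiffAt_calibField {ε : ℝ} (hε : 0 < ε) (τ : ℝ) {M : Heis → ℝ} {p : Heis}
    (hM : 0 < M p) (h : ContDiffAt ℝ 1 M p) : ContDiffAt ℝ 1 (calibField ε τ M) p := by
  have h1 : ContDiffAt ℝ 1 (fun p : Heis => p.1) p := contDiffAt_fst
  have h2 : ContDiffAt ℝ 1 (fun p : Heis => omega ε τ ‖p.1‖) p :=
    ((contDiff_omega ε τ).of_le (by norm_cast)).contDiffAt.comp p h1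
  have h3 : ContDiffAt ℝ 1 (fun p : Heis => √(‖p.1‖ ^ 2 + M p ^ 2)) p :=
    ((h1.norm_sq ℝ).add (h.pow 2)).sqrt (by positivity)
  have hn := (radius_pos hM).ne'
  have ho := (omega_pos ε τ ‖p.1‖).ne'
  have h4 : ContDiffAt ℝ 1 (fun p : Heis => (ε * √(‖p.1‖ ^ 2 + M p ^ 2))⁻¹) p :=
    (contDiffAt_const.mul h3).inv (mul_ne_zero hε.ne' hn)
  have h5 : ContDiffAt ℝ 1 (fun p : Heis => (omega ε τ ‖p.1‖ * √(‖p.1‖ ^ 2 + M p ^ 2))⁻¹) p :=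
    (h2.mul h3).inv (mul_ne_zero ho hn)
  exact ((h4.smul h1).sub (((contDiffAt_const.mul h).mul h5).smul
    (contDiffAt_const.mul h1))).prodMk
      (contDiffAt_const.mul ((h2.mul h).mul (h3.inv hn)))

/-- The divergence of a rotationally symmetric field. -/
theorem divergence_radial {A B C : Heis → ℝ} {p : Heis} {A' B' C' : Heis →L[ℝ] ℝ}
    (hA : HasFDerivAt A A' p) (hB : HasFDerivAt B B' p) (hC : HasFDerivAt C C' p) :
    divergence (fun p => (A p • p.1 - B p • (Complex.I * p.1), C p)) p
      = 2 * A p + A' (p.1, 0) - B' (Complex.I * p.1, 0) + C' (0, 1) := by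
  have hI : HasFDerivAt (fun p : Heis => Complex.I * p.1)
      ((ContinuousLinearMap.mul ℝ ℂ Complex.I) ∘L ContinuousLinearMap.fst ℝ ℂ ℝ) p :=
    (ContinuousLinearMap.mul ℝ ℂ Complex.I).hasFDerivAt.comp p hasFDerivAt_fst
  have h1 := (hA.smul (hasFDerivAt_fst (p := p))).sub (hB.smul hI)
  have h2 : HasFDerivAt (fun p => (A p • p.1 - B p • (Complex.I * p.1), C p)) _ p := h1.prodMk hC
  have e : ∀ (L : Heis →L[ℝ] ℝ) (v : ℂ), L (v, 0) = v.re * L (1, 0) + v.im * L (Complex.I, 0) :=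
    fun L v => map_eq_re_mul_add_im_mul (L ∘L ContinuousLinearMap.inl ℝ ℂ ℝ) v
  rw [e A' p.1, e B' (Complex.I * p.1)]
  unfold divergence
  rw [h2.fderiv]
  simp
  ring

theorem hasFDerivAt_norm_sq_fst (p : Heis) :
    HasFDerivAt (fun p : Heis => ‖p.1‖ ^ 2)
      ((2 : ℝ) • (innerSL ℝ p.1 ∘L ContinuousLinearMap.fst ℝ ℂ ℝ)) p :=
  (hasFDerivAt_norm_sq p.1).comp p hasFDerivAt_fst

theorem hasFDerivAt_inv_of_ne_zero {f : Heis → ℝ} {f' : Heis →L[ℝ] ℝ} {p : Heis}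
    (h : HasFDerivAt f f' p) (h0 : f p ≠ 0) :
    HasFDerivAt (fun p => (f p)⁻¹) (-(f p ^ 2)⁻¹ • f') p :=
  (hasDerivAt_inv h0).comp_hasFDerivAt p h

/-- The leaf through `p` has slope `dt/dr = -ε³ωr/M`, so the last bracket is, up to the factor `2r`,
the derivative of `n² = r² + M²` along the leaf. It vanishes for a genuine foliation by vertically
translated spheres, leaving the mean curvature term `2/(εn)`. The part of the field along `i z`
contributes nothing because its coefficient is rotationally invariant. -/
theorem divergence_calibField {ε : ℝ} (hε : 0 < ε) (τ : ℝ) {M : Heis → ℝ} {p : Heis}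
    (hM : 0 < M p) {μ ν : ℝ} (h : HasFDerivAt M (μ • (innerSL ℝ p.1 ∘L
      ContinuousLinearMap.fst ℝ ℂ ℝ) + ν • ContinuousLinearMap.snd ℝ ℂ ℝ) p) :
    divergence (calibField ε τ M) p = 2 / (ε * √(‖p.1‖ ^ 2 + M p ^ 2))
      - ‖p.1‖ ^ 2 / (ε * √(‖p.1‖ ^ 2 + M p ^ 2) ^ 3)
        * (1 + M p * μ - ε ^ 3 * omega ε τ ‖p.1‖ * ν) := by
  have hn := radius_pos hM
  have ho := omega_pos ε τ ‖p.1‖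
  have hN := ((hasFDerivAt_norm_sq_fst p).add (h.pow 2)).sqrt (by
    have : 0 < ‖p.1‖ ^ 2 + M p ^ 2 := by positivity
    exact this.ne')
  have hn2 : √(‖p.1‖ ^ 2 + M p ^ 2) ^ 2 = ‖p.1‖ ^ 2 + M p ^ 2 := Real.sq_sqrt (by positivity)
  have hN' : HasFDerivAt (fun p : Heis => √(‖p.1‖ ^ 2 + M p ^ 2))
      (((1 + M p * μ) / √(‖p.1‖ ^ 2 + M p ^ 2)) • (innerSL ℝ p.1 ∘L
        ContinuousLinearMap.fst ℝ ℂ ℝ) + (M p * ν / √(‖p.1‖ ^ 2 + M p ^ 2)) •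
          ContinuousLinearMap.snd ℝ ℂ ℝ) p := by
    refine hN.congr_fderiv ?_
    ext v <;> simp <;> field_simp
  have hO : HasFDerivAt (fun p : Heis => omega ε τ ‖p.1‖)
      (((τ ^ 2 * ε ^ 2 / omega ε τ ‖p.1‖) • innerSL ℝ p.1) ∘L ContinuousLinearMap.fst ℝ ℂ ℝ) p :=
    (hasFDerivAt_omega ε τ p.1).comp p hasFDerivAt_fst
  have hA := hasFDerivAt_inv_of_ne_zero (hN'.const_mul ε) (mul_ne_zero hε.ne' hn.ne')
  have hB := (h.const_mul τ).mul (hasFDerivAt_inv_of_ne_zero (hO.mul hN') (mul_ne_zero ho.ne' hn.ne'))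
  have hC := ((hO.mul h).mul (hasFDerivAt_inv_of_ne_zero hN' hn.ne')).const_mul (ε ^ 2)
  have key := divergence_radial hA hB hC
  have hrot : innerSL ℝ p.1 (Complex.I * p.1) = 0 := by
    rw [innerSL_apply_eq]
    simp
    ring
  have hself : innerSL ℝ p.1 p.1 = ‖p.1‖ ^ 2 := by
    rw [innerSL_apply_eq, norm_sq_eq]
    ring
  refine key.trans ?_
  simp only [add_apply, smul_apply, ContinuousLinearMap.comp_apply, Pi.mul_apply,
    ContinuousLinearMap.coe_fst', ContinuousLinearMap.coe_snd', hrot, hself, smul_eq_mul, mul_zero,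
    add_zero, map_zero, zero_add, mul_one, sub_zero]
  have hr : ‖p.1‖ ^ 2 = √(‖p.1‖ ^ 2 + M p ^ 2) ^ 2 - M p ^ 2 := by linarith
  set n := √(‖p.1‖ ^ 2 + M p ^ 2)
  rw [hr]
  field_simp
  ring

/-! ### A `C¹` positive part -/

/-- A continuous ramp from `0` to `1` on `[0, η]`. -/
def ramp (η x : ℝ) : ℝ := min 1 (max 0 (x / η))

/-- A `C¹` approximation of the positive part. -/
def smoothPos (η d : ℝ) : ℝ := ∫ x in (0 : ℝ)..d, ramp η x

theorem continuous_ramp (η : ℝ) : Continuous (ramp η) := by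
  unfold ramp
  fun_prop

theorem ramp_nonneg (η x : ℝ) : 0 ≤ ramp η x := le_min zero_le_one (le_max_left _ _)

theorem ramp_le_one (η x : ℝ) : ramp η x ≤ 1 := min_le_left _ _

theorem ramp_of_nonpos {η x : ℝ} (hη : 0 < η) (hx : x ≤ 0) : ramp η x = 0 := by
  rw [ramp, max_eq_left (div_nonpos_of_nonpos_of_nonneg hx hη.le), min_eq_right zero_le_one]

theorem ramp_of_le {η x : ℝ} (hη : 0 < η) (hx : η ≤ x) : ramp η x = 1 :=
  min_eq_left (((one_le_div hη).2 hx).trans (le_max_right _ _))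

theorem hasDerivAt_smoothPos (η d : ℝ) : HasDerivAt (smoothPos η) (ramp η d) d :=
  (continuous_ramp η).integral_hasStrictDerivAt 0 d |>.hasDerivAt

/-- The vanishing of the ramp at `0` makes the depth function, and hence the calibrating field, `C¹`
across the sphere. The price is an error of at most `η`, which later tends to zero. -/
theorem contDiff_smoothPos (η : ℝ) : ContDiff ℝ 1 (smoothPos η) := by
  refine contDiff_one_iff_deriv.2 ⟨fun d => (hasDerivAt_smoothPos η d).differentiableAt, ?_⟩
  rw [funext fun d => (hasDerivAt_smoothPos η d).deriv]
  exact continuous_ramp η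

theorem smoothPos_of_nonpos {η d : ℝ} (hη : 0 < η) (hd : d ≤ 0) : smoothPos η d = 0 := by
  rw [smoothPos, intervalIntegral.integral_congr (g := fun _ => 0), intervalIntegral.integral_zero]
  intro x hx
  rw [uIcc_of_ge hd] at hx
  exact ramp_of_nonpos hη hx.2

theorem smoothPos_nonneg {η d : ℝ} (hd : 0 ≤ d) : 0 ≤ smoothPos η d :=
  intervalIntegral.integral_nonneg hd fun x _ => ramp_nonneg η x

theorem smoothPos_le {η d : ℝ} (hd : 0 ≤ d) : smoothPos η d ≤ d := by
  have := intervalIntegral.integral_mono_on hd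
    ((continuous_ramp η).intervalIntegrable (μ := volume) 0 d)
    (intervalIntegrable_const (c := (1 : ℝ))) fun x _ => ramp_le_one η x
  simpa [smoothPos] using this

theorem sub_le_smoothPos {η d : ℝ} (hη : 0 < η) (hd : 0 ≤ d) : d - η ≤ smoothPos η d := by
  rcases le_total d η with h | h
  · linarith [smoothPos_nonneg (η := η) hd]
  · have h1 := intervalIntegral.integral_add_adjacent_intervals
      ((continuous_ramp η).intervalIntegrable (μ := volume) 0 η)
      ((continuous_ramp η).intervalIntegrable (μ := volume) η d)
    have h2 : ∫ x in η..d, ramp η x = d - η := by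
      rw [intervalIntegral.integral_congr (g := fun _ => 1)]
      · simp
      · intro x hx
        rw [uIcc_of_le h] at hx
        exact ramp_of_le hη hx.1
    have h3 := smoothPos_nonneg (η := η) hη.le
    unfold smoothPos at h3 ⊢
    linarith

/-! ### The leaves and their depth -/

/-- The distance in the `√(R² - r²)` variable to the innermost leaf. -/
def leafGap (ε τ R a η : ℝ) (p : Heis) : ℝ :=
  depth R p.1 - a
    - smoothPos η ((height ε τ R p.1 - p.2) / (ε ^ 3 * omega ε τ R))

/-- The depth `√(s² - r²)` of the leaf of radius `s` through a point inside the domain. -/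
def leafDepth (ε τ R a η : ℝ) (p : Heis) : ℝ :=
  (depth R p.1 ^ 2 - a ^ 2 + leafGap ε τ R a η p ^ 2) / (2 * leafGap ε τ R a η p)

/-- The depth function of the calibration: leaves of larger radius inside the domain, vertical
translates of the sphere outside. -/
def calibDepth (ε τ R a η : ℝ) (p : Heis) : ℝ :=
  if p.2 < height ε τ R p.1 then leafDepth ε τ R a η p else depth R p.1

/-- The depth `√(R² - r₀²)` over the circle of radius `r₀ = R - δ`. -/
def rimDepth (R δ : ℝ) : ℝ := √(R ^ 2 - (R - δ) ^ 2)

section Leaf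

variable {ε τ R δ η : ℝ} {p : Heis}

theorem rimDepth_nonneg : 0 ≤ rimDepth R δ := Real.sqrt_nonneg _

theorem rimDepth_lt_depth (hδR : δ ≤ R) (hR : 0 ≤ δ) (h : ‖p.1‖ < R - δ) :
    rimDepth R δ < depth R p.1 := by
  have h0 := norm_nonneg p.1
  exact Real.sqrt_lt_sqrt (by nlinarith) (by nlinarith)

theorem profile_nonneg (hε : 0 < ε) (hδ : 0 ≤ δ) (hδR : δ < R) : 0 ≤ profile ε τ (R - δ) R := by
  have h := (strictAntiOn_profileSq hε τ R).antitoneOn (a := (R - δ) ^ 2) (b := R ^ 2)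
    ⟨sq_nonneg _, by nlinarith⟩ ⟨sq_nonneg _, le_rfl⟩ (by nlinarith)
  rwa [profileSq_self] at h

theorem isOpen_halfCylinder : IsOpen (halfCylinder ε τ R δ) := by
  have h1 : IsOpen {p : Heis | ‖p.1‖ < R} := isOpen_lt (by fun_prop) continuous_const
  have h2 : IsOpen {p : Heis | profile ε τ (R - δ) R < p.2} :=
    isOpen_lt continuous_const continuous_snd
  exact h1.inter h2

theorem norm_lt_of_mem_of_le (hε : 0 < ε) (hδ : 0 ≤ δ) (hδR : δ < R)
    (hp : p ∈ halfCylinder ε τ R δ) (h : p.2 ≤ height ε τ R p.1) : ‖p.1‖ < R - δ :=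
  norm_lt_of_profile_lt hε τ hp.1 (by linarith) (by linarith) (hp.2.trans_le h)

theorem slopeBound_pos (hε : 0 < ε) : 0 < ε ^ 3 * omega ε τ R := by
  have := omega_pos ε τ R
  positivity

/-- A point above the rim height has vertical gap less than `f(r) - f(r₀)`, which the slope bound
makes at most `ε³ω(R)(w - a)`. Smoothing only decreases the quantity subtracted. -/
theorem leafGap_pos (hε : 0 < ε) (hδ : 0 ≤ δ) (hδR : δ < R)
    (hp : p ∈ halfCylinder ε τ R δ) (h : p.2 ≤ height ε τ R p.1) :
    0 < leafGap ε τ R (rimDepth R δ) η p := by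
  have hr := norm_lt_of_mem_of_le hε hδ hδR hp h
  obtain ⟨h1, h2⟩ := hp
  have hK : 0 < ε ^ 3 * omega ε τ R := slopeBound_pos hε
  have h3 := height_sub_le hε τ (by linarith : R - δ ≤ R) hr.le
  have h4 : (height ε τ R p.1 - p.2) / (ε ^ 3 * omega ε τ R) < depth R p.1 - rimDepth R δ := by
    rw [div_lt_iff₀ hK, rimDepth]
    linarith
  have h5 := smoothPos_le (η := η) (div_nonneg (sub_nonneg.2 h) hK.le)
  unfold leafGap
  linarith

theorem leafGap_le (hε : 0 < ε) (h : p.2 ≤ height ε τ R p.1) (a : ℝ) :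
    leafGap ε τ R a η p ≤ depth R p.1 - a := by
  have h5 := smoothPos_nonneg (η := η)
    (div_nonneg (sub_nonneg.2 h) (slopeBound_pos (τ := τ) (R := R) hε).le)
  unfold leafGap
  linarith

/-- With `e` the leaf gap and `w` the depth, the claim is `(w - e)² ≥ a²`. It says that leaves
inside the domain have radius at least `R`. -/
theorem depth_le_leafDepth {a : ℝ} (ha : 0 ≤ a) (h0 : 0 < leafGap ε τ R a η p)
    (h1 : leafGap ε τ R a η p ≤ depth R p.1 - a) : depth R p.1 ≤ leafDepth ε τ R a η p := by
  rw [leafDepth, le_div_iff₀ (by positivity)]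
  nlinarith

theorem gap_add_le_leafDepth {a : ℝ} (ha : 0 ≤ a) (h0 : 0 < leafGap ε τ R a η p)
    (h1 : leafGap ε τ R a η p ≤ depth R p.1 - a) :
    leafGap ε τ R a η p + a ≤ leafDepth ε τ R a η p := by
  rw [leafDepth, le_div_iff₀ (by positivity)]
  nlinarith

theorem hasFDerivAt_leafGap (hz : ‖p.1‖ < R) (a : ℝ) :
    HasFDerivAt (leafGap ε τ R a η)
      (((-1 + ramp η ((height ε τ R p.1 - p.2) / (ε ^ 3 * omega ε τ R))
          * (ε ^ 3 * omega ε τ ‖p.1‖ / (ε ^ 3 * omega ε τ R))) / depth R p.1) •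
          (innerSL ℝ p.1 ∘L ContinuousLinearMap.fst ℝ ℂ ℝ)
        + (ramp η ((height ε τ R p.1 - p.2) / (ε ^ 3 * omega ε τ R)) / (ε ^ 3 * omega ε τ R)) •
          ContinuousLinearMap.snd ℝ ℂ ℝ) p := by
  have h1 := (hasFDerivAt_depth hz).comp p (hasFDerivAt_fst (𝕜 := ℝ) (p := p))
  have h2 := (hasFDerivAt_height ε τ hz).comp p (hasFDerivAt_fst (𝕜 := ℝ) (p := p))
  have h3 := (h2.sub (hasFDerivAt_snd (𝕜 := ℝ) (p := p))).mul_const (ε ^ 3 * omega ε τ R)⁻¹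
  have h4 := (hasDerivAt_smoothPos η ((height ε τ R p.1 - p.2) * (ε ^ 3 * omega ε τ R)⁻¹)
    ).comp_hasFDerivAt p h3
  have h5 : HasFDerivAt (leafGap ε τ R a η) _ p := (h1.sub_const a).sub h4
  have hw := depth_pos hz
  refine h5.congr_fderiv ?_
  rw [← div_eq_mul_inv]
  generalize ramp η ((height ε τ R p.1 - p.2) / (ε ^ 3 * omega ε τ R)) = ρ
  generalize ε ^ 3 * omega ε τ R = K
  refine ContinuousLinearMap.ext fun v => ?_
  simp only [add_apply, sub_apply, smul_apply, ContinuousLinearMap.comp_apply, smul_eq_mul,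
    ContinuousLinearMap.coe_fst', ContinuousLinearMap.coe_snd']
  ring

theorem contDiffAt_leafGap (hz : ‖p.1‖ < R) (a : ℝ) : ContDiffAt ℝ 1 (leafGap ε τ R a η) p := by
  have h1 : ContDiffAt ℝ 1 (fun p : Heis => depth R p.1) p :=
    ((contDiffAt_depth hz).of_le (by norm_cast)).comp p contDiffAt_fst
  have h2 : ContDiffAt ℝ 1 (fun p : Heis => height ε τ R p.1) p :=
    (((contDiffOn_height ε τ R).contDiffAt (Metric.isOpen_ball.mem_nhds
      (mem_ball_zero_iff.2 hz))).of_le (by norm_cast)).comp p contDiffAt_fst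
  exact (h1.sub contDiffAt_const).sub ((contDiff_smoothPos η).contDiffAt.comp p
    ((h2.sub contDiffAt_snd).div_const _))

theorem contDiffAt_leafDepth (hz : ‖p.1‖ < R) {a : ℝ} (h0 : leafGap ε τ R a η p ≠ 0) :
    ContDiffAt ℝ 1 (leafDepth ε τ R a η) p := by
  have h1 : ContDiffAt ℝ 1 (fun p : Heis => depth R p.1) p :=
    ((contDiffAt_depth hz).of_le (by norm_cast)).comp p contDiffAt_fst
  have h2 : ContDiffAt ℝ 1 (leafGap ε τ R a η) p := contDiffAt_leafGap hz a
  exact (((h1.pow 2).sub contDiffAt_const).add (h2.pow 2)).div (contDiffAt_const.mul h2)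
    (mul_ne_zero two_ne_zero h0)

/-- The derivative of the leaf depth in terms of that of the leaf gap. -/
theorem hasFDerivAt_leafDepth (hz : ‖p.1‖ < R) {a : ℝ} (h0 : leafGap ε τ R a η p ≠ 0) {α β : ℝ}
    (hg : HasFDerivAt (leafGap ε τ R a η) (α • (innerSL ℝ p.1 ∘L ContinuousLinearMap.fst ℝ ℂ ℝ)
      + β • ContinuousLinearMap.snd ℝ ℂ ℝ) p) :
    HasFDerivAt (leafDepth ε τ R a η)
      ((-(leafGap ε τ R a η p)⁻¹ + (1 - leafDepth ε τ R a η p / leafGap ε τ R a η p) * α) •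
          (innerSL ℝ p.1 ∘L ContinuousLinearMap.fst ℝ ℂ ℝ)
        + ((1 - leafDepth ε τ R a η p / leafGap ε τ R a η p) * β) •
          ContinuousLinearMap.snd ℝ ℂ ℝ) p := by
  have h1 := (hasFDerivAt_depth hz).comp p (hasFDerivAt_fst (𝕜 := ℝ) (p := p))
  have h2 := (((h1.pow 2).sub_const (a ^ 2)).add (hg.pow 2)).mul
    (hasFDerivAt_inv_of_ne_zero (hg.const_mul 2) (mul_ne_zero two_ne_zero h0))
  have h3 : HasFDerivAt (leafDepth ε τ R a η) _ p := h2
  have hw := depth_pos hz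
  refine h3.congr_fderiv (ContinuousLinearMap.ext fun v => ?_)
  simp only [add_apply, smul_apply, ContinuousLinearMap.comp_apply, smul_eq_mul, nsmul_eq_mul,
    ContinuousLinearMap.coe_fst', ContinuousLinearMap.coe_snd', Pi.add_apply,
    Function.comp_apply, leafDepth]
  field_simp
  simp
  ring

/-- Above the sphere the smoothed gap is zero, the leaf gap is `w - a`, and the leaf formula returns
`M = w`, provided `w ≠ a`. So near points on or below the sphere one formula covers both branches.
-/
theorem calibDepth_eventuallyEq_leafDepth (hε : 0 < ε) (hη : 0 < η) (hδ : 0 ≤ δ) (hδR : δ < R)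
    (hp : p ∈ halfCylinder ε τ R δ) (h : p.2 ≤ height ε τ R p.1) :
    calibDepth ε τ R (rimDepth R δ) η =ᶠ[𝓝 p] leafDepth ε τ R (rimDepth R δ) η := by
  have hlt := rimDepth_lt_depth hδR.le hδ (norm_lt_of_mem_of_le hε hδ hδR hp h)
  have hcont : Continuous fun p : Heis => depth R p.1 := by
    unfold depth
    fun_prop
  filter_upwards [hcont.continuousAt.eventually_const_lt hlt] with q hq
  unfold calibDepth
  split_ifs with hqh
  · rfl
  · have h0 : smoothPos η ((height ε τ R q.1 - q.2) / (ε ^ 3 * omega ε τ R)) = 0 :=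
      smoothPos_of_nonpos hη (div_nonpos_of_nonpos_of_nonneg (by linarith) (slopeBound_pos hε).le)
    have h1 := (sub_pos.2 hq).ne'
    rw [leafDepth, leafGap, h0, sub_zero]
    field_simp
    ring

theorem calibDepth_eventuallyEq_depth (h : height ε τ R p.1 < p.2) (a : ℝ) :
    calibDepth ε τ R a η =ᶠ[𝓝 p] fun p => depth R p.1 := by
  have h1 : Continuous fun p : Heis => height ε τ R p.1 :=
    (continuous_height ε τ R).comp continuous_fst
  filter_upwards [(isOpen_lt h1 continuous_snd).mem_nhds h] with q hq
  exact if_neg (not_lt_of_gt hq)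

theorem calibDepth_of_le (h : height ε τ R p.1 ≤ p.2) (a : ℝ) :
    calibDepth ε τ R a η p = depth R p.1 := if_neg (not_lt_of_ge h)

theorem contDiffAt_calibDepth (hε : 0 < ε) (hη : 0 < η) (hδ : 0 ≤ δ) (hδR : δ < R)
    (hp : p ∈ halfCylinder ε τ R δ) : ContDiffAt ℝ 1 (calibDepth ε τ R (rimDepth R δ) η) p := by
  rcases le_or_gt p.2 (height ε τ R p.1) with h | h
  · exact (contDiffAt_leafDepth hp.1 (leafGap_pos hε hδ hδR hp h).ne').congr_of_eventuallyEq
      (calibDepth_eventuallyEq_leafDepth hε hη hδ hδR hp h)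
  · exact (((contDiffAt_depth hp.1).of_le (by norm_cast)).comp p
      contDiffAt_fst).congr_of_eventuallyEq (calibDepth_eventuallyEq_depth h _)

theorem depth_le_calibDepth (hε : 0 < ε) (hδ : 0 ≤ δ) (hδR : δ < R)
    (hp : p ∈ halfCylinder ε τ R δ) : depth R p.1 ≤ calibDepth ε τ R (rimDepth R δ) η p := by
  unfold calibDepth
  split_ifs with h
  · exact depth_le_leafDepth rimDepth_nonneg (leafGap_pos hε hδ hδR hp h.le) (leafGap_le hε h.le _)
  · exact le_rfl

theorem calibDepth_pos (hε : 0 < ε) (hδ : 0 ≤ δ) (hδR : δ < R)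
    (hp : p ∈ halfCylinder ε τ R δ) : 0 < calibDepth ε τ R (rimDepth R δ) η p :=
  (depth_pos hp.1).trans_le (depth_le_calibDepth hε hδ hδR hp)

theorem sqrt_norm_sq_add_depth_sq (hz : ‖p.1‖ < R) : √(‖p.1‖ ^ 2 + depth R p.1 ^ 2) = R := by
  rw [depth_sq hz.le, add_sub_cancel, Real.sqrt_sq ((norm_nonneg _).trans hz.le)]

/-- Inside the domain the divergence is at most the mean curvature of the leaf. -/
theorem divergence_calib_le (hε : 0 < ε) (hη : 0 < η) (hδ : 0 ≤ δ) (hδR : δ < R)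
    (hp : p ∈ halfCylinder ε τ R δ) (h : p.2 < height ε τ R p.1) :
    divergence (calibField ε τ (calibDepth ε τ R (rimDepth R δ) η)) p
      ≤ 2 / (ε * √(‖p.1‖ ^ 2 + leafDepth ε τ R (rimDepth R δ) η p ^ 2)) := by
  set a := rimDepth R δ
  have hMpos := calibDepth_pos (η := η) hε hδ hδR hp
  have hev := calibDepth_eventuallyEq_leafDepth hε hη hδ hδR hp h.le
  have hMeq : calibDepth ε τ R a η p = leafDepth ε τ R a η p := hev.eq_of_nhds
  have he := leafGap_pos (η := η) hε hδ hδR hp h.le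
  have hle := leafGap_le (η := η) hε h.le a
  have hd := (hasFDerivAt_leafDepth hp.1 he.ne' (hasFDerivAt_leafGap hp.1 a)).congr_of_eventuallyEq
    hev
  rw [divergence_calibField hε τ hMpos hd, hMeq]
  rw [hMeq] at hMpos
  have hw := depth_pos hp.1
  have hwM := depth_le_leafDepth rimDepth_nonneg he hle
  have heM := gap_add_le_leafDepth rimDepth_nonneg he hle
  have ha : 0 ≤ a := rimDepth_nonneg
  have hoR := omega_pos ε τ R
  have ho := omega_pos ε τ ‖p.1‖
  have hκ : ε ^ 3 * omega ε τ ‖p.1‖ / (ε ^ 3 * omega ε τ R) ≤ 1 := by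
    rw [div_le_one (slopeBound_pos hε)]
    have : omega ε τ ‖p.1‖ ≤ omega ε τ R := Real.sqrt_le_sqrt (by have := hp.1.le; gcongr)
    gcongr
  have hρ0 := ramp_nonneg η ((height ε τ R p.1 - p.2) / (ε ^ 3 * omega ε τ R))
  have hρ1 := ramp_le_one η ((height ε τ R p.1 - p.2) / (ε ^ 3 * omega ε τ R))
  set ρ := ramp η ((height ε τ R p.1 - p.2) / (ε ^ 3 * omega ε τ R))
  set M := leafDepth ε τ R a η p
  set e := leafGap ε τ R a η p
  set w := depth R p.1
  -- The correction factors into three nonnegative terms, by `M ≥ e`, `M ≥ w` and `ω(r) ≤ ω(R)`. The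
  -- last factor measures the departure from the Euclidean model and the smoothing; it vanishes when
  -- `τ = 0` and `ρ = 1`.
  have hfac : 1 + M * (-e⁻¹ + (1 - M / e) * ((-1 + ρ * (ε ^ 3 * omega ε τ ‖p.1‖ /
      (ε ^ 3 * omega ε τ R))) / w)) - ε ^ 3 * omega ε τ ‖p.1‖ * ((1 - M / e) *
      (ρ / (ε ^ 3 * omega ε τ R)))
      = (M / e - 1) * (M / w - 1) * (1 - ρ * (ε ^ 3 * omega ε τ ‖p.1‖ /
      (ε ^ 3 * omega ε τ R))) := by
    field_simp
    ring
  rw [hfac]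
  have h1 : 0 ≤ M / e - 1 := sub_nonneg.2 ((one_le_div he).2 (by linarith))
  have h2 : 0 ≤ M / w - 1 := sub_nonneg.2 ((one_le_div hw).2 hwM)
  have h3 : 0 ≤ 1 - ρ * (ε ^ 3 * omega ε τ ‖p.1‖ / (ε ^ 3 * omega ε τ R)) :=
    sub_nonneg.2 (mul_le_one₀ hρ1 (by positivity) hκ)
  have h4 : 0 ≤ ‖p.1‖ ^ 2 / (ε * √(‖p.1‖ ^ 2 + M ^ 2) ^ 3) := by positivity
  have := mul_nonneg h4 (mul_nonneg (mul_nonneg h1 h2) h3)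
  linarith

/-- Outside the domain the divergence is the mean curvature of the sphere. -/
theorem divergence_calib_eq (hε : 0 < ε) (hη : 0 < η) (hδ : 0 ≤ δ) (hδR : δ < R)
    (hp : p ∈ halfCylinder ε τ R δ) (h : height ε τ R p.1 ≤ p.2) :
    divergence (calibField ε τ (calibDepth ε τ R (rimDepth R δ) η)) p = 2 / (ε * R) := by
  have hMpos := calibDepth_pos (η := η) hε hδ hδR hp
  have hMeq := calibDepth_of_le (η := η) h (rimDepth R δ)
  have hw := depth_pos hp.1
  have hd : HasFDerivAt (calibDepth ε τ R (rimDepth R δ) η) ((-(depth R p.1)⁻¹) •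
      (innerSL ℝ p.1 ∘L ContinuousLinearMap.fst ℝ ℂ ℝ)
        + (0 : ℝ) • ContinuousLinearMap.snd ℝ ℂ ℝ) p := by
    rcases h.eq_or_lt with h | h
    · have hev := calibDepth_eventuallyEq_leafDepth hε hη hδ hδR hp h.ge
      have he := leafGap_pos (η := η) hε hδ hδR hp h.ge
      have hd := (hasFDerivAt_leafDepth hp.1 he.ne'
        (hasFDerivAt_leafGap hp.1 (rimDepth R δ))).congr_of_eventuallyEq hev
      -- On the sphere itself the ramp is zero, so the derivative of the leaf depth reduces to that
      -- of the depth `w`.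
      rw [← hev.eq_of_nhds, hMeq, h, sub_self, zero_div, ramp_of_nonpos hη le_rfl] at hd
      refine hd.congr_fderiv ?_
      congr 2
      · field_simp
        ring
      · simp
    · have hd := ((hasFDerivAt_depth hp.1).comp p
        (hasFDerivAt_fst (𝕜 := ℝ) (p := p))).congr_of_eventuallyEq
          (calibDepth_eventuallyEq_depth (η := η) h (rimDepth R δ))
      refine hd.congr_fderiv ?_
      rw [zero_smul, add_zero]
      rfl
  rw [divergence_calibField hε τ hMpos hd, hMeq, sqrt_norm_sq_add_depth_sq hp.1]
  have hR : 0 < R := (norm_nonneg _).trans_lt hp.1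
  field_simp
  ring

/-! ### Lower bounds for the divergence defect -/

/-- Here `w, M` are the depths of the spheres of radius `R, n` over the point and `a, A` those over
the rim. The left side is largest on the axis, where `w = R` and `M = n`; there the differences of
square roots are rationalized by multiplying by `(A + a)(n + A)`. -/
theorem mul_le_of_leaf {R a w M A n : ℝ} (ha : 0 < a) (haR : a ≤ R) (hw : 0 < w) (hwR : w ≤ R)
    (hwM : w ≤ M) (haA : a ≤ A) (hA : M ^ 2 - A ^ 2 = w ^ 2 - a ^ 2) (hn : 0 < n)
    (hnM : n ^ 2 = R ^ 2 - w ^ 2 + M ^ 2) : a * (w - a - M + A) ≤ R ^ 2 * (1 - R / n) := by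
  have hR : 0 < R := ha.trans_le haR
  have hM : 0 < M := hw.trans_le hwM
  have hA0 : 0 < A := ha.trans_le haA
  have hRn : R ≤ n := by
    refine le_of_sq_le_sq ?_ hn.le
    nlinarith
  have hMn : M ≤ n := by
    refine le_of_sq_le_sq ?_ hn.le
    nlinarith
  -- Both differences of squares equal `n² - R²`, and `M + w ≤ n + R`.
  have h1 : n - R ≤ M - w := by
    have : (n - R) * (n + R) = (M - w) * (M + w) := by linarith
    by_contra! h
    nlinarith [mul_pos (sub_pos.2 h) (by linarith : 0 < n + R),
      mul_nonneg (sub_nonneg.2 hwM) (by linarith : 0 ≤ n + R - (M + w))]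
  have hRA : a * n ≤ R * A := by
    refine le_of_sq_le_sq ?_ (by positivity)
    have : (R * A) ^ 2 - (a * n) ^ 2 = (R ^ 2 - a ^ 2) * (n ^ 2 - R ^ 2) := by
      have : A ^ 2 = n ^ 2 - R ^ 2 + a ^ 2 := by linarith
      rw [mul_pow, mul_pow, this]
      ring
    have h2 : 0 ≤ (R ^ 2 - a ^ 2) * (n ^ 2 - R ^ 2) :=
      mul_nonneg (by nlinarith) (by nlinarith)
    linarith
  have X : (R - a - n + A) * (A + a) = (n - R) * (n + R - A - a) := by
    have : A ^ 2 = n ^ 2 - R ^ 2 + a ^ 2 := by linarith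
    linear_combination this
  have Y : (n + R - A - a) * (n + A) = (R - a) * (R + a + n + A) := by
    have : A ^ 2 = n ^ 2 - R ^ 2 + a ^ 2 := by linarith
    linear_combination -this
  have Z : a * n * ((R - a) * (R + a + n + A)) ≤ R ^ 2 * ((A + a) * (n + A)) := by
    have z1 : a * (n + R) ≤ R * (A + a) := by linarith
    have z2 : n * ((R - a) * (R + a + n + A)) ≤ R * ((n + R) * (n + A)) := by
      have : R * ((n + R) * (n + A)) - n * ((R - a) * (R + a + n + A))
          = R ^ 2 * A + a * n * (n + A) + n * a ^ 2 := by ring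
      have : 0 ≤ R ^ 2 * A + a * n * (n + A) + n * a ^ 2 := by positivity
      linarith
    calc a * n * ((R - a) * (R + a + n + A)) = a * (n * ((R - a) * (R + a + n + A))) := by ring
      _ ≤ a * (R * ((n + R) * (n + A))) := by gcongr
      _ = R * (n + A) * (a * (n + R)) := by ring
      _ ≤ R * (n + A) * (R * (A + a)) := by gcongr
      _ = _ := by ring
  have main : a * n * (R - a - n + A) ≤ R ^ 2 * (n - R) := by
    have hpos : 0 < (A + a) * (n + A) := by positivity
    refine le_of_mul_le_mul_right ?_ hpos
    calc a * n * (R - a - n + A) * ((A + a) * (n + A))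
        = a * n * ((R - a - n + A) * (A + a)) * (n + A) := by ring
      _ = a * n * (n - R) * ((n + R - A - a) * (n + A)) := by rw [X]; ring
      _ = (n - R) * (a * n * ((R - a) * (R + a + n + A))) := by rw [Y]; ring
      _ ≤ (n - R) * (R ^ 2 * ((A + a) * (n + A))) :=
          mul_le_mul_of_nonneg_left Z (sub_nonneg.2 hRn)
      _ = _ := by ring
  have e : R ^ 2 * (1 - R / n) = R ^ 2 * (n - R) / n := by field_simp
  rw [e, le_div_iff₀ hn]
  have : a * n * (w - a - M + A) ≤ a * n * (R - a - n + A) :=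
    mul_le_mul_of_nonneg_left (by linarith) (by positivity)
  linarith

theorem sq_le_of_leaf {R w M A n : ℝ} (hR : 0 < R) (hwR : w ≤ R)
    (hwM : w ≤ M) (hA : M ^ 2 - A ^ 2 = w ^ 2) (hn : 0 < n)
    (hnM : n ^ 2 = R ^ 2 - w ^ 2 + M ^ 2) (hw : 0 < w) (h0 : 0 ≤ w - M + A) :
    (w - M + A) ^ 2 ≤ 4 * R ^ 2 * (1 - R / n) := by
  have hAn : A ≤ n := by
    refine le_of_sq_le_sq ?_ hn.le
    nlinarith
  have hMn : M ≤ n := by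
    refine le_of_sq_le_sq ?_ hn.le
    nlinarith
  have hRn : R ≤ n := by
    refine le_of_sq_le_sq ?_ hn.le
    nlinarith
  have h1 : n - R ≤ M - w := by
    have : (n - R) * (n + R) = (M - w) * (M + w) := by linarith
    by_contra! h
    nlinarith [mul_pos (sub_pos.2 h) (by linarith : 0 < n + R),
      mul_nonneg (sub_nonneg.2 hwM) (by linarith : 0 ≤ n + R - (M + w))]
  have e : 4 * R ^ 2 * (1 - R / n) = 4 * R ^ 2 * (n - R) / n := by field_simp
  rw [e, le_div_iff₀ hn]
  -- For `n ≥ 4R/3` the bound `θ ≤ R` suffices. For smaller `n` one uses `θ² ≤ A² = n² - R²` and `(n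
  -- + R)n ≤ 28R²/9 ≤ 4R²`.
  rcases le_total (4 / 3 * R) n with h | h
  · have h2 : (w - M + A) ^ 2 ≤ R ^ 2 := by
      have : w - M + A ≤ R := by linarith
      gcongr
    calc (w - M + A) ^ 2 * n ≤ R ^ 2 * n := by gcongr
      _ ≤ 4 * R ^ 2 * (n - R) := by nlinarith [mul_nonneg (sq_nonneg R) (sub_nonneg.2 h)]
  · have h2 : (w - M + A) ^ 2 ≤ A ^ 2 := by
      have : w - M + A ≤ A := by linarith
      gcongr
    have h3 : A ^ 2 = (n - R) * (n + R) := by linarith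
    calc (w - M + A) ^ 2 * n ≤ (n - R) * (n + R) * n := by rw [← h3]; gcongr
      _ = (n - R) * ((n + R) * n) := by ring
      _ ≤ (n - R) * (4 * R ^ 2) := by
          refine mul_le_mul_of_nonneg_left ?_ (sub_nonneg.2 hRn)
          nlinarith
      _ = _ := by ring

/-- The depth of a point below the sphere, in units of the maximal slope. -/
def scaledGap (ε τ R : ℝ) (p : Heis) : ℝ :=
  (height ε τ R p.1 - p.2) / (ε ^ 3 * omega ε τ R)

theorem rimDepth_le (hδ : 0 ≤ δ) (hδR : δ < R) : rimDepth R δ ≤ R :=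
  Real.sqrt_le_iff.2 ⟨by linarith, by nlinarith⟩

theorem depth_le (hz : ‖p.1‖ < R) : depth R p.1 ≤ R := by
  have := norm_nonneg p.1
  exact Real.sqrt_le_iff.2 ⟨by linarith, by nlinarith⟩

/-- So `M` and `A = M - e` are the depths of one sphere, over the point and over the rim: this is
the equation that defines the leaf. -/
theorem leafDepth_sq_sub {a : ℝ} (h0 : leafGap ε τ R a η p ≠ 0) :
    leafDepth ε τ R a η p ^ 2 - (leafDepth ε τ R a η p - leafGap ε τ R a η p) ^ 2
      = depth R p.1 ^ 2 - a ^ 2 := by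
  unfold leafDepth
  field_simp
  ring

theorem leafDepth_relation (a : ℝ) :
    depth R p.1 - a - leafDepth ε τ R a η p + (leafDepth ε τ R a η p - leafGap ε τ R a η p)
      = smoothPos η (scaledGap ε τ R p) := by
  unfold leafGap scaledGap
  ring

/-- The gain is `2/(εR) - 2/(εn) = (2/(εR³)) R²(1 - R/n)`, bounded below by `mul_le_of_leaf`. The
factor `rimDepth` degenerates as `δ → 0`, which is why the case `δ = 0` needs a quadratic bound. -/
theorem gain_linear (hε : 0 < ε) (hη : 0 < η) (hδ : 0 < δ) (hδR : δ < R)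
    (hp : p ∈ halfCylinder ε τ R δ) (h : p.2 < height ε τ R p.1) :
    2 * rimDepth R δ / (ε * R ^ 3) * (scaledGap ε τ R p - η)
      ≤ 2 / (ε * R)
        - divergence (calibField ε τ (calibDepth ε τ R (rimDepth R δ) η)) p := by
  have hR : 0 < R := hδ.trans hδR
  have hdiv := divergence_calib_le hε hη hδ.le hδR hp h
  have he := leafGap_pos (η := η) hε hδ.le hδR hp h.le
  have hle := leafGap_le (η := η) hε h.le (rimDepth R δ)
  have ha : 0 < rimDepth R δ := Real.sqrt_pos.2 (by nlinarith)
  have hw := depth_pos hp.1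
  have hwM := depth_le_leafDepth ha.le he hle
  have hn : 0 < √(‖p.1‖ ^ 2 + leafDepth ε τ R (rimDepth R δ) η p ^ 2) := by
    have := hw.trans_le hwM
    exact Real.sqrt_pos.2 (by positivity)
  have hn2 := Real.sq_sqrt (by positivity :
    0 ≤ ‖p.1‖ ^ 2 + leafDepth ε τ R (rimDepth R δ) η p ^ 2)
  have key := mul_le_of_leaf ha (rimDepth_le hδ.le hδR) hw (depth_le hp.1) hwM
    (by linarith [gap_add_le_leafDepth ha.le he hle]) (leafDepth_sq_sub he.ne') hn
    (by rw [hn2, depth_sq hp.1.le]; ring)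
  rw [leafDepth_relation] at key
  have hθ := sub_le_smoothPos hη (d := scaledGap ε τ R p)
    (div_nonneg (sub_nonneg.2 h.le) (slopeBound_pos hε).le)
  refine le_trans ?_ (sub_le_sub_left hdiv _)
  set n := √(‖p.1‖ ^ 2 + leafDepth ε τ R (rimDepth R δ) η p ^ 2)
  have e : 2 / (ε * R) - 2 / (ε * n) = 2 / (ε * R ^ 3) * (R ^ 2 * (1 - R / n)) := by
    field_simp
  rw [e, mul_div_right_comm, mul_assoc]
  have : rimDepth R δ * (scaledGap ε τ R p - η)
      ≤ rimDepth R δ * smoothPos η (scaledGap ε τ R p) := by gcongr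
  exact mul_le_mul_of_nonneg_left (this.trans key) (by positivity)

theorem rimDepth_zero : rimDepth R 0 = 0 := by simp [rimDepth]

theorem gain_quadratic (hε : 0 < ε) (hη : 0 < η) (hR : 0 < R)
    (hp : p ∈ halfCylinder ε τ R 0) (h : p.2 < height ε τ R p.1) :
    1 / (2 * ε * R ^ 3) * (scaledGap ε τ R p ^ 2 - 2 * R * η)
      ≤ 2 / (ε * R)
        - divergence (calibField ε τ (calibDepth ε τ R (rimDepth R 0) η)) p := by
  have hdiv := divergence_calib_le hε hη le_rfl hR hp h
  have he := leafGap_pos (η := η) hε le_rfl hR hp h.le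
  have hle := leafGap_le (η := η) hε h.le (rimDepth R 0)
  have hd0 : 0 ≤ scaledGap ε τ R p :=
    div_nonneg (sub_nonneg.2 h.le) (slopeBound_pos hε).le
  -- This bound turns `(d - η)²` into `d²` up to an error `2Rη` linear in `η`.
  have hdR : scaledGap ε τ R p ≤ R := by
    have h3 := height_sub_le hε τ (by linarith : R - 0 ≤ R) (by simpa using hp.1.le)
    have h4 := profile_nonneg (τ := τ) hε le_rfl hR
    have h5 := depth_le hp.1
    have h6 := slopeBound_pos (τ := τ) (R := R) hε
    rw [scaledGap, div_le_iff₀ h6]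
    have h7 := hp.2
    simp only [sub_zero, sub_self, Real.sqrt_zero] at h3 h4 h7
    have : ε ^ 3 * omega ε τ R * depth R p.1 ≤ ε ^ 3 * omega ε τ R * R := by gcongr
    linarith
  have hθ := sub_le_smoothPos hη hd0
  have hθ0 := smoothPos_nonneg (η := η) hd0
  rw [rimDepth_zero] at *
  have hw := depth_pos hp.1
  have hwM := depth_le_leafDepth le_rfl he hle
  have hn : 0 < √(‖p.1‖ ^ 2 + leafDepth ε τ R 0 η p ^ 2) := by
    have := hw.trans_le hwM
    exact Real.sqrt_pos.2 (by positivity)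
  have hn2 := Real.sq_sqrt (by positivity : 0 ≤ ‖p.1‖ ^ 2 + leafDepth ε τ R 0 η p ^ 2)
  have hrel := leafDepth_relation (ε := ε) (τ := τ) (R := R) (η := η) (p := p) 0
  have hsq := leafDepth_sq_sub (a := 0) he.ne'
  rw [sub_zero] at hrel
  have key := sq_le_of_leaf hR (depth_le hp.1) hwM (by rw [hsq]; ring) hn
    (by rw [hn2, depth_sq hp.1.le]; ring) hw (by rw [hrel]; exact hθ0)
  rw [hrel] at key
  refine le_trans ?_ (sub_le_sub_left hdiv _)
  set n := √(‖p.1‖ ^ 2 + leafDepth ε τ R 0 η p ^ 2)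
  have e : 2 / (ε * R) - 2 / (ε * n) = 1 / (2 * ε * R ^ 3) * (4 * R ^ 2 * (1 - R / n)) := by
    field_simp
    ring
  rw [e]
  refine mul_le_mul_of_nonneg_left (le_trans ?_ key) (by positivity)
  rcases le_total η (scaledGap ε τ R p) with h1 | h1
  · have : (scaledGap ε τ R p - η) ^ 2 ≤ smoothPos η (scaledGap ε τ R p) ^ 2 := by
      have := sub_nonneg.2 h1
      gcongr
    nlinarith
  · nlinarith [sq_nonneg (smoothPos η (scaledGap ε τ R p))]

end Leaf

/-! ### The layer inequality for moments of the gap -/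

/-- The reflection of each vertical line that exchanges the height `0` and the graph of `h`. -/
def verticalReflection {h : ℂ → ℝ} (hh : Continuous h) : Heis ≃ₜ Heis where
  toFun p := (p.1, h p.1 - p.2)
  invFun p := (p.1, h p.1 - p.2)
  left_inv p := by simp
  right_inv p := by simp
  continuous_toFun := by fun_prop
  continuous_invFun := by fun_prop

theorem measurePreserving_verticalReflection {h : ℂ → ℝ} (hh : Continuous h) :
    MeasurePreserving (verticalReflection hh) := by
  refine (MeasurePreserving.id (volume : Measure ℂ)).skew_product (μc := (volume : Measure ℝ))
    (g := fun z t => h z - t) ?_ (.of_forall fun z => ?_)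
  · exact (by fun_prop : Continuous fun p : ℂ × ℝ => h p.1 - p.2).measurable
  · exact (Measure.measurePreserving_sub_left volume (h z)).map_eq

theorem setIntegral_gap_layer {h : ℂ → ℝ} (hh : Continuous h) {R l : ℝ} (hR : 0 ≤ R) (hl : 0 ≤ l)
    (j : ℕ) :
    IntegrableOn (fun p : Heis => l ^ j - (h p.1 - p.2) ^ j)
      {p | ‖p.1‖ < R ∧ 0 < h p.1 - p.2 ∧ h p.1 - p.2 < l} ∧
    ∫ p in {p : Heis | ‖p.1‖ < R ∧ 0 < h p.1 - p.2 ∧ h p.1 - p.2 < l},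
        (l ^ j - (h p.1 - p.2) ^ j)
      = Real.pi * R ^ 2 * (l ^ (j + 1) * (j / (j + 1))) := by
  have hL : {p : Heis | ‖p.1‖ < R ∧ 0 < h p.1 - p.2 ∧ h p.1 - p.2 < l}
      = verticalReflection hh ⁻¹' (Metric.ball 0 R ×ˢ Ioo 0 l) := by
    ext p
    simp [verticalReflection]
  have hcomp : (fun p : Heis => l ^ j - (h p.1 - p.2) ^ j)
      = (fun q : Heis => (1 : ℝ) * (l ^ j - q.2 ^ j)) ∘ verticalReflection hh := by
    ext p
    simp [verticalReflection]
  have hcont : Continuous fun t : ℝ => l ^ j - t ^ j := by fun_prop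
  have hI1 : IntegrableOn (fun _ : ℂ => (1 : ℝ)) (Metric.ball 0 R) :=
    integrableOn_const measure_ball_lt_top.ne
  have hI2 : IntegrableOn (fun t : ℝ => l ^ j - t ^ j) (Ioo 0 l) :=
    (hcont.integrableOn_Icc (a := 0) (b := l)).mono_set Ioo_subset_Icc_self
  have hmp := measurePreserving_verticalReflection hh
  have hemb := (verticalReflection hh).measurableEmbedding
  constructor
  · rw [hL, hcomp, hmp.integrableOn_comp_preimage hemb, IntegrableOn, Measure.volume_eq_prod,
      ← Measure.prod_restrict]
    exact Integrable.mul_prod hI1 hI2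
  · rw [hL, hcomp]
    have := hmp.setIntegral_preimage_emb hemb (fun q : Heis => (1 : ℝ) * (l ^ j - q.2 ^ j))
      (Metric.ball 0 R ×ˢ Ioo 0 l)
    simp only [Function.comp_def]
    rw [this, Measure.volume_eq_prod,
      setIntegral_prod_mul (fun _ : ℂ => (1 : ℝ)) (fun t : ℝ => l ^ j - t ^ j)]
    have e1 : ∫ _ in Metric.ball (0 : ℂ) R, (1 : ℝ) = Real.pi * R ^ 2 := by
      simp [Measure.real, Complex.volume_ball, ENNReal.toReal_ofReal hR, mul_comm]
    have e2 : ∫ t in Ioo 0 l, (l ^ j - t ^ j) = l ^ (j + 1) * (j / (j + 1)) := by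
      rw [← integral_Ioc_eq_integral_Ioo, ← intervalIntegral.integral_of_le hl,
        intervalIntegral.integral_sub (by simp) (by simp), integral_pow]
      simp
      field_simp
      ring
    rw [e1, e2]

/-- Among sets of given volume below a graph over the disc, a layer along the graph has the least
moment of the vertical distance to the graph. -/
theorem volume_pow_le_setIntegral_gap {h : ℂ → ℝ} (hh : Continuous h) {R : ℝ} (hR : 0 < R)
    {G : Set Heis} (hG : MeasurableSet G) (hfin : volume G ≠ ⊤)
    (hGs : ∀ p ∈ G, ‖p.1‖ < R ∧ p.2 < h p.1) (j : ℕ)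
    (hj : IntegrableOn (fun p : Heis => (h p.1 - p.2) ^ j) G) :
    volume.real G ^ (j + 1) / ((j + 1) * (Real.pi * R ^ 2) ^ j)
      ≤ ∫ p in G, (h p.1 - p.2) ^ j := by
  have hA : 0 < Real.pi * R ^ 2 := by positivity
  set m := volume.real G
  have hm : 0 ≤ m := measureReal_nonneg
  -- The thickness for which the layer over the disc has the same volume `m` as `G`.
  set l := m / (Real.pi * R ^ 2) with hl
  have hl0 : 0 ≤ l := by positivity
  obtain ⟨hLi, hLe⟩ := setIntegral_gap_layer hh hR.le hl0 j
  set L := {p : Heis | ‖p.1‖ < R ∧ 0 < h p.1 - p.2 ∧ h p.1 - p.2 < l} with hLdef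
  have hLm : MeasurableSet L := by
    have h1 : IsOpen {p : Heis | ‖p.1‖ < R} := isOpen_lt (by fun_prop) continuous_const
    have h2 : IsOpen {p : Heis | 0 < h p.1 - p.2} := isOpen_lt continuous_const (by fun_prop)
    have h3 : IsOpen {p : Heis | h p.1 - p.2 < l} := isOpen_lt (by fun_prop) continuous_const
    exact (h1.inter (h2.inter h3)).measurableSet
  have hconst : IntegrableOn (fun _ : Heis => l ^ j) G := integrableOn_const hfin
  have hint := hconst.sub hj
  -- The integrand is nonnegative on the layer and nonpositive on the rest of `G`, so the layer
  -- maximizes its integral.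
  have key : ∫ p in G, (l ^ j - (h p.1 - p.2) ^ j) ≤ ∫ p in L, (l ^ j - (h p.1 - p.2) ^ j) := by
    have h0 := integral_inter_add_sdiff hLm hint
    have h1 : ∫ p in G \ L, (l ^ j - (h p.1 - p.2) ^ j) ≤ 0 := by
      refine setIntegral_nonpos (hG.diff hLm) fun p hp => ?_
      have h2 := hGs p hp.1
      have h3 : l ≤ h p.1 - p.2 := by
        by_contra! h4
        exact hp.2 ⟨h2.1, sub_pos.2 h2.2, h4⟩
      have := pow_le_pow_left₀ hl0 h3 j
      linarith
    have h2 : ∫ p in G ∩ L, (l ^ j - (h p.1 - p.2) ^ j)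
        ≤ ∫ p in L, (l ^ j - (h p.1 - p.2) ^ j) := by
      refine setIntegral_mono_set hLi ?_ (LE.le.eventuallyLE inter_subset_right)
      refine (ae_restrict_iff' hLm).2 (.of_forall fun p hp => ?_)
      have := pow_le_pow_left₀ hp.2.1.le hp.2.2.le j
      simp only [Pi.zero_apply]
      linarith
    simp only [Pi.sub_apply] at h0
    linarith
  rw [hLe, integral_sub hconst hj, setIntegral_const, smul_eq_mul] at key
  have e1 : Real.pi * R ^ 2 * (l ^ (j + 1) * (j / (j + 1))) = m * l ^ j * (j / (j + 1)) := by
    have e0 : Real.pi * R ^ 2 * l = m := by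
      rw [hl]
      field_simp
    linear_combination l ^ j * (j / (j + 1)) * e0
  have e2 : m ^ (j + 1) / ((j + 1) * (Real.pi * R ^ 2) ^ j)
      = m * l ^ j - m * l ^ j * (j / (j + 1)) := by
    rw [hl, div_pow]
    field_simp
    ring
  rw [e1] at key
  rw [e2]
  linarith

/-! ### Cutoffs, normality on the sphere, and its topology -/

theorem exists_smooth_cutoff {V : Type*} [NormedAddCommGroup V] [NormedSpace ℝ V]
    [FiniteDimensional ℝ V] {K C : Set V} (hK : IsCompact K) (hC : IsOpen C) (hKC : K ⊆ C) :
    ∃ χ : V → ℝ, ContDiff ℝ ∞ χ ∧ HasCompactSupport χ ∧ tsupport χ ⊆ C ∧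
      (∀ᶠ p in 𝓝ˢ K, χ p = 1) ∧ ∀ p, χ p ∈ Icc (0 : ℝ) 1 := by
  obtain ⟨L, hL, hKL, hLC⟩ := exists_compact_between hK hC hKC
  obtain ⟨f, h1, h0, hf⟩ := exists_contMDiffMap_one_nhds_of_subset_interior
    (modelWithCornersSelf ℝ V) (n := (⊤ : ℕ∞)) hK.isClosed hKL
  have hsupp : tsupport f ⊆ L := closure_minimal
    (fun p hp => by_contra fun h => hp (h0 p h)) hL.isClosed
  exact ⟨f, f.contMDiff.contDiff, hL.of_isClosed_subset (isClosed_tsupport _) hsupp,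
    hsupp.trans hLC, h1, hf⟩

theorem contDiff_smul_of_tsupport_subset {V W : Type*} [NormedAddCommGroup V] [NormedSpace ℝ V]
    [NormedAddCommGroup W] [NormedSpace ℝ W] {n : WithTop ℕ∞} {χ : V → ℝ} {F : V → W} {C : Set V}
    (hχ : ContDiff ℝ n χ) (hC : tsupport χ ⊆ C) (hF : ∀ p ∈ C, ContDiffAt ℝ n F p) :
    ContDiff ℝ n fun p => χ p • F p := by
  refine contDiff_iff_contDiffAt.2 fun p => ?_
  by_cases hp : p ∈ tsupport χ
  · exact hχ.contDiffAt.smul (hF p (hC hp))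
  · refine (contDiffAt_const (c := (0 : W))).congr_of_eventuallyEq ?_
    filter_upwards [(isClosed_tsupport χ).isOpen_compl.mem_nhds hp] with q hq
    rw [image_eq_zero_of_notMem_tsupport hq, zero_smul]

/-- The calibrating field is normal to the upper half of the sphere. -/
theorem tripleProduct_calibField {ε : ℝ} (hε : 0 < ε) (τ : ℝ) {R : ℝ} {M : Heis → ℝ}
    {g : ℂ → ℝ} {u : ℝ × ℝ} (hz : ‖Complex.equivRealProdCLM.symm u‖ < R)
    (hg : HasFDerivAt g (-(ε ^ 3 * omega ε τ ‖Complex.equivRealProdCLM.symm u‖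
      / depth R (Complex.equivRealProdCLM.symm u)) • innerSL ℝ (Complex.equivRealProdCLM.symm u))
      (Complex.equivRealProdCLM.symm u))
    (hM : M (shearedGraph 0 g u) = depth R (Complex.equivRealProdCLM.symm u)) :
    tripleProduct (calibField ε τ M (shearedGraph 0 g u))
      (fderiv ℝ (shearedGraph 0 g) u (1, 0)) (fderiv ℝ (shearedGraph 0 g) u (0, 1))
      = areaDensity ε τ (shearedGraph 0 g) u := by
  have hψ : shearedGraph 0 g u
      = (Complex.equivRealProdCLM.symm u, g (Complex.equivRealProdCLM.symm u)) := by
    simp [shearedGraph, shear_apply]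
  rw [areaDensity_graph hε τ (s := 1) (by norm_num) hz (by rwa [one_smul]),
    fderiv_shearedGraph 0 hg.differentiableAt,
    fderiv_shearedGraph 0 hg.differentiableAt, equivRealProdCLM_symm_fst,
    equivRealProdCLM_symm_snd, hg.fderiv, calibField, hM, hψ,
    sqrt_norm_sq_add_depth_sq (p := (Complex.equivRealProdCLM.symm u,
      g (Complex.equivRealProdCLM.symm u))) hz]
  simp only [smul_apply, innerSL_one, innerSL_I, shear_apply, smul_zero, add_zero]
  set z := Complex.equivRealProdCLM.symm u
  have hR : 0 < R := (norm_nonneg z).trans_lt hz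
  have hw := depth_pos hz
  have hw2 := depth_sq hz.le
  have ho := omega_pos ε τ ‖z‖
  rw [norm_sq_eq] at hw2
  set w := depth R z
  set o := omega ε τ ‖z‖
  simp only [tripleProduct, Complex.one_re, Complex.one_im, Complex.I_re, Complex.I_im,
    smul_eq_mul, Complex.sub_re, Complex.sub_im, Complex.smul_re, Complex.smul_im, Complex.mul_re,
    Complex.mul_im]
  have e : z.re ^ 2 + z.im ^ 2 = R ^ 2 - w ^ 2 := by linarith
  field_simp
  linear_combination o * e

theorem tripleProduct_smul (a : ℝ) (F v w : Heis) :
    tripleProduct (a • F) v w = a * tripleProduct F v w := by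
  simp only [tripleProduct, Prod.smul_fst, Prod.smul_snd, Complex.smul_re, Complex.smul_im,
    smul_eq_mul]
  ring

theorem height_le {ε : ℝ} (hε : 0 < ε) (τ : ℝ) {R : ℝ} {z : ℂ} (hz : ‖z‖ ≤ R) :
    height ε τ R z ≤ profile ε τ 0 R := by
  have h0 := norm_nonneg z
  exact (strictAntiOn_profileSq hε τ R).antitoneOn (a := 0 ^ 2) (b := ‖z‖ ^ 2)
    ⟨by norm_num, by nlinarith⟩ ⟨sq_nonneg _, by gcongr⟩ (by nlinarith)

theorem exists_isCompact_domain_subset {ε : ℝ} (hε : 0 < ε) (τ R : ℝ) :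
    ∃ K : Set Heis, IsCompact K ∧ domain ε τ R ⊆ K := by
  refine ⟨Metric.closedBall 0 R ×ˢ Icc (-profile ε τ 0 R) (profile ε τ 0 R),
    (isCompact_closedBall (0 : ℂ) R).prod isCompact_Icc, ?_⟩
  rintro p ⟨h1, h2⟩
  exact ⟨mem_closedBall_zero_iff.2 h2.le, abs_le.1 (h1.le.trans (height_le hε τ h2.le))⟩

theorem volume_domain_lt_top {ε : ℝ} (hε : 0 < ε) (τ R : ℝ) : volume (domain ε τ R) < ⊤ := by
  obtain ⟨K, hK, hsub⟩ := exists_isCompact_domain_subset hε τ R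
  exact (measure_mono hsub).trans_lt hK.measure_lt_top

/-- Points over the open disc are approached by shrinking the height, points of the equator by
shrinking the radius. -/
theorem sphere_subset_frontier_domain {ε : ℝ} (hε : 0 < ε) (τ : ℝ) {R : ℝ} (hR : 0 < R) :
    sphere ε τ R ⊆ frontier (domain ε τ R) := by
  rintro ⟨z, t⟩ ⟨hz, ht⟩
  simp only at hz ht
  rw [(isOpen_domain ε τ R).frontier_eq]
  refine ⟨?_, fun h => (ne_of_lt h.1) ht⟩
  have hs : ∀ᶠ s : ℝ in 𝓝[<] 1, s ∈ Ioo (0 : ℝ) 1 := Ioo_mem_nhdsLT one_pos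
  rcases hz.lt_or_eq with hz | hz
  · have hlim : Tendsto (fun s : ℝ => ((z, s * t) : Heis)) (𝓝[<] 1) (𝓝 (z, t)) := by
      have : Continuous fun s : ℝ => ((z, s * t) : Heis) := by fun_prop
      have h1 := this.tendsto 1
      rw [one_mul] at h1
      exact h1.mono_left nhdsWithin_le_nhds
    refine mem_closure_of_tendsto hlim ?_
    filter_upwards [hs] with s hs
    have h2 := height_pos hε τ hz
    refine ⟨?_, hz⟩
    rw [height, ← ht] at h2
    rw [abs_mul, abs_of_pos hs.1, ← ht]
    exact mul_lt_of_lt_one_left h2 hs.2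
  · have ht0 : t = 0 := by
      rw [hz, profile_eq_profileSq, profileSq_self] at ht
      exact abs_eq_zero.1 ht
    have hlim : Tendsto (fun s : ℝ => ((s • z, t) : Heis)) (𝓝[<] 1) (𝓝 (z, t)) := by
      have : Continuous fun s : ℝ => ((s • z, t) : Heis) := by fun_prop
      have h1 := this.tendsto 1
      rw [one_smul] at h1
      exact h1.mono_left nhdsWithin_le_nhds
    refine mem_closure_of_tendsto hlim ?_
    filter_upwards [hs] with s hs
    have h2 : ‖s • z‖ < R := by
      rw [norm_smul, hz, Real.norm_of_nonneg hs.1.le]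
      exact mul_lt_of_lt_one_left hR hs.2
    refine ⟨?_, h2⟩
    rw [ht0, abs_zero]
    exact height_pos hε τ h2

theorem frontier_inter_subset_of_inter_eq {V : Type*} [TopologicalSpace V] {A B O : Set V}
    (hO : IsOpen O) (h : A ∩ O = B ∩ O) : frontier A ∩ O ⊆ frontier B := by
  rw [← frontier_inter_open_inter hO, h, frontier_inter_open_inter hO]
  exact inter_subset_left

theorem hasCompactSupport_smul_of_left {V V' : Type*} [TopologicalSpace V] [AddCommGroup V']
    [Module ℝ V'] {a : V → ℝ} (ha : HasCompactSupport a) (F : V → V') :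
    HasCompactSupport fun p => a p • F p :=
  ha.mono fun p hp h => hp (by simp [h])

theorem measureReal_sdiff_eq_of_measure_eq {X : Type*} [MeasurableSpace X] {μ : Measure X}
    {A B : Set X} (hA : MeasurableSet A) (hB : MeasurableSet B) (h : μ A = μ B) (hfin : μ B ≠ ⊤) :
    μ.real (A \ B) = μ.real (B \ A) := by
  have h1 := measureReal_sdiff_add_inter (μ := μ) (s := A) (t := B) hB (h ▸ hfin)
  have h2 := measureReal_sdiff_add_inter (μ := μ) (s := B) (t := A) hA hfin
  have h3 : μ.real A = μ.real B := by rw [Measure.real, h, Measure.real]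
  rw [inter_comm] at h2
  linarith

/-! ### The calibration inequality -/

/-- The flux of a field that is a multiple of the calibrating field by a cutoff function. -/
theorem lintegral_cutoff_sphere_le {ε τ R δ η : ℝ} (hε : 0 < ε) (hη : 0 < η) (hδ : 0 ≤ δ)
    (hδR : δ < R) {χ : Heis → ℝ} (hχ : ContDiff ℝ ∞ χ) (hχc : HasCompactSupport χ)
    (hχC : tsupport χ ⊆ halfCylinder ε τ R δ) (hχ0 : ∀ p, 0 ≤ χ p) :
    ContDiff ℝ 1 (fun p => χ p • calibField ε τ (calibDepth ε τ R (rimDepth R δ) η) p) ∧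
    (∀ p, riemNorm ε τ p (χ p • calibField ε τ (calibDepth ε τ R (rimDepth R δ) η) p) = χ p) ∧
    0 ≤ ∫ p in domain ε τ R,
      divergence (fun p => χ p • calibField ε τ (calibDepth ε τ R (rimDepth R δ) η) p) p ∧
    ∫⁻ p, ENNReal.ofReal (χ p) ∂(surfaceMeasure ε τ (sphere ε τ R))
      ≤ ENNReal.ofReal (∫ p in domain ε τ R,
        divergence (fun p => χ p • calibField ε τ (calibDepth ε τ R (rimDepth R δ) η) p) p) := by
  set V := calibField ε τ (calibDepth ε τ R (rimDepth R δ) η) with hV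
  have hF : ContDiff ℝ 1 fun p => χ p • V p :=
    contDiff_smul_of_tsupport_subset (hχ.of_le (by norm_cast)) hχC fun p hp =>
      contDiffAt_calibField hε τ (calibDepth_pos hε hδ hδR hp)
        (contDiffAt_calibDepth hε hη hδ hδR hp)
  have hFc : HasCompactSupport fun p => χ p • V p := hasCompactSupport_smul_of_left hχc V
  have hnorm : ∀ p, riemNorm ε τ p (χ p • V p) = χ p := fun p => by
    rw [riemNorm_smul ε τ p (hχ0 p)]
    by_cases hp : p ∈ tsupport χ
    · rw [riemNorm_calibField hε τ (calibDepth_pos hε hδ hδR (hχC hp)), mul_one]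
    · rw [image_eq_zero_of_notMem_tsupport hp, zero_mul]
  -- The height is smooth only inside the disc. Multiplying it by `β`, equal to `1` near the
  -- projection of the support of `χ`, gives a globally smooth graph function.
  obtain ⟨β, hβ, -, hβR, hβ1, -⟩ := exists_smooth_cutoff
    (hχc.isCompact.image continuous_fst) (C := Metric.ball (0 : ℂ) R) Metric.isOpen_ball (by
      rintro _ ⟨p, hp, rfl⟩
      exact mem_ball_zero_iff.2 (hχC hp).1)
  obtain ⟨U, hU, hKU, hU1⟩ := eventually_nhdsSet_iff_exists.1 hβ1
  have hNo : IsOpen (U ∩ Metric.ball (0 : ℂ) R) := hU.inter Metric.isOpen_ball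
  have hg : ContDiff ℝ ∞ fun z => β z • height ε τ R z :=
    contDiff_smul_of_tsupport_subset hβ hβR fun z hz =>
      (contDiffOn_height ε τ R).contDiffAt (Metric.isOpen_ball.mem_nhds hz)
  have hgN : EqOn (fun z => β z • height ε τ R z) (height ε τ R) (U ∩ Metric.ball (0 : ℂ) R) :=
    fun z hz => by simp only [hU1 z hz.1, one_smul]
  have hmain := lintegral_sphere_le (ε := ε) τ hNo inter_subset_right hg hgN hF hFc
    (fun p hp => by
      have hp' := tsupport_fun_smul_subset χ V hp
      have hpC := hχC hp'
      exact ⟨⟨hKU ⟨p, hp', rfl⟩, mem_ball_zero_iff.2 hpC.1⟩,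
        (profile_nonneg hε hδ hδR).trans_lt hpC.2⟩)
    (fun u hu => by
      have hz := mem_ball_zero_iff.1 hu.2
      have hev : (fun z => β z • height ε τ R z) =ᶠ[𝓝 (Complex.equivRealProdCLM.symm u)]
          height ε τ R := hgN.eventuallyEq_of_mem (hNo.mem_nhds hu)
      have hψ : shearedGraph 0 (fun z => β z • height ε τ R z) u
          = (Complex.equivRealProdCLM.symm u, height ε τ R (Complex.equivRealProdCLM.symm u)) := by
        rw [← hgN hu]
        simp [shearedGraph, shear_apply]
      rw [hnorm, tripleProduct_smul, hV, tripleProduct_calibField hε τ hz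
        ((hasFDerivAt_height ε τ hz).congr_of_eventuallyEq hev), mul_comm]
      rw [hψ]
      exact calibDepth_of_le le_rfl _)
  simp only [hnorm] at hmain
  exact ⟨hF, hnorm, hmain⟩

/-- The calibration inequality: the area excess controls the defect of the divergence of the
calibrating field over `domain \ E`. -/
theorem area_sphere_add_le {ε τ R δ η : ℝ} (hε : 0 < ε) (hη : 0 < η) (hδ : 0 ≤ δ)
    (hδR : δ < R) {E : Set Heis} (hE : IsSmoothOpen E) (hvol : volume E = volume (domain ε τ R))
    (hcc : CompactlyContained (symmDiff E (domain ε τ R)) (halfCylinder ε τ R δ)) :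
    IntegrableOn (fun p => 2 / (ε * R)
      - divergence (calibField ε τ (calibDepth ε τ R (rimDepth R δ) η)) p) (domain ε τ R \ E) ∧
    ((0 ≤ ∫ p in domain ε τ R \ E, (2 / (ε * R)
      - divergence (calibField ε τ (calibDepth ε τ R (rimDepth R δ) η)) p)) →
    area ε τ (sphere ε τ R) + ENNReal.ofReal (∫ p in domain ε τ R \ E, (2 / (ε * R)
        - divergence (calibField ε τ (calibDepth ε τ R (rimDepth R δ) η)) p))
      ≤ area ε τ (frontier E)) := by
  have hR : 0 < R := hδ.trans_lt hδR
  obtain ⟨hK, hKC⟩ := hcc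
  obtain ⟨χ, hχ, hχc, hχC, hχ1, hχI⟩ := exists_smooth_cutoff hK isOpen_halfCylinder hKC
  obtain ⟨hF, hnorm, hI0, hA⟩ := lintegral_cutoff_sphere_le (η := η) hε hη hδ hδR hχ hχc hχC
    fun p => (hχI p).1
  set V := calibField ε τ (calibDepth ε τ R (rimDepth R δ) η) with hV
  set D := domain ε τ R with hD
  have hDm : MeasurableSet D := (isOpen_domain ε τ R).measurableSet
  have hEm : MeasurableSet E := hE.1.measurableSet
  have hDfin : volume D ≠ ⊤ := (volume_domain_lt_top hε τ R).ne
  have hFc : HasCompactSupport fun p => χ p • V p := hasCompactSupport_smul_of_left hχc V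
  have hint := integrable_divergence hF hFc
  have hdivK : ∀ p ∈ closure (symmDiff E D), divergence (fun p => χ p • V p) p = divergence V p := by
    intro p hp
    refine divergence_congr ?_
    filter_upwards [eventually_nhdsSet_iff_forall.1 hχ1 p hp] with q hq
    rw [hq, one_smul]
  have hED : E \ D ⊆ closure (symmDiff E D) := fun p hp => subset_closure (Or.inl hp)
  have hDE : D \ E ⊆ closure (symmDiff E D) := fun p hp => subset_closure (Or.inr hp)
  have hB := ofReal_setIntegral_divergence_le hε τ hE hF hFc
  simp only [hnorm] at hB
  have hconst : IntegrableOn (fun _ : Heis => 2 / (ε * R)) (D \ E) :=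
    integrableOn_const ((measure_mono sdiff_subset).trans_lt hDfin.lt_top).ne
  have hEq : EqOn (fun p => 2 / (ε * R) - divergence V p)
      (fun p => 2 / (ε * R) - divergence (fun p => χ p • V p) p) (D \ E) := fun p hp => by
    simp only [hdivK p (hDE hp)]
  refine ⟨(hconst.sub hint.integrableOn).congr_fun hEq.symm (hDm.diff hEm), fun hT => ?_⟩
  have hTe : ∫ p in D \ E, (2 / (ε * R) - divergence V p)
      = volume.real (D \ E) * (2 / (ε * R)) - ∫ p in D \ E, divergence (fun p => χ p • V p) p := by
    rw [setIntegral_congr_fun (hDm.diff hEm) hEq, integral_sub hconst hint.integrableOn,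
      setIntegral_const, smul_eq_mul]
  -- On `E \ E_R` the divergence is the constant `2/(εR)`, and equal volumes allow `E \ E_R` to be
  -- replaced by `E_R \ E`.
  have hout : ∫ p in E \ D, divergence (fun p => χ p • V p) p
      = volume.real (D \ E) * (2 / (ε * R)) := by
    rw [← measureReal_sdiff_eq_of_measure_eq hEm hDm hvol hDfin, ← smul_eq_mul,
      ← setIntegral_const]
    refine setIntegral_congr_fun (hEm.diff hDm) fun p hp => ?_
    have hpC := hKC (hED hp)
    have hp0 : 0 < p.2 := (profile_nonneg hε hδ hδR).trans_lt hpC.2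
    have hle : height ε τ R p.1 ≤ p.2 := by
      by_contra! h
      exact hp.2 ⟨by rwa [abs_of_pos hp0], hpC.1⟩
    simp only [hdivK p (hED hp)]
    exact divergence_calib_eq hε hη hδ hδR hpC hle
  have hsplitE := integral_inter_add_sdiff (s := E) hDm hint.integrableOn
  have hsplitD := integral_inter_add_sdiff (s := D) hEm hint.integrableOn
  rw [inter_comm] at hsplitD
  have hIE : ∫ p in E, divergence (fun p => χ p • V p) p
      = (∫ p in D, divergence (fun p => χ p • V p) p)
        + ∫ p in D \ E, (2 / (ε * R) - divergence V p) := by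
    linarith
  -- Away from the closure of the symmetric difference `E` and `E_R` coincide, hence so do their
  -- boundaries.
  have hloc : (surfaceMeasure ε τ (sphere ε τ R)).restrict (closure (symmDiff E D))ᶜ
      ≤ surfaceMeasure ε τ (frontier E) := by
    refine surfaceMeasure_restrict_le_surfaceMeasure isClosed_closure.isOpen_compl ?_
    refine (inter_subset_inter_left _ (sphere_subset_frontier_domain hε τ hR)).trans
      (frontier_inter_subset_of_inter_eq isClosed_closure.isOpen_compl ?_)
    ext p
    refine and_congr_left fun hp => ?_
    have : p ∉ symmDiff E D := fun h => hp (subset_closure h)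
    rw [mem_symmDiff] at this
    tauto
  have hχm : Measurable fun p => ENNReal.ofReal (χ p) := hχ.continuous.measurable.ennreal_ofReal
  have hχm' : Measurable fun p => ENNReal.ofReal (1 - χ p) :=
    (continuous_const.sub hχ.continuous).measurable.ennreal_ofReal
  have harea : ∀ μ : Measure Heis, μ univ
      = ∫⁻ p, ENNReal.ofReal (χ p) ∂μ + ∫⁻ p, ENNReal.ofReal (1 - χ p) ∂μ := fun μ => by
    rw [← lintegral_add_left hχm, ← lintegral_one]
    refine lintegral_congr fun p => ?_
    rw [← ENNReal.ofReal_add (hχI p).1 (sub_nonneg.2 (hχI p).2), add_sub_cancel,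
      ENNReal.ofReal_one]
  -- The weight `1 - χ` vanishes on the closure of the symmetric difference, so only the common part
  -- of the surfaces counts.
  have hC : ∫⁻ p, ENNReal.ofReal (1 - χ p) ∂(surfaceMeasure ε τ (sphere ε τ R))
      ≤ ∫⁻ p, ENNReal.ofReal (1 - χ p) ∂(surfaceMeasure ε τ (frontier E)) := by
    refine le_trans ?_ (lintegral_mono' hloc le_rfl)
    rw [← lintegral_indicator isClosed_closure.measurableSet.compl]
    refine lintegral_mono fun p => ?_
    by_cases hp : p ∈ closure (symmDiff E D)
    · rw [eventually_nhdsSet_iff_forall.1 hχ1 p hp |>.self_of_nhds]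
      simp
    · rw [indicator_of_mem hp]
  unfold area
  rw [harea (surfaceMeasure ε τ (sphere ε τ R)), harea (surfaceMeasure ε τ (frontier E))]
  calc _ ≤ ENNReal.ofReal (∫ p in D, divergence (fun p => χ p • V p) p)
        + ∫⁻ p, ENNReal.ofReal (1 - χ p) ∂(surfaceMeasure ε τ (frontier E))
        + ENNReal.ofReal (∫ p in D \ E, (2 / (ε * R) - divergence V p)) := by gcongr
    _ = ENNReal.ofReal (∫ p in E, divergence (fun p => χ p • V p) p)
        + ∫⁻ p, ENNReal.ofReal (1 - χ p) ∂(surfaceMeasure ε τ (frontier E)) := by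
        rw [hIE, ENNReal.ofReal_add hI0 hT]
        ring
    _ ≤ _ := by gcongr

theorem measureReal_sdiff_eq_half_symmDiff {X : Type*} [MeasurableSpace X] {μ : Measure X}
    {A B : Set X} (hA : MeasurableSet A) (hB : MeasurableSet B) (h : μ A = μ B) (hfin : μ B ≠ ⊤) :
    μ.real (B \ A) = μ.real (symmDiff A B) / 2 := by
  have h1 := measureReal_sdiff_eq_of_measure_eq hA hB h hfin
  have h2 : μ.real (symmDiff A B) = μ.real (A \ B) + μ.real (B \ A) := by
    rw [Set.symmDiff_def]
    exact measureReal_union disjoint_sdiff_sdiff (hB.diff hA)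
      ((measure_mono sdiff_subset).trans_lt (h ▸ hfin).lt_top).ne
      ((measure_mono sdiff_subset).trans_lt hfin.lt_top).ne
  linarith

/-! ### From the gain to the quantitative inequality -/

/-- The leaf radius is at least `R`. This gives the sign of the defect, needed to add it as an
extended nonnegative number. -/
theorem divergence_calib_le_of_lt {ε τ R δ η : ℝ} {p : Heis} (hε : 0 < ε) (hη : 0 < η) (hδ : 0 ≤ δ)
    (hδR : δ < R) (hp : p ∈ halfCylinder ε τ R δ) (h : p.2 < height ε τ R p.1) :
    divergence (calibField ε τ (calibDepth ε τ R (rimDepth R δ) η)) p ≤ 2 / (ε * R) := by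
  have hR : 0 < R := hδ.trans_lt hδR
  refine (divergence_calib_le hε hη hδ hδR hp h).trans ?_
  have hM := depth_le_leafDepth rimDepth_nonneg (leafGap_pos (η := η) hε hδ hδR hp h.le)
    (leafGap_le hε h.le _)
  have hw := depth_pos hp.1
  have hle : R ≤ √(‖p.1‖ ^ 2 + leafDepth ε τ R (rimDepth R δ) η p ^ 2) := by
    conv_lhs => rw [← sqrt_norm_sq_add_depth_sq hp.1]
    gcongr
  gcongr

/-- A lower bound for the divergence defect by a power of the gap gives a quantitative
isoperimetric inequality. -/
theorem area_sphere_add_le_of_gain {ε τ R δ c B : ℝ} (hε : 0 < ε) (hδ : 0 ≤ δ)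
    (hδR : δ < R) {E : Set Heis} (hE : IsSmoothOpen E) (hvol : volume E = volume (domain ε τ R))
    (hcc : CompactlyContained (symmDiff E (domain ε τ R)) (halfCylinder ε τ R δ)) (hc : 0 ≤ c)
    (j : ℕ) (hgain : ∀ η, 0 < η → ∀ p ∈ halfCylinder ε τ R δ, p.2 < height ε τ R p.1 →
      c * (scaledGap ε τ R p ^ j - B * η) ≤ 2 / (ε * R)
        - divergence (calibField ε τ (calibDepth ε τ R (rimDepth R δ) η)) p) :
    area ε τ (sphere ε τ R) + ENNReal.ofReal (c / (ε ^ 3 * omega ε τ R) ^ j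
        * ((volume.real (symmDiff E (domain ε τ R)) / 2) ^ (j + 1)
          / ((j + 1) * (Real.pi * R ^ 2) ^ j)))
      ≤ area ε τ (frontier E) := by
  have hR : 0 < R := hδ.trans_lt hδR
  have hK : 0 < ε ^ 3 * omega ε τ R := slopeBound_pos hε
  set D := domain ε τ R with hD
  have hDm : MeasurableSet D := (isOpen_domain ε τ R).measurableSet
  have hEm : MeasurableSet E := hE.1.measurableSet
  have hDfin : volume D ≠ ⊤ := (volume_domain_lt_top hε τ R).ne
  have hGfin : volume (D \ E) ≠ ⊤ := ((measure_mono sdiff_subset).trans_lt hDfin.lt_top).ne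
  rw [← measureReal_sdiff_eq_half_symmDiff hEm hDm hvol hDfin]
  have hG : ∀ p ∈ D \ E, p ∈ halfCylinder ε τ R δ ∧ p.2 < height ε τ R p.1 := fun p hp =>
    ⟨hcc.2 (subset_closure (Or.inr hp)), (le_abs_self _).trans_lt hp.1.1⟩
  have hcont : Continuous fun p : Heis => (height ε τ R p.1 - p.2) ^ j :=
    (((continuous_height ε τ R).comp continuous_fst).sub continuous_snd).pow j
  have hgap : IntegrableOn (fun p : Heis => (height ε τ R p.1 - p.2) ^ j) (D \ E) := by
    obtain ⟨K, hKc, hDK⟩ := exists_isCompact_domain_subset hε τ R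
    exact (hcont.continuousOn.integrableOn_compact hKc).mono_set (sdiff_subset.trans hDK)
  have hbath := volume_pow_le_setIntegral_gap (continuous_height ε τ R) hR (hDm.diff hEm) hGfin
    (fun p hp => ⟨(hG p hp).1.1, (hG p hp).2⟩) j hgap
  set m := volume.real (D \ E)
  set S := c / (ε ^ 3 * omega ε τ R) ^ j * (m ^ (j + 1) / ((j + 1) * (Real.pi * R ^ 2) ^ j))
  have hη : ∀ η, 0 < η →
      area ε τ (sphere ε τ R) + ENNReal.ofReal (S - c * B * m * η) ≤ area ε τ (frontier E) := by
    intro η hη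
    obtain ⟨hint, hle⟩ := area_sphere_add_le (η := η) hε hη hδ hδR hE hvol hcc
    refine le_trans ?_ (hle (setIntegral_nonneg (hDm.diff hEm) fun p hp =>
      sub_nonneg.2 (divergence_calib_le_of_lt hε hη hδ hδR (hG p hp).1 (hG p hp).2)))
    refine add_le_add le_rfl (ENNReal.ofReal_le_ofReal ?_)
    have hconst : IntegrableOn (fun _ : Heis => c * B * η) (D \ E) := integrableOn_const hGfin
    have hscaled : IntegrableOn (fun p : Heis => c / (ε ^ 3 * omega ε τ R) ^ j
        * (height ε τ R p.1 - p.2) ^ j) (D \ E) := hgap.const_mul _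
    have hlow : ∫ p in D \ E, (c / (ε ^ 3 * omega ε τ R) ^ j * (height ε τ R p.1 - p.2) ^ j
        - c * B * η) ≤ ∫ p in D \ E, (2 / (ε * R)
        - divergence (calibField ε τ (calibDepth ε τ R (rimDepth R δ) η)) p) := by
      refine setIntegral_mono_on (hscaled.sub hconst) hint (hDm.diff hEm) fun p hp => ?_
      refine le_trans (le_of_eq ?_) (hgain η hη p (hG p hp).1 (hG p hp).2)
      rw [scaledGap, div_pow]
      ring
    rw [integral_sub hscaled hconst, integral_const_mul, setIntegral_const, smul_eq_mul] at hlow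
    have : S ≤ c / (ε ^ 3 * omega ε τ R) ^ j * ∫ p in D \ E, (height ε τ R p.1 - p.2) ^ j :=
      mul_le_mul_of_nonneg_left hbath (by positivity)
    linarith
  -- The areas do not depend on `η`, so the smoothing error disappears in the limit.
  have hlim : Tendsto (fun η => area ε τ (sphere ε τ R) + ENNReal.ofReal (S - c * B * m * η))
      (𝓝[>] 0) (𝓝 (area ε τ (sphere ε τ R) + ENNReal.ofReal S)) := by
    have h1 : Continuous fun η : ℝ => ENNReal.ofReal (S - c * B * m * η) :=
      ENNReal.continuous_ofReal.comp (by fun_prop)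
    have h2 := h1.tendsto 0
    rw [mul_zero, sub_zero] at h2
    exact (h2.mono_left nhdsWithin_le_nhds).const_add _
  exact le_of_tendsto hlim (eventually_mem_nhdsWithin.mono hη)

/-! ### Comparison with the stated constants -/

theorem profile_zero_nonneg {ε : ℝ} (hε : 0 < ε) (τ : ℝ) {R : ℝ} (hR : 0 < R) :
    0 ≤ profile ε τ 0 R := by
  have := height_pos hε τ (z := 0) (by simpa using hR)
  rw [height, norm_zero] at this
  exact this.le

/-- The squared rim depth is `δ(2R - δ) ≥ δR`, and dropping `f(0; R)` from the denominator only
enlarges the constant. -/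
theorem sqrt_mul_constC_le {R ε δ : ℝ} (τ : ℝ) (hR : 0 < R) (hε : 0 < ε) (hδ : 0 ≤ δ) (hδR : δ < R)
    (v : ℝ) :
    √δ * constC R ε τ * v ^ 2 ≤ 2 * rimDepth R δ / (ε * R ^ 3) / (ε ^ 3 * omega ε τ R) ^ 1
      * ((v / 2) ^ (1 + 1) / (((1 : ℕ) + 1) * (Real.pi * R ^ 2) ^ 1)) := by
  have ha : √δ * √R ≤ rimDepth R δ := by
    rw [← Real.sqrt_mul hδ]
    exact Real.sqrt_le_sqrt (by nlinarith)
  have hf := profile_zero_nonneg hε τ hR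
  have hK : 0 < ε ^ 3 * omega ε τ R := slopeBound_pos hε
  rw [constC, constK]
  set K := ε ^ 3 * omega ε τ R
  have hsR : 0 < √R := Real.sqrt_pos.2 hR
  have e : 2 * rimDepth R δ / (ε * R ^ 3) / K ^ 1
      * ((v / 2) ^ (1 + 1) / (((1 : ℕ) + 1) * (Real.pi * R ^ 2) ^ 1))
      = rimDepth R δ * (v ^ 2 / (4 * Real.pi * ε * R ^ 5 * K)) := by
    push_cast
    field_simp
    ring
  have h1 : √δ * (1 / (4 * Real.pi * ε * R ^ 3 * (R * (K * √R) + profile ε τ 0 R))) * v ^ 2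
      ≤ √δ * (1 / (4 * Real.pi * ε * R ^ 3 * (R * (K * √R)))) * v ^ 2 := by
    gcongr
    linarith
  have h2 : √δ * (1 / (4 * Real.pi * ε * R ^ 3 * (R * (K * √R)))) * v ^ 2
      = √δ * √R * (v ^ 2 / (4 * Real.pi * ε * R ^ 5 * K)) := by
    field_simp
    rw [Real.sq_sqrt hR.le]
  rw [e]
  refine h1.trans (h2.le.trans ?_)
  gcongr

/-- Without the term `f(0; R)²` in the denominator the two sides agree exactly. -/
theorem constD_mul_le {R ε : ℝ} (τ : ℝ) (hR : 0 < R) (hε : 0 < ε) {v : ℝ} (hv : 0 ≤ v) :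
    constD R ε τ * v ^ 3 ≤ 1 / (2 * ε * R ^ 3) / (ε ^ 3 * omega ε τ R) ^ 2
      * ((v / 2) ^ (2 + 1) / (((2 : ℕ) + 1) * (Real.pi * R ^ 2) ^ 2)) := by
  have hK : 0 < ε ^ 3 * omega ε τ R := slopeBound_pos hε
  rw [constD, constK]
  set K := ε ^ 3 * omega ε τ R
  have hsR : √R ^ 2 = R := Real.sq_sqrt hR.le
  have e : 1 / (2 * ε * R ^ 3) / K ^ 2
      * ((v / 2) ^ (2 + 1) / (((2 : ℕ) + 1) * (Real.pi * R ^ 2) ^ 2))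
      = 1 / (12 * ε * Real.pi ^ 2 * R ^ 5 * (4 * R * (K ^ 2 * R))) * v ^ 3 := by
    push_cast
    field_simp
    ring
  rw [e, mul_pow K, hsR]
  gcongr
  nlinarith [sq_nonneg (profile ε τ 0 R)]

end Heis

end

theorem mainTheorem3 (R ε τ : ℝ) (hR : 0 < R) (hε : 0 < ε) (E : Set Heis)
    (hE : Heis.IsSmoothOpen E) (hvol : volume E = volume (Heis.domain ε τ R)) :
    Heis.area ε τ (Heis.sphere ε τ R) ≠ ⊤ ∧
    (∀ δ : ℝ, 0 < δ → δ < R →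
      Heis.CompactlyContained (symmDiff E (Heis.domain ε τ R)) (Heis.halfCylinder ε τ R δ) →
      Heis.area ε τ (Heis.sphere ε τ R)
          + ENNReal.ofReal
            (√δ * Heis.constC R ε τ * volume.real (symmDiff E (Heis.domain ε τ R)) ^ 2)
        ≤ Heis.area ε τ (frontier E)) ∧
    (Heis.CompactlyContained (symmDiff E (Heis.domain ε τ R)) (Heis.halfCylinder ε τ R 0) →
      Heis.area ε τ (Heis.sphere ε τ R)
          + ENNReal.ofReal
            (Heis.constD R ε τ * volume.real (symmDiff E (Heis.domain ε τ R)) ^ 3)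
        ≤ Heis.area ε τ (frontier E)) := by
  refine ⟨(Heis.area_sphere_lt_top hε τ hR).ne, fun δ hδ hδR hcc => ?_, fun hcc => ?_⟩
  · have hc : 0 ≤ 2 * Heis.rimDepth R δ / (ε * R ^ 3) := by
      have := Heis.rimDepth_nonneg (R := R) (δ := δ)
      positivity
    refine le_trans (add_le_add le_rfl (ENNReal.ofReal_le_ofReal
      (Heis.sqrt_mul_constC_le τ hR hε hδ.le hδR _)))
      (Heis.area_sphere_add_le_of_gain (B := 1) hε hδ.le hδR hE hvol hcc hc 1
        fun η hη p hp h => ?_)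
    rw [pow_one, one_mul]
    exact Heis.gain_linear hε hη hδ hδR hp h
  · exact le_trans (add_le_add le_rfl (ENNReal.ofReal_le_ofReal
      (Heis.constD_mul_le τ hR hε measureReal_nonneg)))
      -- The error coefficient `2R` comes from `(d - η)² ≥ d² - 2Rη` for `d ≤ R`.
      (Heis.area_sphere_add_le_of_gain (B := 2 * R) hε le_rfl hR hE hvol hcc (by positivity) 2
        fun η hη p hp h => Heis.gain_quadratic hε hη hR hp h)
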